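/- **Definitions.** A walk on $\mathbb Z^2$ starts at the origin and takes unit north, east, south or west steps. It is *prudent* if it never takes a step towards an already visited node (that is, no visited node lies on the open half-line issuing from the current position in the direction of the next step); such a walk is self-avoiding. It is *3-sided* if after every number of steps its endpoint lies on the north, east or west side of the bounding box (smallest lattice rectangle) of the part walked so far, and moreover, whenever this box has non-zero width, a south step is never followed by a west step from the east side of the box, nor by an east step from the west side of the box. A *3-sided prudent polygon* is a 3-sided prudent walk with at least two steps that ends at a node adjacent to the origin; its *area* is the area enclosed by the walk together with the closing edge. Let $PA_n$ be the number of 3-sided prudent polygons of area $n$ (it is finite) and let $PA(q)=\sum_{n}PA_nq^n$. Put $(x;q)_\infty=\prod_{j\ge 0}(1-xq^j)$ and $$u=\frac{q}{1-q},\quad v=\frac{1-q+q^2}{1-q},\quad C(q)=\frac{2q(3-10q+9q^2-q^3)}{(1-q)(1-2q)^2},\quad A(q)=\frac{2q(1-q)^2}{(1-2q)^2},$$ $$Q(z;q)=\frac{(vz;q)_\infty}{(quz;q)_\infty},\qquad d_\nu(q)=[z^\nu]\frac1{Q(z;q)}.$$ For $k\ge 2$ let $\overline z_k$ be the root of $1-2x+x^{k+2}$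 in $(0,1)$; this root is unique. **Lemma.** (i) The power series $PA(q)$ converges for $|q|<\frac12$ and its sum extends to a function, still denoted $PA(q)$, that is analytic at all points of the slit disc $\mathcal D_0=\{q\in\mathbb C: |q|<\frac{55}{100},\ q\notin[\frac12,\frac{55}{100}]\}$. For every $q\in\mathcal D_0$ the denominators below do not vanish, the series converges, and $$PA(q)=C(q)-A(q)\frac{(v;q)_\infty}{(qu;q)_\infty}\left[\frac{q^2}{(1-q)^2}+\sum_{\nu\ge1}d_\nu(q)\frac{q^{\nu+2}}{1-2q+q^{\nu+2}}\right].$$ (ii) One has $\frac12<\overline z_k<\frac{55}{100}$ for all $k\ge2$, and $\overline z_k\to\frac12$ as $k\to\infty$. The function $PA(q)$ extends further to a meromorphic function in the disc $|q|<\frac{55}{100}$ punctured at $\frac12$; it has a simple pole at each $\overline z_k$, $k\ge2$, and is analytic at every other point of the punctured disc. (iii) Consequently $PA(q)$ is non-holonomic: it satisfies no linear differential equation with polynomial coefficients in $\mathbb C[q]$, not all zero. In particular, $PA(q)$ is transcendental over $\mathbb C(q)$. -/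

import Mathlib

open scoped Polynomial PowerSeries Topology

namespace Prudent

/-- The unit steps of the square lattice. -/
inductive Step
  | north
  | east
  | south
  | west

/-- The displacement of a step. -/
def Step.vec : Step → ℤ × ℤ
  | .north => (0, 1)
  | .east => (1, 0)
  | .south => (0, -1)
  | .west => (-1, 0)

/-- A walk on `ℤ²` starting at the origin, given by its sequence of steps. -/
abbrev Walk := List Step

/-- The position of the walk after its first `i` steps. -/
def Walk.pos (w : Walk) (i : ℕ) : ℤ × ℤ := ((w.take i).map Step.vec).sum

/-- A walk is prudent if it never takes a step towards an already occupied node: no node visited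
so far lies on the open half-line that starts at the current position and points in the direction
of the next step. (Taking `t = 1`, such a walk is self-avoiding.) -/
def Walk.IsPrudent (w : Walk) : Prop :=
  ∀ (i : ℕ) (hi : i < w.length), ∀ j ≤ i, ∀ t : ℕ, 1 ≤ t →
    w.pos j ≠ w.pos i + (t : ℤ) • (w[i]).vec

/-- After `i` steps, the walk is on the north side of its current bounding box. -/
def Walk.OnNorth (w : Walk) (i : ℕ) : Prop := ∀ j ≤ i, (w.pos j).2 ≤ (w.pos i).2

/-- After `i` steps, the walk is on the east side of its current bounding box. -/
def Walk.OnEast (w : Walk) (i : ℕ) : Prop := ∀ j ≤ i, (w.pos j).1 ≤ (w.pos i).1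

/-- After `i` steps, the walk is on the west side of its current bounding box. -/
def Walk.OnWest (w : Walk) (i : ℕ) : Prop := ∀ j ≤ i, (w.pos i).1 ≤ (w.pos j).1

/-- After `i` steps, the bounding box of the walk has non-zero width. -/
def Walk.WideBox (w : Walk) (i : ℕ) : Prop := ∃ j ≤ i, ∃ k ≤ i, (w.pos j).1 ≠ (w.pos k).1

/-- A walk is 3-sided if it is always on the north, east or west side of its current bounding box,
where moreover, when the box has non-zero width, a south step must not be followed by a west step
on the east side of the box, nor by an east step on the west side of the box. -/
def Walk.IsThreeSided (w : Walk) : Prop :=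
  (∀ i ≤ w.length, w.OnNorth i ∨ w.OnEast i ∨ w.OnWest i) ∧
  ∀ (i : ℕ) (hi : i + 1 < w.length), w[i] = Step.south → w.WideBox (i + 1) →
    (w.OnEast (i + 1) → w[i + 1] ≠ Step.west) ∧ (w.OnWest (i + 1) → w[i + 1] ≠ Step.east)

/-- The walk has at least two steps and ends at a node adjacent to its starting point; closing it
up by one more edge gives a polygon. -/
def Walk.IsAlmostClosed (w : Walk) : Prop :=
  2 ≤ w.length ∧ |(w.pos w.length).1| + |(w.pos w.length).2| = 1

/-- The area enclosed by the closed walk obtained by joining the last node to the origin: the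
absolute value of `∮ x dy`, the last summand being the contribution of the closing edge. -/
def Walk.area (w : Walk) : ℕ :=
  (∑ i ∈ Finset.range w.length, (w.pos i).1 * ((w.pos (i + 1)).2 - (w.pos i).2)
    + (w.pos w.length).1 * (0 - (w.pos w.length).2)).natAbs

/-- The 3-sided prudent polygons of area `n`. -/
def polygons (n : ℕ) : Set Walk :=
  {w | w.IsPrudent ∧ w.IsThreeSided ∧ w.IsAlmostClosed ∧ w.area = n}

/-- The area generating function of 3-sided prudent polygons. -/
noncomputable def PA : ℂ⟦X⟧ := PowerSeries.mk fun n => ((polygons n).ncard : ℂ)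

/-- The infinite `q`-Pochhammer symbol `(x; q)_∞`. -/
noncomputable def qPoch (x q : ℂ) : ℂ := ∏' j : ℕ, (1 - x * q ^ j)

noncomputable def u (q : ℂ) : ℂ := q / (1 - q)

noncomputable def v (q : ℂ) : ℂ := (1 - q + q ^ 2) / (1 - q)

noncomputable def C (q : ℂ) : ℂ :=
  2 * q * (3 - 10 * q + 9 * q ^ 2 - q ^ 3) / ((1 - q) * (1 - 2 * q) ^ 2)

noncomputable def A (q : ℂ) : ℂ := 2 * q * (1 - q) ^ 2 / (1 - 2 * q) ^ 2

/-- `Q(z; q) = (v z; q)_∞ / (q u z; q)_∞`. -/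
noncomputable def Q (z q : ℂ) : ℂ := qPoch (v q * z) q / qPoch (q * u q * z) q

/-- The coefficient of `z ^ ν` in the Taylor expansion of `1 / Q(z; q)` at `z = 0`. -/
noncomputable def d (ν : ℕ) (q : ℂ) : ℂ :=
  iteratedDeriv ν (fun z : ℂ => 1 / Q z q) 0 / (ν.factorial : ℂ)

/-- The smallest root in `[0, 1]` of `1 - 2 x + x ^ (k + 2)` (the number `1` is always a root). -/
noncomputable def zbar (k : ℕ) : ℝ :=
  sInf {x : ℝ | x ∈ Set.Icc 0 1 ∧ 1 - 2 * x + x ^ (k + 2) = 0}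

/-- The disc `|q| < 55/100` slit along the real interval `[1/2, 55/100]`. -/
def slitDisc : Set ℂ :=
  {q : ℂ | ‖q‖ < 55 / 100 ∧ ∀ x : ℝ, x ∈ Set.Icc (1 / 2) (55 / 100) → q ≠ (x : ℂ)}

/-- The disc `|q| < 55/100` punctured at `1/2`. -/
def puncturedDisc : Set ℂ := {q : ℂ | ‖q‖ < 55 / 100 ∧ q ≠ 1 / 2}

/-- A power series is holonomic (D-finite) if it satisfies a non-trivial linear differential
equation with polynomial coefficients. -/
def IsHolonomic (F : ℂ⟦X⟧) : Prop :=
  ∃ (r : ℕ) (p : ℕ → ℂ[X]), p r ≠ 0 ∧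
    ∑ i ∈ Finset.range (r + 1), (p i : ℂ⟦X⟧) * (PowerSeries.derivative ℂ)^[i] F = 0

end Prudent

/-!
Up to reflection in the `y`-axis, a 3-sided prudent polygon is either one of two simple families,
with generating functions `q / (1 - q)` and `q / (1 - 2 q)`, or it follows a prudent walk in the
half-plane `x ≥ 0` up to a last north step and closes up along the line `x = -1`. Recording where
each step that enlarges the bounding box is taken gives recurrences for the number of these walks
by area and width. For their generating function `R(t)`, with `t` marking the width, they amount to
a linear relation between `R(t)` and `R(q t)`. For small `q` this relation has a contraction factor
less than one, hence at most one bounded solution, and the coefficients `d ν q` of `1 / Q`, which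
Cauchy's `q`-binomial theorem makes explicit, produce one. Setting `t = 1` gives the formula for
`PA(q)`.

The explicit coefficients are bounded by a multiple of `(7 / 4) ^ ν`, and `7 / 4 * 55 / 100 < 1`, so
the series converges in the whole disc `|q| < 55 / 100`, away from `1 / 2` and the zeros of its
denominators. The only such zero of the `k`-th denominator is `zbar k`; it is a zero of no other
denominator, and the numerator does not vanish there, so it is a simple pole. The order of the pole
at all of the infinitely many points `zbar k` strictly increases along the sequence of derivatives
of `PA`, and along the sequence of its powers. Hence in a linear combination with polynomial
coefficients, the pole of the last term survives at every `zbar k` that is not a root of its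
coefficient, and the combination is not zero.
-/

namespace Prudent

/-! ### Visited nodes of walks -/

/-- The last node of a walk. -/
def endpoint (w : Walk) : ℤ × ℤ := (w.map Step.vec).sum

/-- The set of nodes of a walk, both ends included. -/
def visited (w : Walk) : Set (ℤ × ℤ) := {p | ∃ j ≤ w.length, w.pos j = p}

lemma pos_length (w : Walk) : w.pos w.length = endpoint w := by
  simp [Walk.pos, endpoint]

lemma pos_append_of_le (w r : Walk) {i : ℕ} (h : i ≤ w.length) :
    Walk.pos (w ++ r) i = w.pos i := by
  simp [Walk.pos, List.take_append_of_le_length h]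

lemma endpoint_append (w r : Walk) : endpoint (w ++ r) = endpoint w + endpoint r := by
  simp [endpoint]

lemma endpoint_singleton (s : Step) : endpoint [s] = s.vec := by simp [endpoint]

lemma endpoint_snoc (w : Walk) (s : Step) : endpoint (w ++ [s]) = endpoint w + s.vec := by
  rw [endpoint_append, endpoint_singleton]

lemma endpoint_replicate (k : ℕ) (s : Step) :
    endpoint (List.replicate k s) = (k : ℤ) • s.vec := by
  simp [endpoint]

lemma endpoint_mem_visited (w : Walk) : endpoint w ∈ visited w := ⟨_, le_rfl, pos_length w⟩

lemma zero_mem_visited (w : Walk) : (0 : ℤ × ℤ) ∈ visited w :=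
  ⟨0, Nat.zero_le _, by simp [Walk.pos]⟩

lemma visited_nil : visited [] = {0} := by
  ext p
  simp [visited, Walk.pos, eq_comm]

lemma forall_mem_visited {w : Walk} {P : ℤ × ℤ → Prop} :
    (∀ p ∈ visited w, P p) ↔ ∀ j ≤ w.length, P (w.pos j) :=
  ⟨fun h j hj ↦ h _ ⟨j, hj, rfl⟩, by rintro h _ ⟨j, hj, rfl⟩; exact h j hj⟩

lemma visited_subset_append (w r : Walk) : visited w ⊆ visited (w ++ r) :=
  forall_mem_visited.2 fun j hj ↦ ⟨j, by simp; omega, pos_append_of_le w r hj⟩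

lemma mem_visited_snoc {w : Walk} {s : Step} {p : ℤ × ℤ} :
    p ∈ visited (w ++ [s]) ↔ p ∈ visited w ∨ p = endpoint w + s.vec := by
  rw [← endpoint_snoc]
  constructor
  · rintro ⟨j, hj, rfl⟩
    rcases hj.lt_or_eq with h | rfl
    · have h : j ≤ w.length := by simpa [Nat.lt_succ_iff] using h
      exact Or.inl ⟨j, h, (pos_append_of_le w [s] h).symm⟩
    · exact Or.inr (pos_length _)
  · rintro (h | rfl)
    · exact visited_subset_append _ _ h
    · exact endpoint_mem_visited _

lemma mem_visited_append_replicate {w : Walk} {s : Step} {k : ℕ} {p : ℤ × ℤ} :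
    p ∈ visited (w ++ List.replicate k s) ↔
      p ∈ visited w ∨ ∃ j ≤ k, p = endpoint w + (j : ℤ) • s.vec := by
  induction k with
  | zero => simpa using fun h ↦ h ▸ endpoint_mem_visited w
  | succ k ih =>
    rw [List.replicate_succ', ← List.append_assoc, mem_visited_snoc, ih, endpoint_append,
      endpoint_replicate]
    simp only [Nat.le_succ_iff_eq_or_le, or_and_right, exists_or, exists_eq_left, Nat.cast_succ,
      add_smul, one_smul, add_assoc]
    rw [or_assoc, or_comm (a := ∃ j ≤ k, _)]

/-! ### Prudent 3-sided walks, one step at a time -/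

/-- The walk ends on the north side of its bounding box. -/
def AtNorth (w : Walk) : Prop := ∀ p ∈ visited w, p.2 ≤ (endpoint w).2

/-- The walk ends on the east side of its bounding box. -/
def AtEast (w : Walk) : Prop := ∀ p ∈ visited w, p.1 ≤ (endpoint w).1

/-- The walk ends on the west side of its bounding box. -/
def AtWest (w : Walk) : Prop := ∀ p ∈ visited w, (endpoint w).1 ≤ p.1

/-- The walk ends on the north, east or west side of its bounding box. -/
def OnSide (w : Walk) : Prop := AtNorth w ∨ AtEast w ∨ AtWest w

/-- The rule about the steps that may follow a south step allows `s` as the next step of `w`. -/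
def TurnAllowed (w : Walk) (s : Step) : Prop :=
  w.getLast? = some Step.south → (∃ p ∈ visited w, ∃ p' ∈ visited w, p.1 ≠ p'.1) →
    (AtEast w → s ≠ Step.west) ∧ (AtWest w → s ≠ Step.east)

/-- No node of `w` lies ahead of its last node in the direction `s`. -/
def ClearAhead (w : Walk) (s : Step) : Prop :=
  ∀ p ∈ visited w, ∀ t : ℕ, 1 ≤ t → p ≠ endpoint w + (t : ℤ) • s.vec

/-- Prudent 3-sided walks. -/
def Admissible (w : Walk) : Prop := w.IsPrudent ∧ w.IsThreeSided

/-- The two products are the cross product and the inner product of `p - endpoint w` with `s`. -/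
lemma clearAhead_iff {w : Walk} {s : Step} :
    ClearAhead w s ↔ ∀ p ∈ visited w,
      (p.1 - (endpoint w).1) * s.vec.2 - (p.2 - (endpoint w).2) * s.vec.1 = 0 →
      (p.1 - (endpoint w).1) * s.vec.1 + (p.2 - (endpoint w).2) * s.vec.2 ≤ 0 := by
  refine forall₂_congr fun p _ ↦ ⟨fun h hcross ↦ ?_, fun h t ht he ↦ ?_⟩
  · by_contra! hpos
    refine h ((p.1 - (endpoint w).1) * s.vec.1 + (p.2 - (endpoint w).2) * s.vec.2).toNat
      (by omega) ?_
    rw [Int.toNat_of_nonneg hpos.le]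
    ext <;> cases s <;> simp [Step.vec] at hcross ⊢ <;> omega
  · subst he
    cases s <;> simp [Step.vec] at h <;> omega

lemma clearAhead_north {w : Walk} : ClearAhead w Step.north ↔
    ∀ p ∈ visited w, p.1 = (endpoint w).1 → p.2 ≤ (endpoint w).2 := by
  simp [clearAhead_iff, Step.vec, sub_eq_zero]

lemma clearAhead_south {w : Walk} : ClearAhead w Step.south ↔
    ∀ p ∈ visited w, p.1 = (endpoint w).1 → (endpoint w).2 ≤ p.2 := by
  simp [clearAhead_iff, Step.vec, sub_eq_zero, eq_comm (a := (endpoint w).1)]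

lemma clearAhead_east {w : Walk} : ClearAhead w Step.east ↔
    ∀ p ∈ visited w, p.2 = (endpoint w).2 → p.1 ≤ (endpoint w).1 := by
  simp [clearAhead_iff, Step.vec, sub_eq_zero, eq_comm (a := (endpoint w).2)]

lemma clearAhead_west {w : Walk} : ClearAhead w Step.west ↔
    ∀ p ∈ visited w, p.2 = (endpoint w).2 → (endpoint w).1 ≤ p.1 := by
  simp [clearAhead_iff, Step.vec, sub_eq_zero]

lemma ClearAhead.notMem {w : Walk} {s : Step} (h : ClearAhead w s) :
    endpoint w + s.vec ∉ visited w :=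
  fun hm ↦ h _ hm 1 le_rfl (by simp)

lemma turnAllowed_of_getLast? {w : Walk} {s : Step} (h : w.getLast? ≠ some Step.south) :
    TurnAllowed w s :=
  fun h' ↦ absurd h' h

lemma turnAllowed_north {w : Walk} : TurnAllowed w Step.north := by simp [TurnAllowed]

lemma turnAllowed_south {w : Walk} : TurnAllowed w Step.south := by simp [TurnAllowed]

lemma AtEast.turnAllowed_east {w : Walk} (h : AtEast w) : TurnAllowed w Step.east := by
  rintro _ ⟨p, hp, p', hp', hne⟩
  refine ⟨fun _ ↦ by simp, fun h' ↦ absurd ?_ hne⟩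
  exact (le_antisymm (h p hp) (h' p hp)).trans (le_antisymm (h p' hp') (h' p' hp')).symm

lemma TurnAllowed.append_self {w : Walk} {s : Step} (h : TurnAllowed w s) (k : ℕ) :
    TurnAllowed (w ++ List.replicate k s) s := by
  rcases k with _ | k
  · simpa using h
  · intro hl
    rw [List.replicate_succ', ← List.append_assoc, List.getLast?_concat] at hl
    cases hl
    simp

lemma onNorth_append {w r : Walk} {i : ℕ} (h : i ≤ w.length) :
    Walk.OnNorth (w ++ r) i ↔ w.OnNorth i :=
  forall₂_congr fun j hj ↦ by rw [pos_append_of_le w r h, pos_append_of_le w r (hj.trans h)]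

lemma onEast_append {w r : Walk} {i : ℕ} (h : i ≤ w.length) :
    Walk.OnEast (w ++ r) i ↔ w.OnEast i :=
  forall₂_congr fun j hj ↦ by rw [pos_append_of_le w r h, pos_append_of_le w r (hj.trans h)]

lemma onWest_append {w r : Walk} {i : ℕ} (h : i ≤ w.length) :
    Walk.OnWest (w ++ r) i ↔ w.OnWest i :=
  forall₂_congr fun j hj ↦ by rw [pos_append_of_le w r h, pos_append_of_le w r (hj.trans h)]

lemma wideBox_append {w r : Walk} {i : ℕ} (h : i ≤ w.length) :
    Walk.WideBox (w ++ r) i ↔ w.WideBox i :=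
  exists_congr fun j ↦ and_congr_right fun hj ↦ exists_congr fun k ↦ and_congr_right fun hk ↦ by
    rw [pos_append_of_le w r (hj.trans h), pos_append_of_le w r (hk.trans h)]

lemma onNorth_length {w : Walk} : w.OnNorth w.length ↔ AtNorth w := by
  rw [Walk.OnNorth, pos_length, AtNorth, forall_mem_visited]

lemma onEast_length {w : Walk} : w.OnEast w.length ↔ AtEast w := by
  rw [Walk.OnEast, pos_length, AtEast, forall_mem_visited]

lemma onWest_length {w : Walk} : w.OnWest w.length ↔ AtWest w := by
  rw [Walk.OnWest, pos_length, AtWest, forall_mem_visited]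

lemma wideBox_length {w : Walk} :
    w.WideBox w.length ↔ ∃ p ∈ visited w, ∃ p' ∈ visited w, p.1 ≠ p'.1 := by
  rw [← not_iff_not]
  simp only [Walk.WideBox, not_exists, not_and, forall_mem_visited]

lemma isPrudent_snoc {w : Walk} {s : Step} :
    Walk.IsPrudent (w ++ [s]) ↔ w.IsPrudent ∧ ClearAhead w s := by
  have old {i j : ℕ} (hi : i < w.length) (hj : j ≤ i) (t : ℤ) :
      Walk.pos (w ++ [s]) j ≠ Walk.pos (w ++ [s]) i + t • ((w ++ [s])[i]'(by simp; omega)).vec ↔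
        w.pos j ≠ w.pos i + t • w[i].vec := by
    rw [pos_append_of_le w [s] hi.le, pos_append_of_le w [s] (hj.trans hi.le),
      List.getElem_append_left hi]
  have new {j : ℕ} (hj : j ≤ w.length) (t : ℤ) :
      Walk.pos (w ++ [s]) j ≠
        Walk.pos (w ++ [s]) w.length + t • ((w ++ [s])[w.length]'(by simp)).vec ↔
      w.pos j ≠ endpoint w + t • s.vec := by
    rw [pos_append_of_le w [s] le_rfl, pos_append_of_le w [s] hj, pos_length,
      List.getElem_concat_length rfl]
  rw [ClearAhead, forall_mem_visited]
  refine ⟨fun h ↦ ⟨fun i hi j hj t ht ↦ (old hi hj t).1 (h i (by simp; omega) j hj t ht),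
    fun j hj t ht ↦ (new hj t).1 (h w.length (by simp) j hj t ht)⟩,
    fun ⟨h, hc⟩ i hi j hj t ht ↦ ?_⟩
  rcases (Nat.lt_succ_iff.1 (by simpa using hi)).lt_or_eq with hl | rfl
  · exact (old hl hj t).2 (h i hl j hj t ht)
  · exact (new hj t).2 (hc j hj t ht)

lemma turnAllowed_iff {w : Walk} {s : Step} : TurnAllowed w s ↔ ∀ i (hi : i + 1 = w.length),
    w[i] = Step.south → w.WideBox (i + 1) →
      (w.OnEast (i + 1) → s ≠ Step.west) ∧ (w.OnWest (i + 1) → s ≠ Step.east) := by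
  constructor
  · intro h i hi hs hw
    rw [hi, wideBox_length] at hw
    rw [hi, onEast_length, onWest_length]
    refine h ?_ hw
    rw [List.getLast?_eq_getElem?, ← hi, Nat.add_sub_cancel, ← hs, List.getElem?_eq_getElem]
  · intro h hl hw
    obtain ⟨w', rfl⟩ := List.getLast?_eq_some_iff.1 hl
    have h := h w'.length (by simp) (by simp)
    rw [show w'.length + 1 = (w' ++ [Step.south]).length by simp, wideBox_length, onEast_length,
      onWest_length] at h
    exact h hw

lemma isThreeSided_snoc {w : Walk} {s : Step} :
    Walk.IsThreeSided (w ++ [s]) ↔ w.IsThreeSided ∧ OnSide (w ++ [s]) ∧ TurnAllowed w s := by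
  have hsides : (∀ i ≤ (w ++ [s]).length, Walk.OnNorth (w ++ [s]) i ∨ Walk.OnEast (w ++ [s]) i ∨
      Walk.OnWest (w ++ [s]) i) ↔
      (∀ i ≤ w.length, w.OnNorth i ∨ w.OnEast i ∨ w.OnWest i) ∧ OnSide (w ++ [s]) := by
    rw [OnSide, ← onNorth_length, ← onEast_length, ← onWest_length, List.length_append,
      List.length_singleton, ← Order.succ_eq_add_one]
    simp only [Order.le_succ_iff_eq_or_le, or_imp, forall_and, forall_eq, and_comm]
    exact and_congr_right fun _ ↦ forall₂_congr fun i hi ↦ by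
      rw [onNorth_append hi, onEast_append hi, onWest_append hi]
  have hturns : (∀ (i : ℕ) (hi : i + 1 < (w ++ [s]).length), (w ++ [s])[i] = Step.south →
      Walk.WideBox (w ++ [s]) (i + 1) →
        (Walk.OnEast (w ++ [s]) (i + 1) → (w ++ [s])[i + 1] ≠ Step.west) ∧
        (Walk.OnWest (w ++ [s]) (i + 1) → (w ++ [s])[i + 1] ≠ Step.east)) ↔
      (∀ (i : ℕ) (hi : i + 1 < w.length), w[i] = Step.south → w.WideBox (i + 1) →
        (w.OnEast (i + 1) → w[i + 1] ≠ Step.west) ∧ (w.OnWest (i + 1) → w[i + 1] ≠ Step.east)) ∧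
      TurnAllowed w s := by
    rw [turnAllowed_iff]
    have old (i : ℕ) (hi : i + 1 ≤ w.length) : (w ++ [s])[i]'(by simp; omega) = w[i] :=
      List.getElem_append_left hi
    have new (i : ℕ) (hi : i + 1 = w.length) : (w ++ [s])[i + 1]'(by simp; omega) = s :=
      List.getElem_concat_length hi _
    refine ⟨fun h ↦ ⟨fun i hi hs hw ↦ ?_, fun i hi hs hw ↦ ?_⟩, fun ⟨h, h'⟩ i hi hs hw ↦ ?_⟩
    · simpa only [onEast_append hi.le, onWest_append hi.le, old _ hi] using
        h i (by simp; omega) ((old i hi.le).trans hs) ((wideBox_append hi.le).2 hw)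
    · simpa only [onEast_append hi.le, onWest_append hi.le, new i hi] using
        h i (by simp; omega) ((old i hi.le).trans hs) ((wideBox_append hi.le).2 hw)
    · have hi : i + 1 ≤ w.length := by simpa [Nat.lt_succ_iff] using hi
      rw [onEast_append hi, onWest_append hi]
      rw [wideBox_append hi] at hw
      rw [old i hi] at hs
      rcases hi.lt_or_eq with hl | hl
      · simpa only [old _ hl] using h i hl hs hw
      · simpa only [new i hl] using h' i hl hs hw
  rw [Walk.IsThreeSided, hsides, hturns, Walk.IsThreeSided]
  tauto

lemma admissible_nil : Admissible [] :=
  ⟨fun i hi ↦ by simp at hi, fun _ _ ↦ Or.inl fun _ _ ↦ by simp [Walk.pos],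
    fun i hi ↦ by simp at hi⟩

lemma admissible_snoc {w : Walk} {s : Step} : Admissible (w ++ [s]) ↔
    Admissible w ∧ ClearAhead w s ∧ OnSide (w ++ [s]) ∧ TurnAllowed w s := by
  rw [Admissible, isPrudent_snoc, isThreeSided_snoc, Admissible]
  tauto

lemma Admissible.of_append {w r : Walk} (h : Admissible (w ++ r)) : Admissible w := by
  induction r using List.reverseRecOn with
  | nil => simpa using h
  | append_singleton r s ih => exact ih (admissible_snoc.1 (by simpa using h)).1

lemma Admissible.onSide {w : Walk} (h : Admissible w) : OnSide w := by
  rw [OnSide, ← onNorth_length, ← onEast_length, ← onWest_length]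
  exact h.2.1 _ le_rfl

lemma AtNorth.snoc {w : Walk} (h : AtNorth w) : AtNorth (w ++ [Step.north]) := by
  intro p hp
  rw [endpoint_snoc]
  rcases mem_visited_snoc.1 hp with hp | rfl
  · exact (h p hp).trans (by simp [Step.vec])
  · exact le_rfl

lemma AtEast.snoc {w : Walk} (h : AtEast w) : AtEast (w ++ [Step.east]) := by
  intro p hp
  rw [endpoint_snoc]
  rcases mem_visited_snoc.1 hp with hp | rfl
  · exact (h p hp).trans (by simp [Step.vec])
  · exact le_rfl

lemma Admissible.snoc_north {w : Walk} (h : Admissible w) (hn : AtNorth w) :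
    Admissible (w ++ [Step.north]) :=
  admissible_snoc.2 ⟨h, clearAhead_north.2 fun p hp _ ↦ hn p hp, Or.inl hn.snoc,
    turnAllowed_north⟩

lemma Admissible.snoc_east {w : Walk} (h : Admissible w) (he : AtEast w) :
    Admissible (w ++ [Step.east]) :=
  admissible_snoc.2 ⟨h, clearAhead_east.2 fun p hp _ ↦ he p hp, Or.inr (Or.inl he.snoc),
    he.turnAllowed_east⟩

lemma ClearAhead.append_self {w : Walk} {s : Step} (h : ClearAhead w s) (k : ℕ) :
    ClearAhead (w ++ List.replicate k s) s := by
  intro p hp t ht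
  rw [endpoint_append, endpoint_replicate]
  rcases mem_visited_append_replicate.1 hp with hp | ⟨j, hj, rfl⟩
  · have := h p hp (k + t) (by omega)
    rwa [Nat.cast_add, add_smul, ← add_assoc] at this
  · rw [add_assoc, ← add_smul]
    intro he
    have h1 := congrArg Prod.fst (add_left_cancel he)
    have h2 := congrArg Prod.snd (add_left_cancel he)
    cases s <;> simp [Step.vec] at h1 h2 <;> omega

lemma Admissible.append_replicate {w : Walk} {s : Step} {k : ℕ} (h : Admissible w)
    (hk : k ≠ 0 → ClearAhead w s ∧ TurnAllowed w s)
    (hside : ∀ j ≤ k, OnSide (w ++ List.replicate j s)) :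
    Admissible (w ++ List.replicate k s) := by
  induction k with
  | zero => simpa using h
  | succ k ih =>
    have hs := hside (k + 1) le_rfl
    obtain ⟨hclear, hturn⟩ := hk k.succ_ne_zero
    rw [List.replicate_succ', ← List.append_assoc] at hs ⊢
    exact admissible_snoc.2 ⟨ih (fun _ ↦ ⟨hclear, hturn⟩) fun j hj ↦ hside j (by omega),
      hclear.append_self k, hs, hturn.append_self k⟩

/-! ### Signed area -/

/-- The line integral of `x dy` along a walk. -/
def signedArea (w : Walk) : ℤ :=
  ∑ i ∈ Finset.range w.length, (w.pos i).1 * ((w.pos (i + 1)).2 - (w.pos i).2)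

lemma area_eq (w : Walk) :
    w.area = (signedArea w - (endpoint w).1 * (endpoint w).2).natAbs := by
  rw [Walk.area, signedArea, pos_length]
  congr 1
  ring

lemma signedArea_nil : signedArea [] = 0 := by simp [signedArea]

lemma signedArea_snoc (w : Walk) (s : Step) :
    signedArea (w ++ [s]) = signedArea w + (endpoint w).1 * s.vec.2 := by
  have hlast : Walk.pos (w ++ [s]) (w.length + 1) = endpoint w + s.vec := by
    rw [← endpoint_snoc, ← pos_length, List.length_append, List.length_singleton]
  rw [signedArea, List.length_append, List.length_singleton, Finset.sum_range_succ,
    pos_append_of_le w [s] le_rfl, hlast, pos_length, Prod.snd_add, add_sub_cancel_left]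
  congr 1
  refine Finset.sum_congr rfl fun i hi ↦ ?_
  have hi := Finset.mem_range.1 hi
  rw [pos_append_of_le w [s] hi.le, pos_append_of_le w [s] hi]

lemma signedArea_append_replicate (w : Walk) (s : Step) (k : ℕ) :
    signedArea (w ++ List.replicate k s) = signedArea w + k * ((endpoint w).1 * s.vec.2) := by
  induction k with
  | zero => simp
  | succ k ih =>
    rw [List.replicate_succ', ← List.append_assoc, signedArea_snoc, ih, endpoint_append,
      endpoint_replicate]
    cases s <;> simp [Step.vec] <;> ring

/-! ### Reflection in the vertical axis -/

/-- The reflection of a step in the vertical axis. -/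
def Step.mirror : Step → Step
  | .north => .north
  | .east => .west
  | .south => .south
  | .west => .east

/-- The reflection of a walk in the vertical axis. -/
def mirror (w : Walk) : Walk := w.map Step.mirror

lemma mirror_mirror (w : Walk) : mirror (mirror w) = w := by
  have : Step.mirror ∘ Step.mirror = id := by ext s; cases s <;> rfl
  simp [mirror, this]

lemma mirror_injective : Function.Injective mirror :=
  Function.LeftInverse.injective mirror_mirror

lemma length_mirror (w : Walk) : (mirror w).length = w.length := List.length_map _

lemma mirror_append (w r : Walk) : mirror (w ++ r) = mirror w ++ mirror r := List.map_append

lemma mirror_snoc (w : Walk) (s : Step) : mirror (w ++ [s]) = mirror w ++ [s.mirror] :=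
  mirror_append w [s]

lemma endpoint_mirror (w : Walk) : endpoint (mirror w) = (-(endpoint w).1, (endpoint w).2) := by
  induction w using List.reverseRecOn with
  | nil => rfl
  | append_singleton w s ih =>
    rw [mirror_snoc, endpoint_snoc, ih, endpoint_snoc]
    cases s <;> ext <;> simp [Step.mirror, Step.vec] <;> ring

lemma mem_visited_mirror {w : Walk} {p : ℤ × ℤ} :
    p ∈ visited (mirror w) ↔ (-p.1, p.2) ∈ visited w := by
  induction w using List.reverseRecOn with
  | nil => simp [mirror, visited_nil, Prod.ext_iff]
  | append_singleton w s ih =>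
    rw [mirror_snoc, mem_visited_snoc, mem_visited_snoc, ih, endpoint_mirror]
    refine or_congr_right ?_
    rw [Prod.ext_iff, Prod.ext_iff]
    cases s <;> simp [Step.mirror, Step.vec] <;> omega

lemma forall_mem_visited_mirror {w : Walk} {P : ℤ × ℤ → Prop} :
    (∀ p ∈ visited (mirror w), P p) ↔ ∀ p ∈ visited w, P (-p.1, p.2) :=
  ⟨fun h p hp ↦ h _ (mem_visited_mirror.2 (by simpa using hp)),
    fun h p hp ↦ by simpa using h _ (mem_visited_mirror.1 hp)⟩

lemma exists_mem_visited_mirror {w : Walk} {P : ℤ × ℤ → Prop} :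
    (∃ p ∈ visited (mirror w), P p) ↔ ∃ p ∈ visited w, P (-p.1, p.2) := by
  rw [← not_iff_not]
  simp only [not_exists, not_and]
  exact forall_mem_visited_mirror

lemma atNorth_mirror {w : Walk} : AtNorth (mirror w) ↔ AtNorth w := by
  simp only [AtNorth, forall_mem_visited_mirror, endpoint_mirror]

lemma atEast_mirror {w : Walk} : AtEast (mirror w) ↔ AtWest w := by
  simp only [AtEast, AtWest, forall_mem_visited_mirror, endpoint_mirror, neg_le_neg_iff]

lemma atWest_mirror {w : Walk} : AtWest (mirror w) ↔ AtEast w := by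
  simp only [AtEast, AtWest, forall_mem_visited_mirror, endpoint_mirror, neg_le_neg_iff]

lemma onSide_mirror {w : Walk} : OnSide (mirror w) ↔ OnSide w := by
  rw [OnSide, atNorth_mirror, atEast_mirror, atWest_mirror, OnSide, or_comm (a := AtWest w)]

lemma clearAhead_mirror {w : Walk} {s : Step} :
    ClearAhead (mirror w) s.mirror ↔ ClearAhead w s := by
  cases s <;> simp only [Step.mirror, clearAhead_north, clearAhead_south, clearAhead_east,
    clearAhead_west, forall_mem_visited_mirror, endpoint_mirror, neg_le_neg_iff, neg_inj]

lemma turnAllowed_mirror {w : Walk} {s : Step} :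
    TurnAllowed (mirror w) s.mirror ↔ TurnAllowed w s := by
  have hlast : (mirror w).getLast? = some Step.south ↔ w.getLast? = some Step.south := by
    rw [mirror, List.getLast?_map]
    rcases w.getLast? with _ | ⟨_ | _⟩ <;> simp [Step.mirror]
  have hwest : s.mirror ≠ Step.west ↔ s ≠ Step.east := by cases s <;> simp [Step.mirror]
  have heast : s.mirror ≠ Step.east ↔ s ≠ Step.west := by cases s <;> simp [Step.mirror]
  simp only [TurnAllowed, hlast, hwest, heast, exists_mem_visited_mirror, atEast_mirror,
    atWest_mirror, ne_eq, neg_inj]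
  exact forall₂_congr fun _ _ ↦ and_comm

lemma admissible_mirror {w : Walk} : Admissible (mirror w) ↔ Admissible w := by
  induction w using List.reverseRecOn with
  | nil => rfl
  | append_singleton w s ih =>
    rw [admissible_snoc, mirror_snoc, admissible_snoc, ih, clearAhead_mirror, turnAllowed_mirror,
      ← mirror_snoc, onSide_mirror]

lemma signedArea_mirror (w : Walk) : signedArea (mirror w) = -signedArea w := by
  induction w using List.reverseRecOn with
  | nil => simp [mirror, signedArea_nil]
  | append_singleton w s ih =>
    rw [mirror_snoc, signedArea_snoc, signedArea_snoc, ih, endpoint_mirror]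
    cases s <;> simp [Step.mirror, Step.vec] <;> ring

/-! ### Codes of prudent walks in the right half-plane -/

/-- Codes for the 3-sided prudent walks in the half-plane `x ≥ 0` that end with a step enlarging
the bounding box. This step is a north step to a new row for `row` and `up`, and an east step to a
new column for `ext` and `col`. Before it, the walk `p` moves along its current row to the
abscissa `x` (`row p x`) or to the east side of the box (`ext p`), or along its current column to
the distance `c` from the north side of the box (`col p c`) or to that side (`up p`). -/
inductive Code
  | start
  | row (p : Code) (x : ℕ)
  | up (p : Code)
  | ext (p : Code)
  | col (p : Code) (c : ℕ)

namespace Code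

/-- The width of the bounding box. -/
def width : Code → ℕ
  | start => 0
  | row p _ => p.width
  | up p => p.width
  | ext p => p.width + 1
  | col p _ => p.width + 1

/-- The ordinate of the north side of the bounding box. -/
def height : Code → ℕ
  | start => 0
  | row p _ => p.height + 1
  | up p => p.height + 1
  | ext p => p.height
  | col p _ => p.height

/-- Whether the walk ends with a north step, to a new row. -/
def isRow : Code → Bool
  | row _ _ => true
  | up _ => true
  | _ => false

/-- The position of the endpoint on the current row, measured from the line `x = 0`, or on the
current column, measured from the north side of the box. -/
def offset : Code → ℕ
  | start => 0
  | row _ x => x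
  | up p => p.width
  | ext _ => 0
  | col _ c => c

/-- The area between the walk, the line `x = -1` and the north side of the bounding box. -/
def areaLeft : Code → ℕ
  | start => 0
  | row p x => p.areaLeft + x + 1
  | up p => p.areaLeft + p.width + 1
  | ext p => p.areaLeft
  | col p c => p.areaLeft + c

/-- The constructors are applied to codes ending on a row or on a column as described above, and
rows do not leave the bounding box. -/
def Valid : Code → Prop
  | start => True
  | row p x => p.Valid ∧ p.isRow ∧ x ≤ p.width
  | up p => p.Valid ∧ ¬ p.isRow
  | ext p => p.Valid ∧ p.isRow
  | col p _ => p.Valid ∧ ¬ p.isRow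

/-- The node with offset `y` on the current row or column. -/
def node (p : Code) (y : ℤ) : ℤ × ℤ :=
  if p.isRow then (y, p.height) else (p.width, p.height - y)

/-- The step along the current row or column that increases the offset. -/
def forth (p : Code) : Step := if p.isRow then .east else .south

/-- The step along the current row or column that decreases the offset. -/
def back (p : Code) : Step := if p.isRow then .west else .north

/-- The straight walk along the current row or column to the offset `y`. -/
def lateral (p : Code) (y : ℕ) : Walk :=
  List.replicate (p.offset - y) p.back ++ List.replicate (y - p.offset) p.forth

/-- The walk described by a code. -/
def word : Code → Walk
  | start => []
  | row p x => p.word ++ p.lateral x ++ [.north]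
  | up p => p.word ++ p.lateral 0 ++ [.north]
  | ext p => p.word ++ p.lateral p.width ++ [.east]
  | col p c => p.word ++ p.lateral c ++ [.east]

/-- The walk described by a code, continued along the current row or column to the offset `y`. -/
def slide (p : Code) (y : ℕ) : Walk := p.word ++ p.lateral y

variable {p q : Code} {y z : ℕ}

lemma node_add_forth (p : Code) (y t : ℤ) : p.node y + t • p.forth.vec = p.node (y + t) := by
  unfold node forth
  split <;> ext <;> simp only [Step.vec, Int.reduceNeg, Prod.smul_mk, Int.zsmul_eq_mul, mul_one,
    mul_zero, mul_neg, Prod.mk_add_mk, add_zero]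
  ring

lemma node_add_back (p : Code) (y t : ℤ) : p.node y + t • p.back.vec = p.node (y - t) := by
  unfold node back
  split <;> ext <;> simp [Step.vec] <;> ring

lemma node_injective (p : Code) : Function.Injective p.node := by
  intro y z h
  unfold node at h
  split at h <;> simpa using h

lemma slide_offset (p : Code) : p.slide p.offset = p.word := by simp [slide, lateral]

lemma slide_of_le (h : y ≤ p.offset) :
    p.slide y = p.word ++ List.replicate (p.offset - y) p.back := by
  simp [slide, lateral, Nat.sub_eq_zero_of_le h]

lemma slide_of_ge (h : p.offset ≤ y) :
    p.slide y = p.word ++ List.replicate (y - p.offset) p.forth := by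
  simp [slide, lateral, Nat.sub_eq_zero_of_le h]

lemma slide_snoc_forth (h : p.offset ≤ y) : p.slide y ++ [p.forth] = p.slide (y + 1) := by
  rw [slide_of_ge h, slide_of_ge (h.trans y.le_succ), Nat.succ_sub h, List.replicate_succ',
    List.append_assoc]

lemma slide_snoc_back (h : y + 1 ≤ p.offset) : p.slide (y + 1) ++ [p.back] = p.slide y := by
  rw [slide_of_le h, slide_of_le (y.le_succ.trans h), List.append_assoc, ← List.replicate_succ',
    show p.offset - (y + 1) + 1 = p.offset - y by omega]

lemma endpoint_slide_of_word (h : endpoint p.word = p.node p.offset) (y : ℕ) :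
    endpoint (p.slide y) = p.node y := by
  rcases le_total y p.offset with hy | hy
  · rw [slide_of_le hy, endpoint_append, h, endpoint_replicate, node_add_back, Nat.cast_sub hy,
      sub_sub_cancel]
  · rw [slide_of_ge hy, endpoint_append, h, endpoint_replicate, node_add_forth, Nat.cast_sub hy,
      add_sub_cancel]

lemma endpoint_word (h : p.Valid) : endpoint p.word = p.node p.offset := by
  induction p with
  | start => rfl
  | row p x ih =>
    obtain ⟨h, hr, -⟩ := h
    rw [word, endpoint_snoc, ← slide, endpoint_slide_of_word (ih h), node, if_pos hr]
    simp [node, isRow, height, offset, Step.vec]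
  | up p ih =>
    obtain ⟨h, hr⟩ := h
    rw [word, endpoint_snoc, ← slide, endpoint_slide_of_word (ih h), node, if_neg hr]
    simp [node, isRow, height, offset, Step.vec]
  | ext p ih =>
    obtain ⟨h, hr⟩ := h
    rw [word, endpoint_snoc, ← slide, endpoint_slide_of_word (ih h), node, if_pos hr]
    simp [node, isRow, height, offset, width, Step.vec]
  | col p c ih =>
    obtain ⟨h, hr⟩ := h
    rw [word, endpoint_snoc, ← slide, endpoint_slide_of_word (ih h), node, if_neg hr]
    simp [node, isRow, height, offset, width, Step.vec]

lemma endpoint_slide (h : p.Valid) (y : ℕ) : endpoint (p.slide y) = p.node y :=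
  endpoint_slide_of_word (endpoint_word h) y

lemma visited_word_subset_slide (p : Code) (y : ℕ) : visited p.word ⊆ visited (p.slide y) :=
  visited_subset_append _ _

lemma mem_visited_slide (h : p.Valid) {v : ℤ × ℤ} : v ∈ visited (p.slide y) ↔
    v ∈ visited p.word ∨ ∃ j ∈ Set.uIcc p.offset y, v = p.node j := by
  rcases le_total y p.offset with hy | hy
  · rw [slide_of_le hy, mem_visited_append_replicate, endpoint_word h, Set.uIcc_of_ge hy]
    refine or_congr_right ⟨?_, ?_⟩
    · rintro ⟨j, hj, rfl⟩
      exact ⟨p.offset - j, ⟨by omega, by omega⟩, by rw [node_add_back, Nat.cast_sub (by omega)]⟩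
    · rintro ⟨j, ⟨h1, h2⟩, rfl⟩
      exact ⟨p.offset - j, by omega, by rw [node_add_back, Nat.cast_sub h2, sub_sub_cancel]⟩
  · rw [slide_of_ge hy, mem_visited_append_replicate, endpoint_word h, Set.uIcc_of_le hy]
    refine or_congr_right ⟨?_, ?_⟩
    · rintro ⟨j, hj, rfl⟩
      exact ⟨p.offset + j, ⟨by omega, by omega⟩, by rw [node_add_forth, Nat.cast_add]⟩
    · rintro ⟨j, ⟨h1, h2⟩, rfl⟩
      exact ⟨j - p.offset, by omega, by rw [node_add_forth, Nat.cast_sub h1, add_sub_cancel]⟩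

lemma node_mem_visited_word (h : p.Valid) : p.node p.offset ∈ visited p.word :=
  endpoint_word h ▸ endpoint_mem_visited _

lemma getLast?_word_ne (p : Code) : p.word.getLast? ≠ some Step.south := by
  cases p <;> simp [word]

lemma offset_le_width (h : p.Valid) (hr : p.isRow) : p.offset ≤ p.width := by
  cases p <;> simp_all [offset, width, Valid, isRow]

lemma height_pos (hr : p.isRow) : 0 < p.height := by
  cases p <;> simp_all [height, isRow]

/-- What the position of the walk in its bounding box says about the nodes it has visited. -/
structure Inv (p : Code) : Prop where
  nonneg_fst : ∀ v ∈ visited p.word, 0 ≤ v.1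
  fst_le : ∀ v ∈ visited p.word, v.1 ≤ p.width
  snd_le : ∀ v ∈ visited p.word, v.2 ≤ p.height
  eq_offset : ∀ y : ℤ, p.node y ∈ visited p.word → y = p.offset
  exists_fst_eq : p.isRow → ∃ v ∈ visited p.word, v.1 = p.width ∧ v.2 < p.height
  exists_snd_eq : ¬ p.isRow → 0 < p.width → ∀ b : ℤ, (p.height : ℤ) - p.offset ≤ b →
    b ≤ p.height → ∃ v ∈ visited p.word, v.2 = b ∧ v.1 < p.width

lemma Inv.nonneg_fst_slide (hi : Inv p) (h : p.Valid) {v : ℤ × ℤ}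
    (hv : v ∈ visited (p.slide y)) : 0 ≤ v.1 := by
  rcases (mem_visited_slide h).1 hv with hv | ⟨j, -, rfl⟩
  · exact hi.nonneg_fst v hv
  · rw [node]
    split <;> simp

lemma Inv.fst_le_slide (hi : Inv p) (h : p.Valid) (hy : p.isRow → y ≤ p.width) {v : ℤ × ℤ}
    (hv : v ∈ visited (p.slide y)) : v.1 ≤ p.width := by
  rcases (mem_visited_slide h).1 hv with hv | ⟨j, hj, rfl⟩
  · exact hi.fst_le v hv
  · rw [node]
    split
    next hr =>
      change (j : ℤ) ≤ p.width
      exact_mod_cast hj.2.trans (sup_le (offset_le_width h hr) (hy hr))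
    next => exact le_rfl

lemma Inv.snd_le_slide (hi : Inv p) (h : p.Valid) {v : ℤ × ℤ} (hv : v ∈ visited (p.slide y)) :
    v.2 ≤ p.height := by
  rcases (mem_visited_slide h).1 hv with hv | ⟨j, -, rfl⟩
  · exact hi.snd_le v hv
  · rw [node]
    split <;> simp

lemma Inv.of_snoc_north (hi : Inv p) (h : p.Valid) (hy : p.isRow → y ≤ p.width)
    (hword : q.word = p.slide y ++ [.north]) (hrow : q.isRow) (hwidth : q.width = p.width)
    (hheight : q.height = p.height + 1) (hnode : p.node y = ((q.offset : ℤ), (p.height : ℤ)))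
    (hwit : ∃ v ∈ visited (p.slide y), v.1 = p.width) : Inv q := by
  have hmem {v : ℤ × ℤ} : v ∈ visited q.word ↔
      v ∈ visited (p.slide y) ∨ v = ((q.offset : ℤ), (p.height : ℤ) + 1) := by
    rw [hword, mem_visited_snoc, endpoint_slide h, hnode]
    simp [Step.vec]
  have hoff : (q.offset : ℤ) ≤ p.width := by
    simpa [endpoint_slide h, hnode] using hi.fst_le_slide h hy (endpoint_mem_visited _)
  refine ⟨fun v hv ↦ ?_, fun v hv ↦ ?_, fun v hv ↦ ?_, fun j hj ↦ ?_, fun _ ↦ ?_,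
    fun hq ↦ absurd hrow hq⟩
  · rcases hmem.1 hv with hv | rfl
    exacts [hi.nonneg_fst_slide h hv, Int.natCast_nonneg _]
  · rw [hwidth]
    rcases hmem.1 hv with hv | rfl
    exacts [hi.fst_le_slide h hy hv, hoff]
  · rw [hheight, Nat.cast_succ]
    rcases hmem.1 hv with hv | rfl
    exacts [(hi.snd_le_slide h hv).trans (by simp), le_rfl]
  · rw [node, if_pos hrow, hheight] at hj
    rcases hmem.1 hj with hj | hj
    · exact absurd (hi.snd_le_slide h hj) (by simp)
    · exact congrArg Prod.fst hj
  · obtain ⟨v, hv, hv1⟩ := hwit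
    refine ⟨v, hmem.2 (Or.inl hv), hwidth ▸ hv1, ?_⟩
    rw [hheight, Nat.cast_succ]
    exact Int.lt_add_one_of_le (hi.snd_le_slide h hv)

lemma Inv.of_snoc_east (hi : Inv p) (h : p.Valid) (hy : p.isRow → y ≤ p.width)
    (hword : q.word = p.slide y ++ [.east]) (hrow : ¬ q.isRow) (hwidth : q.width = p.width + 1)
    (hheight : q.height = p.height)
    (hnode : p.node y = ((p.width : ℤ), (p.height : ℤ) - q.offset))
    (hwit : ∀ b : ℤ, (p.height : ℤ) - q.offset ≤ b → b ≤ p.height →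
      ∃ v ∈ visited (p.slide y), v.2 = b) : Inv q := by
  have hmem {v : ℤ × ℤ} : v ∈ visited q.word ↔
      v ∈ visited (p.slide y) ∨ v = ((p.width : ℤ) + 1, (p.height : ℤ) - q.offset) := by
    rw [hword, mem_visited_snoc, endpoint_slide h, hnode]
    simp [Step.vec]
  refine ⟨fun v hv ↦ ?_, fun v hv ↦ ?_, fun v hv ↦ ?_, fun j hj ↦ ?_,
    fun hq ↦ absurd hq hrow, fun _ _ b hb hb' ↦ ?_⟩
  · rcases hmem.1 hv with hv | rfl
    exacts [hi.nonneg_fst_slide h hv, by positivity]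
  · rw [hwidth, Nat.cast_succ]
    rcases hmem.1 hv with hv | rfl
    exacts [(hi.fst_le_slide h hy hv).trans (by simp), le_rfl]
  · rw [hheight]
    rcases hmem.1 hv with hv | rfl
    exacts [hi.snd_le_slide h hv, by simp]
  · rw [node, if_neg hrow, hwidth, hheight] at hj
    rcases hmem.1 hj with hj | hj
    · exact absurd (hi.fst_le_slide h hy hj) (by simp)
    · simpa using congrArg Prod.snd hj
  · rw [hheight] at hb hb'
    obtain ⟨v, hv, hv2⟩ := hwit b hb hb'
    refine ⟨v, hmem.2 (Or.inl hv), hv2, ?_⟩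
    rw [hwidth, Nat.cast_succ]
    exact Int.lt_add_one_of_le (hi.fst_le_slide h hy hv)

lemma eq_start_of_width_eq_zero (hr : ¬ p.isRow) (hw : p.width = 0) : p = start := by
  cases p <;> simp_all [isRow, width]

lemma Inv.exists_snd_eq_slide (hi : Inv p) (h : p.Valid) (hr : ¬ p.isRow) {b : ℤ}
    (hb : (p.height : ℤ) - y ≤ b) (hb' : b ≤ p.height) : ∃ v ∈ visited (p.slide y), v.2 = b := by
  by_cases hb'' : (p.height : ℤ) - p.offset < b
  · rcases Nat.eq_zero_or_pos p.width with hw | hw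
    · cases eq_start_of_width_eq_zero hr hw
      simp only [height, CharP.cast_eq_zero, offset, sub_self] at hb' hb''
      omega
    · obtain ⟨v, hv, hv2, -⟩ := hi.exists_snd_eq hr hw b hb''.le hb'
      exact ⟨v, visited_word_subset_slide p y hv, hv2⟩
  · refine ⟨p.node ((p.height - b).toNat : ℕ), (mem_visited_slide h).2 (Or.inr ⟨_, ?_, rfl⟩), ?_⟩
    · exact Set.Icc_subset_uIcc ⟨by omega, by omega⟩
    · simp only [node, if_neg hr]
      omega

lemma Valid.inv (h : p.Valid) : Inv p := by
  induction p with
  | start => constructor <;> simp [word, visited_nil, width, height, node, isRow, offset]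
  | row p x ih =>
    obtain ⟨h, hr, hx⟩ := h
    obtain ⟨v, hv, hv1, -⟩ := (ih h).exists_fst_eq hr
    exact (ih h).of_snoc_north h (fun _ ↦ hx) rfl rfl rfl rfl (by simp [node, hr, offset])
      ⟨v, visited_word_subset_slide p x hv, hv1⟩
  | up p ih =>
    obtain ⟨h, hr⟩ := h
    have hnode : p.node (0 : ℕ) = ((p.width : ℤ), (p.height : ℤ)) := by simp [node, hr]
    exact (ih h).of_snoc_north h (fun hr' ↦ absurd hr' hr) rfl rfl rfl rfl hnode
      ⟨_, endpoint_mem_visited _, by rw [endpoint_slide h, hnode]⟩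
  | ext p ih =>
    obtain ⟨h, hr⟩ := h
    have hnode : p.node p.width = ((p.width : ℤ), (p.height : ℤ)) := by simp [node, hr]
    refine (ih h).of_snoc_east h (fun _ ↦ le_rfl) rfl (by simp [isRow]) rfl rfl
      (by simp [hnode, offset]) fun b hb hb' ↦ ⟨_, endpoint_mem_visited _, ?_⟩
    rw [endpoint_slide h, hnode]
    simp only [offset, Nat.cast_zero, sub_zero] at hb
    exact le_antisymm hb hb'
  | col p c ih =>
    obtain ⟨h, hr⟩ := h
    exact (ih h).of_snoc_east h (fun hr' ↦ absurd hr' hr) rfl (by simp [isRow]) rfl rfl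
      (by simp [node, hr, offset]) fun b ↦ (ih h).exists_snd_eq_slide h hr

/-! ### The walks described by codes are prudent and 3-sided -/

lemma atNorth_slide (h : p.Valid) (hy : p.isRow ∨ y = 0) : AtNorth (p.slide y) := by
  intro v hv
  have : (p.node y).2 = p.height := by
    unfold node
    split
    next => rfl
    next hr => simp [hy.resolve_left hr]
  rw [endpoint_slide h, this]
  exact h.inv.snd_le_slide h hv

lemma atEast_slide (h : p.Valid) (hy : p.isRow → y = p.width) : AtEast (p.slide y) := by
  intro v hv
  have : (p.node y).1 = p.width := by
    unfold node
    split
    next hr => simp [hy hr]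
    next => rfl
  rw [endpoint_slide h, this]
  exact h.inv.fst_le_slide h (fun hr ↦ (hy hr).le) hv

lemma clearAhead_word_forth (h : p.Valid) : ClearAhead p.word p.forth := by
  rintro v hv t ht rfl
  rw [endpoint_word h, node_add_forth] at hv
  have := h.inv.eq_offset _ hv
  omega

lemma clearAhead_word_back (h : p.Valid) : ClearAhead p.word p.back := by
  rintro v hv t ht rfl
  rw [endpoint_word h, node_add_back] at hv
  have := h.inv.eq_offset _ hv
  omega

lemma turnAllowed_word (p : Code) (s : Step) : TurnAllowed p.word s :=
  turnAllowed_of_getLast? p.getLast?_word_ne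

lemma onSide_slide (h : p.Valid) : OnSide (p.slide y) := by
  by_cases hr : p.isRow
  · exact Or.inl (atNorth_slide h (Or.inl hr))
  · exact Or.inr (Or.inl (atEast_slide h fun hr' ↦ absurd hr' hr))

lemma admissible_slide_of_word (h : p.Valid) (hp : Admissible p.word) (y : ℕ) :
    Admissible (p.slide y) := by
  rcases le_total y p.offset with hy | hy
  · rw [slide_of_le hy]
    refine hp.append_replicate (fun _ ↦ ⟨clearAhead_word_back h, turnAllowed_word _ _⟩)
      fun j hj ↦ ?_
    have := onSide_slide h (y := p.offset - j)
    rwa [slide_of_le (Nat.sub_le _ _), Nat.sub_sub_self (by omega)] at this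
  · rw [slide_of_ge hy]
    refine hp.append_replicate (fun _ ↦ ⟨clearAhead_word_forth h, turnAllowed_word _ _⟩)
      fun j _ ↦ ?_
    have := onSide_slide h (y := p.offset + j)
    rwa [slide_of_ge (Nat.le_add_right _ _), Nat.add_sub_cancel_left] at this

lemma admissible_word (h : p.Valid) : Admissible p.word := by
  induction p with
  | start => exact admissible_nil
  | row p x ih =>
    exact (admissible_slide_of_word h.1 (ih h.1) x).snoc_north (atNorth_slide h.1 (Or.inl h.2.1))
  | up p ih =>
    exact (admissible_slide_of_word h.1 (ih h.1) 0).snoc_north (atNorth_slide h.1 (Or.inr rfl))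
  | ext p ih =>
    exact (admissible_slide_of_word h.1 (ih h.1) _).snoc_east (atEast_slide h.1 fun _ ↦ rfl)
  | col p c ih =>
    exact (admissible_slide_of_word h.1 (ih h.1) c).snoc_east
      (atEast_slide h.1 fun hr ↦ absurd hr h.2)

lemma admissible_slide (h : p.Valid) (y : ℕ) : Admissible (p.slide y) :=
  admissible_slide_of_word h (admissible_word h) y

/-! ### Every prudent 3-sided walk in the right half-plane has a code -/

lemma offset_le_of_clearAhead_forth (h : p.Valid) (hc : ClearAhead (p.slide y) p.forth) :
    p.offset ≤ y := by
  by_contra! hlt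
  refine hc _ (visited_word_subset_slide p y (node_mem_visited_word h)) (p.offset - y) (by omega) ?_
  rw [endpoint_slide h, node_add_forth, Nat.cast_sub hlt.le, add_sub_cancel]

lemma le_offset_of_clearAhead_back (h : p.Valid) (hc : ClearAhead (p.slide y) p.back) :
    y ≤ p.offset := by
  by_contra! hlt
  refine hc _ (visited_word_subset_slide p y (node_mem_visited_word h)) (y - p.offset) (by omega) ?_
  rw [endpoint_slide h, node_add_back, Nat.cast_sub hlt.le, sub_sub_cancel]

/-- The walk is described by a valid code, continued along the current row or column. -/
def Coded (w : Walk) : Prop :=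
  ∃ p : Code, p.Valid ∧ ∃ y, (p.isRow → y ≤ p.width) ∧ p.slide y = w

lemma coded_slide (h : p.Valid) (hy : p.isRow → y ≤ p.width) : Coded (p.slide y) :=
  ⟨p, h, y, hy, rfl⟩

lemma coded_word (h : p.Valid) : Coded p.word :=
  ⟨p, h, p.offset, offset_le_width h, p.slide_offset⟩

lemma not_admissible_slide_snoc_south (h : p.Valid) (hr : p.isRow) (hy : y ≤ p.width) :
    ¬ Admissible (p.slide y ++ [.south]) := by
  intro ha
  obtain ⟨-, hclear, hside, -⟩ := admissible_snoc.1 ha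
  have hend : endpoint (p.slide y) = ((y : ℤ), (p.height : ℤ)) := by
    rw [endpoint_slide h, node, if_pos hr]
  have hsub : visited (p.slide y) ⊆ visited (p.slide y ++ [.south]) := visited_subset_append _ _
  rw [clearAhead_south, hend] at hclear
  simp only [OnSide, AtNorth, AtEast, AtWest, endpoint_snoc, hend, Step.vec, Prod.mk_add_mk,
    add_zero] at hside
  rcases hside with hnorth | heast | hwest
  · have := hnorth _ (hsub (endpoint_mem_visited _))
    simp [hend] at this
  · obtain ⟨v, hv, hv1, hv2⟩ := h.inv.exists_fst_eq hr
    have hv := visited_word_subset_slide p y hv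
    have := heast v (hsub hv)
    have := hclear v hv (by omega)
    omega
  · have hzero := zero_mem_visited (p.slide y)
    have hy0 : (y : ℤ) ≤ 0 := hwest 0 (hsub hzero)
    have : (p.height : ℤ) ≤ 0 := hclear 0 hzero (le_antisymm (Int.natCast_nonneg y) hy0)
    have := height_pos hr
    omega

lemma not_admissible_slide_snoc_west (h : p.Valid) (hr : ¬ p.isRow) (hw : 0 < p.width) :
    ¬ Admissible (p.slide y ++ [.west]) := by
  intro ha
  obtain ⟨-, hclear, -, hturn⟩ := admissible_snoc.1 ha
  have hend : endpoint (p.slide y) = ((p.width : ℤ), (p.height : ℤ) - y) := by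
    rw [endpoint_slide h, node, if_neg hr]
  rcases le_or_gt y p.offset with hy | hy
  · obtain ⟨v, hv, hv2, hv1⟩ := h.inv.exists_snd_eq hr hw (p.height - y) (by omega) (by omega)
    rw [clearAhead_west, hend] at hclear
    exact absurd (hclear v (visited_word_subset_slide p y hv) hv2) (not_le.2 hv1)
  · obtain ⟨y, rfl⟩ := Nat.exists_eq_add_of_lt hy
    have hforth : p.forth = .south := by simp [forth, hr]
    refine (hturn ?_ ⟨_, endpoint_mem_visited _, 0, zero_mem_visited _, ?_⟩).1
      (atEast_slide h fun hr' ↦ absurd hr' hr) rfl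
    · rw [← slide_snoc_forth (Nat.le_add_right _ _), hforth, List.getLast?_concat]
    · simp only [hend, Prod.fst_zero]
      omega

lemma coded_slide_snoc_of_isRow (h : p.Valid) (hr : p.isRow) (hy : y ≤ p.width) {s : Step}
    (ha : Admissible (p.slide y ++ [s])) (hx : 0 ≤ (endpoint (p.slide y ++ [s])).1) :
    Coded (p.slide y ++ [s]) := by
  have hforth : p.forth = .east := by simp [forth, hr]
  have hback : p.back = .west := by simp [back, hr]
  have hclear := (admissible_snoc.1 ha).2.1
  cases s with
  | north => exact coded_word (p := row p y) ⟨h, hr, hy⟩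
  | east =>
    rcases hy.lt_or_eq with hy | rfl
    · rw [← hforth] at hclear ⊢
      rw [slide_snoc_forth (offset_le_of_clearAhead_forth h hclear)]
      exact coded_slide h fun _ ↦ hy
    · exact coded_word (p := ext p) ⟨h, hr⟩
  | south => exact absurd ha (not_admissible_slide_snoc_south h hr hy)
  | west =>
    rcases y with _ | y
    · simp [endpoint_snoc, endpoint_slide h, node, hr, Step.vec] at hx
    · rw [← hback] at hclear ⊢
      rw [slide_snoc_back (le_offset_of_clearAhead_back h hclear)]
      exact coded_slide h fun _ ↦ y.le_succ.trans hy

lemma coded_slide_snoc_of_not_isRow (h : p.Valid) (hr : ¬ p.isRow) {s : Step}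
    (ha : Admissible (p.slide y ++ [s])) (hx : 0 ≤ (endpoint (p.slide y ++ [s])).1) :
    Coded (p.slide y ++ [s]) := by
  have hforth : p.forth = .south := by simp [forth, hr]
  have hback : p.back = .north := by simp [back, hr]
  have hclear := (admissible_snoc.1 ha).2.1
  cases s with
  | north =>
    rcases y with _ | y
    · exact coded_word (p := up p) ⟨h, hr⟩
    · rw [← hback] at hclear ⊢
      rw [slide_snoc_back (le_offset_of_clearAhead_back h hclear)]
      exact coded_slide h fun hr' ↦ absurd hr' hr
  | east => exact coded_word (p := col p y) ⟨h, hr⟩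
  | south =>
    rw [← hforth] at hclear ⊢
    rw [slide_snoc_forth (offset_le_of_clearAhead_forth h hclear)]
    exact coded_slide h fun hr' ↦ absurd hr' hr
  | west =>
    rw [endpoint_snoc, endpoint_slide h, node, if_neg hr] at hx
    exact absurd ha (not_admissible_slide_snoc_west h hr (by simp [Step.vec] at hx; omega))

lemma coded_of_admissible {w : Walk} (hw : Admissible w) (hx : ∀ v ∈ visited w, 0 ≤ v.1) :
    Coded w := by
  induction w using List.reverseRecOn with
  | nil => exact coded_word (p := start) trivial
  | append_singleton w s ih =>
    have hend := hx _ (endpoint_mem_visited _)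
    obtain ⟨p, h, y, hy, rfl⟩ := ih hw.of_append fun v hv ↦ hx v (visited_subset_append _ _ hv)
    by_cases hr : p.isRow
    · exact coded_slide_snoc_of_isRow h hr (hy hr) hw hend
    · exact coded_slide_snoc_of_not_isRow h hr hw hend

/-! ### Different codes describe different walks -/

lemma lt_endpoint_word_of_eq_snoc (h : p.Valid) {r : Walk} {s : Step}
    (hword : p.word = r ++ [s]) :
    (∀ v ∈ visited r, v.1 < (endpoint p.word).1) ∨
      ∀ v ∈ visited r, v.2 < (endpoint p.word).2 := by
  have hend := endpoint_word h
  cases p with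
  | start => simp [word] at hword
  | row p x =>
    obtain rfl : p.slide x = r := (List.append_inj' hword rfl).1
    exact Or.inr fun v hv ↦ by
      simpa [hend, node, isRow, height] using Int.lt_add_one_of_le (h.1.inv.snd_le_slide h.1 hv)
  | up p =>
    obtain rfl : p.slide 0 = r := (List.append_inj' hword rfl).1
    exact Or.inr fun v hv ↦ by
      simpa [hend, node, isRow, height] using Int.lt_add_one_of_le (h.1.inv.snd_le_slide h.1 hv)
  | ext p =>
    obtain rfl : p.slide p.width = r := (List.append_inj' hword rfl).1
    exact Or.inl fun v hv ↦ by
      simpa [hend, node, isRow, width] using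
        Int.lt_add_one_of_le (h.1.inv.fst_le_slide h.1 (fun _ ↦ le_rfl) hv)
  | col p c =>
    obtain rfl : p.slide c = r := (List.append_inj' hword rfl).1
    exact Or.inl fun v hv ↦ by
      simpa [hend, node, isRow, width] using
        Int.lt_add_one_of_le (h.1.inv.fst_le_slide h.1 (fun hr ↦ absurd hr h.2) hv)

lemma Inv.exists_fst_eq_width (hi : Inv p) (h : p.Valid) :
    ∃ v ∈ visited p.word, v.1 = p.width := by
  by_cases hr : p.isRow
  · obtain ⟨v, hv, hv1, -⟩ := hi.exists_fst_eq hr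
    exact ⟨v, hv, hv1⟩
  · exact ⟨_, node_mem_visited_word h, by rw [node, if_neg hr]⟩

lemma Inv.exists_snd_eq_height (hi : Inv p) (h : p.Valid) :
    ∃ v ∈ visited p.word, v.2 = p.height := by
  by_cases hr : p.isRow
  · exact ⟨_, node_mem_visited_word h, by rw [node, if_pos hr]⟩
  · simpa only [slide_offset] using hi.exists_snd_eq_slide (y := p.offset) h hr (by omega) le_rfl

/-- The last step of `q.word` enlarges the bounding box, but the box of `p.slide y` is already the
one of `p.word`. -/
lemma prefix_of_slide_eq_slide (hp : p.Valid) (hq : q.Valid) (hy : p.isRow → y ≤ p.width)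
    (h : p.slide y = q.slide z) : q.word <+: p.word := by
  have hpre : p.word <+: p.slide y := List.prefix_append _ _
  have hqre : q.word <+: p.slide y := h ▸ List.prefix_append _ _
  rcases List.prefix_or_prefix_of_prefix hpre hqre with ⟨r, hr⟩ | hle
  · rcases r.eq_nil_or_concat' with rfl | ⟨r, s, rfl⟩
    · simp [← hr]
    have hmem : endpoint q.word ∈ visited (p.slide y) :=
      h ▸ visited_word_subset_slide q z (endpoint_mem_visited _)
    have hsub := visited_subset_append p.word r
    rcases lt_endpoint_word_of_eq_snoc hq (hr.symm.trans (List.append_assoc _ _ _).symm) with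
      hlt | hlt
    · obtain ⟨v, hv, hv1⟩ := hp.inv.exists_fst_eq_width hp
      exact absurd (hp.inv.fst_le_slide hp hy hmem) (not_le.2 (hv1 ▸ hlt v (hsub hv)))
    · obtain ⟨v, hv, hv2⟩ := hp.inv.exists_snd_eq_height hp
      exact absurd (hp.inv.snd_le_slide hp hmem) (not_le.2 (hv2 ▸ hlt v (hsub hv)))
  · exact hle

lemma word_eq_word_of_slide_eq_slide (hp : p.Valid) (hq : q.Valid) (hy : p.isRow → y ≤ p.width)
    (hz : q.isRow → z ≤ q.width) (h : p.slide y = q.slide z) : p.word = q.word :=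
  (prefix_of_slide_eq_slide hq hp hz h.symm).eq_of_length_le
    (prefix_of_slide_eq_slide hp hq hy h).length_le

lemma offset_eq_of_slide_eq (hp : p.Valid) (h : p.slide y = p.slide z) : y = z := by
  have := congrArg endpoint h
  rw [endpoint_slide hp, endpoint_slide hp] at this
  exact_mod_cast p.node_injective this

lemma eq_of_snoc_slide_eq {s t : Step} (hp : p.Valid) (hq : q.Valid) (hy : p.isRow → y ≤ p.width)
    (hz : q.isRow → z ≤ q.width) (hinj : ∀ {q : Code}, p.Valid → q.Valid → p.word = q.word → p = q)
    (h : p.slide y ++ [s] = q.slide z ++ [t]) : p = q ∧ y = z ∧ s = t := by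
  obtain ⟨hslide, hst⟩ := List.append_inj' h rfl
  obtain rfl := hinj hp hq (word_eq_word_of_slide_eq_slide hp hq hy hz hslide)
  exact ⟨rfl, offset_eq_of_slide_eq hp hslide, List.singleton_inj.1 hst⟩

lemma word_injective (hp : p.Valid) (hq : q.Valid) (h : p.word = q.word) : p = q := by
  induction p generalizing q with
  | start => cases q <;> simp_all [word]
  | row p x ih =>
    obtain ⟨hp, hpr, hx⟩ := hp
    cases q with
    | row q z => grind [eq_of_snoc_slide_eq hp hq.1 (fun _ ↦ hx) (fun _ ↦ hq.2.2) ih h]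
    | up q => grind [eq_of_snoc_slide_eq hp hq.1 (fun _ ↦ hx) (absurd · hq.2) ih h, Valid]
    | _ => simpa [word] using congrArg List.getLast? h
  | up p ih =>
    obtain ⟨hp, hpr⟩ := hp
    cases q with
    | row q z => grind [eq_of_snoc_slide_eq hp hq.1 (absurd · hpr) (fun _ ↦ hq.2.2) ih h, Valid]
    | up q => grind [eq_of_snoc_slide_eq hp hq.1 (absurd · hpr) (absurd · hq.2) ih h]
    | _ => simpa [word] using congrArg List.getLast? h
  | ext p ih =>
    obtain ⟨hp, hpr⟩ := hp
    cases q with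
    | ext q => grind [eq_of_snoc_slide_eq hp hq.1 (fun _ ↦ le_rfl) (fun _ ↦ le_rfl) ih h]
    | col q z => grind [eq_of_snoc_slide_eq hp hq.1 (fun _ ↦ le_rfl) (absurd · hq.2) ih h, Valid]
    | _ => simpa [word] using congrArg List.getLast? h
  | col p c ih =>
    obtain ⟨hp, hpr⟩ := hp
    cases q with
    | ext q => grind [eq_of_snoc_slide_eq hp hq.1 (absurd · hpr) (fun _ ↦ le_rfl) ih h, Valid]
    | col q z => grind [eq_of_snoc_slide_eq hp hq.1 (absurd · hpr) (absurd · hq.2) ih h]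
    | _ => simpa [word] using congrArg List.getLast? h

lemma slide_injective (hp : p.Valid) (hq : q.Valid) (hy : p.isRow → y ≤ p.width)
    (hz : q.isRow → z ≤ q.width) (h : p.slide y = q.slide z) : p = q ∧ y = z := by
  obtain rfl := word_injective hp hq (word_eq_word_of_slide_eq_slide hp hq hy hz h)
  exact ⟨rfl, offset_eq_of_slide_eq hp h⟩

lemma signedArea_slide_of_word (h : p.Valid)
    (hp : signedArea p.word =
      p.areaLeft - p.height - if p.isRow then 0 else (p.width : ℤ) * p.offset) (y : ℕ) :
    signedArea (p.slide y) =
      p.areaLeft - p.height - if p.isRow then 0 else (p.width : ℤ) * y := by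
  rcases le_total y p.offset with hy | hy
  · rw [slide_of_le hy, signedArea_append_replicate, hp, endpoint_word h, node, back]
    split <;> simp only [Nat.cast_sub hy, Step.vec, Int.reduceNeg, sub_zero, mul_zero, add_zero,
      mul_one]
    ring
  · rw [slide_of_ge hy, signedArea_append_replicate, hp, endpoint_word h, node, forth]
    split <;> simp only [Nat.cast_sub hy, Step.vec, Int.reduceNeg, sub_zero, mul_zero, add_zero,
      mul_one, mul_neg]
    ring

lemma signedArea_word (h : p.Valid) : signedArea p.word =
    p.areaLeft - p.height - if p.isRow then 0 else (p.width : ℤ) * p.offset := by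
  induction p with
  | start => rfl
  | row p x ih =>
    obtain ⟨h, hr, -⟩ := h
    rw [word, signedArea_snoc, ← slide, signedArea_slide_of_word h (ih h), endpoint_slide h, node,
      if_pos hr, if_pos hr]
    simp only [sub_zero, Step.vec, mul_one, areaLeft, Nat.cast_add, Nat.cast_one, height, isRow,
      if_true]
    ring
  | up p ih =>
    obtain ⟨h, hr⟩ := h
    rw [word, signedArea_snoc, ← slide, signedArea_slide_of_word h (ih h), endpoint_slide h, node,
      if_neg hr, if_neg hr]
    simp only [Nat.cast_zero, mul_zero, sub_zero, Step.vec, mul_one, areaLeft, Nat.cast_add,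
      Nat.cast_one, height, isRow, if_true]
    ring
  | ext p ih =>
    obtain ⟨h, hr⟩ := h
    rw [word, signedArea_snoc, ← slide, signedArea_slide_of_word h (ih h), if_pos hr]
    simp [isRow, height, areaLeft, offset, Step.vec]
  | col p c ih =>
    obtain ⟨h, hr⟩ := h
    rw [word, signedArea_snoc, ← slide, signedArea_slide_of_word h (ih h), if_neg hr]
    simp only [Step.vec, mul_zero, add_zero, areaLeft, Nat.cast_add, height, isRow,
      Bool.false_eq_true, if_false, width, Nat.cast_one, offset]
    ring

lemma signedArea_slide (h : p.Valid) (y : ℕ) : signedArea (p.slide y) =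
    p.areaLeft - p.height - if p.isRow then 0 else (p.width : ℤ) * y :=
  signedArea_slide_of_word h (signedArea_word h) y

end Code

/-! ### The three families of counterclockwise polygons -/

namespace Code

variable {p b : Code}

/-- Codes of bar graphs: these walks stay weakly below the `x`-axis. -/
def IsBar (b : Code) : Prop := b.Valid ∧ ¬ b.isRow ∧ b.height = 0

/-- The polygon going around a single column of height `n` below the origin. -/
def hook (n : ℕ) : Walk := (col start n).slide 0

/-- The polygon going around a bar graph and back along the row above the origin. -/
def bar (b : Code) : Walk := (up b).slide 0

/-- The polygon obtained by closing up the walk of a code along the line `x = -1`. -/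
def wrap (p : Code) : Walk :=
  p.slide 0 ++ [.west] ++ List.replicate p.height .south

lemma valid_col_start (n : ℕ) : (col start n).Valid := ⟨trivial, by simp [isRow]⟩

lemma IsBar.valid_up (h : IsBar b) : (up b).Valid := ⟨h.1, h.2.1⟩

lemma endpoint_hook (n : ℕ) : endpoint (hook n) = (1, 0) := by
  rw [hook, endpoint_slide (valid_col_start n)]
  rfl

lemma endpoint_bar (h : IsBar b) : endpoint (bar b) = (0, 1) := by
  rw [bar, endpoint_slide h.valid_up]
  simp [node, isRow, height, h.2.2]

lemma endpoint_slide_zero (h : p.Valid) (hr : p.isRow) :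
    endpoint (p.slide 0) = (0, (p.height : ℤ)) := by
  rw [endpoint_slide h, node, if_pos hr, Nat.cast_zero]

lemma endpoint_slide_zero_snoc_west (h : p.Valid) (hr : p.isRow) :
    endpoint (p.slide 0 ++ [.west]) = (-1, (p.height : ℤ)) := by
  simp [endpoint_snoc, endpoint_slide_zero h hr, Step.vec]

lemma endpoint_wrap (h : p.Valid) (hr : p.isRow) : endpoint (wrap p) = (-1, 0) := by
  rw [wrap, endpoint_append, endpoint_slide_zero_snoc_west h hr, endpoint_replicate]
  simp [Step.vec]

lemma signedArea_hook (n : ℕ) : signedArea (hook n) = n := by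
  rw [hook, signedArea_slide (valid_col_start n)]
  simp [areaLeft, height]

lemma signedArea_bar (h : IsBar b) : signedArea (bar b) = b.areaLeft + b.width := by
  rw [bar, signedArea_slide h.valid_up]
  simp [areaLeft, height, isRow, h.2.2]

lemma signedArea_wrap (h : p.Valid) (hr : p.isRow) : signedArea (wrap p) = p.areaLeft := by
  rw [wrap, signedArea_append_replicate, signedArea_snoc, signedArea_slide h, if_pos hr,
    endpoint_slide_zero_snoc_west h hr]
  simp [Step.vec]

lemma nonneg_fst_slide (h : p.Valid) {y : ℕ} {v : ℤ × ℤ} (hv : v ∈ visited (p.slide y)) :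
    0 ≤ v.1 :=
  h.inv.nonneg_fst_slide h hv

lemma admissible_slide_zero_snoc_west (h : p.Valid) (hr : p.isRow) :
    Admissible (p.slide 0 ++ [.west]) := by
  refine admissible_snoc.2 ⟨admissible_slide h 0, clearAhead_west.2 fun v hv _ ↦ ?_,
    Or.inl fun v hv ↦ ?_, turnAllowed_of_getLast? ?_⟩
  · rw [endpoint_slide_zero h hr]
    exact nonneg_fst_slide h hv
  · rw [endpoint_slide_zero_snoc_west h hr]
    rcases mem_visited_snoc.1 hv with hv | rfl
    · exact h.inv.snd_le_slide h hv
    · simp [endpoint_slide_zero h hr, Step.vec]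
  · rw [slide_of_le (Nat.zero_le _), List.getLast?_append, List.getLast?_replicate]
    have := p.getLast?_word_ne
    split <;> simp_all [back]

lemma neg_one_le_fst_of_mem_visited (h : p.Valid) (hr : p.isRow) {k : ℕ} {v : ℤ × ℤ}
    (hv : v ∈ visited (p.slide 0 ++ [.west] ++ List.replicate k .south)) : -1 ≤ v.1 := by
  rw [mem_visited_append_replicate, mem_visited_snoc, ← endpoint_snoc,
    endpoint_slide_zero_snoc_west h hr] at hv
  rcases hv with (hv | rfl) | ⟨j, -, rfl⟩
  · have := nonneg_fst_slide h hv
    omega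
  · exact le_rfl
  · simp [Step.vec]

lemma admissible_wrap (h : p.Valid) (hr : p.isRow) : Admissible (wrap p) := by
  refine (admissible_slide_zero_snoc_west h hr).append_replicate
    (fun _ ↦ ⟨clearAhead_south.2 fun v hv hv1 ↦ ?_, turnAllowed_south⟩)
    fun j _ ↦ Or.inr (Or.inr fun v hv ↦ ?_)
  · rw [endpoint_slide_zero_snoc_west h hr] at hv1 ⊢
    rcases mem_visited_snoc.1 hv with hv | rfl
    · have := nonneg_fst_slide h hv
      omega
    · simp [endpoint_slide_zero h hr, Step.vec]
  · rw [endpoint_append, endpoint_replicate, endpoint_slide_zero_snoc_west h hr]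
    simpa [Step.vec] using neg_one_le_fst_of_mem_visited h hr hv

lemma length_lateral (p : Code) (y : ℕ) :
    (p.lateral y).length = (p.offset - y) + (y - p.offset) := by
  simp [lateral]

lemma areaLeft_pos (hr : p.isRow) : 0 < p.areaLeft := by
  cases p <;> simp_all [areaLeft, isRow]

lemma wrap_injective {p q : Code} (hp : p.Valid) (hpr : p.isRow) (hq : q.Valid) (hqr : q.isRow)
    (h : wrap p = wrap q) : p = q := by
  have eq_of_prefix_word {p q : Code} (hp : p.Valid) (hpr : p.isRow) (hq : q.Valid) (hqr : q.isRow)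
      (h : p.slide 0 ++ [.west] <+: q.slide 0 ++ [.west]) : p = q := by
    rcases List.prefix_concat_iff.1 h with h | ⟨r, hr⟩
    · exact (slide_injective hp hq (fun _ ↦ Nat.zero_le _) (fun _ ↦ Nat.zero_le _)
        (List.append_inj' h rfl).1).1
    · have := nonneg_fst_slide hq (hr ▸ visited_subset_append _ r (endpoint_mem_visited _))
      simp [endpoint_slide_zero_snoc_west hp hpr] at this
  have hpre : p.slide 0 ++ [.west] <+: wrap p := List.prefix_append _ _
  have hpre' : q.slide 0 ++ [.west] <+: wrap p := h ▸ List.prefix_append _ _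
  rcases List.prefix_or_prefix_of_prefix hpre hpre' with hpre | hpre
  · exact eq_of_prefix_word hp hpr hq hqr hpre
  · exact (eq_of_prefix_word hq hqr hp hpr hpre).symm

lemma bar_injective {b c : Code} (hb : IsBar b) (hc : IsBar c) (h : bar b = bar c) : b = c :=
  up.inj (slide_injective hb.valid_up hc.valid_up (fun _ ↦ Nat.zero_le _)
    (fun _ ↦ Nat.zero_le _) h).1

end Code

open Code

/-- The 3-sided prudent polygons that are traversed counterclockwise. -/
def IsCounterclockwise (w : Walk) : Prop :=
  (∃ n, 1 ≤ n ∧ w = hook n) ∨ (∃ b, IsBar b ∧ 1 ≤ b.width ∧ w = bar b) ∨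
    ∃ p : Code, p.Valid ∧ p.isRow ∧ w = wrap p

namespace IsCounterclockwise

variable {w : Walk}

lemma admissible (h : IsCounterclockwise w) : Admissible w := by
  rcases h with ⟨n, -, rfl⟩ | ⟨b, hb, -, rfl⟩ | ⟨p, h, hr, rfl⟩
  · exact admissible_slide (valid_col_start n) 0
  · exact admissible_slide hb.valid_up 0
  · exact admissible_wrap h hr

lemma endpoint_eq (h : IsCounterclockwise w) :
    endpoint w = (1, 0) ∨ endpoint w = (0, 1) ∨ endpoint w = (-1, 0) := by
  rcases h with ⟨n, -, rfl⟩ | ⟨b, hb, -, rfl⟩ | ⟨p, h, hr, rfl⟩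
  · exact Or.inl (endpoint_hook n)
  · exact Or.inr (Or.inl (endpoint_bar hb))
  · exact Or.inr (Or.inr (endpoint_wrap h hr))

lemma signedArea_pos (h : IsCounterclockwise w) : 0 < signedArea w := by
  rcases h with ⟨n, hn, rfl⟩ | ⟨b, hb, hw, rfl⟩ | ⟨p, h, hr, rfl⟩
  · rw [signedArea_hook]; omega
  · rw [signedArea_bar hb]; omega
  · rw [signedArea_wrap h hr]
    exact_mod_cast areaLeft_pos hr

lemma area_eq_signedArea (h : IsCounterclockwise w) : (w.area : ℤ) = signedArea w := by
  have : (endpoint w).1 * (endpoint w).2 = 0 := by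
    rcases h.endpoint_eq with h | h | h <;> simp [h]
  rw [area_eq, this, sub_zero, Int.natAbs_of_nonneg h.signedArea_pos.le]

lemma two_le_length (h : IsCounterclockwise w) : 2 ≤ w.length := by
  rcases h with ⟨n, hn, rfl⟩ | ⟨b, -, hw, rfl⟩ | ⟨p, -, hr, rfl⟩
  · simp [hook, slide, word, length_lateral, offset]; omega
  · simp [bar, slide, word, length_lateral, offset]; omega
  · have := height_pos hr
    simp [wrap]; omega

end IsCounterclockwise

lemma area_mirror (w : Walk) : (mirror w).area = w.area := by
  rw [area_eq, area_eq, signedArea_mirror, endpoint_mirror, ← Int.natAbs_neg]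
  congr 1
  ring

/-- The point is adjacent to the origin. -/
def IsAdjacentToOrigin (v : ℤ × ℤ) : Prop :=
  v.1 = 0 ∧ (v.2 = 1 ∨ v.2 = -1) ∨ v.2 = 0 ∧ (v.1 = 1 ∨ v.1 = -1)

lemma isAlmostClosed_iff {w : Walk} :
    w.IsAlmostClosed ↔ 2 ≤ w.length ∧ IsAdjacentToOrigin (endpoint w) := by
  rw [Walk.IsAlmostClosed, pos_length, IsAdjacentToOrigin]
  refine and_congr_right fun _ ↦ ?_
  rcases abs_cases (endpoint w).1 with ⟨h1, _⟩ | ⟨h1, _⟩ <;>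
    rcases abs_cases (endpoint w).2 with ⟨h2, _⟩ | ⟨h2, _⟩ <;> rw [h1, h2] <;> omega

lemma isAlmostClosed_mirror {w : Walk} : (mirror w).IsAlmostClosed ↔ w.IsAlmostClosed := by
  simp only [isAlmostClosed_iff, IsAdjacentToOrigin, length_mirror, endpoint_mirror]
  omega

lemma IsCounterclockwise.isAlmostClosed {w : Walk} (h : IsCounterclockwise w) :
    w.IsAlmostClosed :=
  isAlmostClosed_iff.2 ⟨h.two_le_length, by
    rcases h.endpoint_eq with h | h | h <;> simp [h, IsAdjacentToOrigin]⟩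

lemma not_isCounterclockwise_mirror {w : Walk} (h : IsCounterclockwise w) :
    ¬ IsCounterclockwise (mirror w) := by
  intro h'
  have := h.signedArea_pos
  have := h'.signedArea_pos
  rw [signedArea_mirror] at this
  omega

/-! ### Classification of the polygons -/

namespace Code

variable {p : Code} {y : ℕ}

lemma word_of_width_eq_zero (h : p.Valid) (hr : p.isRow) (hw : p.width = 0) :
    p.word = List.replicate p.height .north := by
  induction p with
  | row p x ih =>
    obtain ⟨h, hr', hx⟩ := h
    rw [width] at hw
    obtain rfl : p.offset = x := by have := offset_le_width h hr'; omega
    rw [word, ← slide, slide_offset, ih h hr' hw, height, List.replicate_succ']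
  | up p ih =>
    obtain rfl := eq_start_of_width_eq_zero h.2 hw
    rfl
  | _ => simp [isRow] at hr

lemma exists_isBar_of_height_eq_one (h : p.Valid) (hr : p.isRow) (hh : p.height = 1) :
    ∃ b, IsBar b ∧ p = up b := by
  cases p with
  | row p x =>
    have := height_pos h.2.1
    simp only [height] at hh
    omega
  | up p => exact ⟨p, ⟨h.1, h.2, by simpa [height] using hh⟩, rfl⟩
  | _ => simp [isRow] at hr

lemma mirror_wrap_of_width_eq_zero (h : p.Valid) (hr : p.isRow) (hw : p.width = 0) :
    mirror (wrap p) = (ext p).slide p.height := by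
  have hoff : p.offset = 0 := by have := offset_le_width h hr; omega
  have hslide : p.slide 0 = p.word := by rw [← hoff, slide_offset]
  have hslide' : (ext p).slide p.height = (ext p).word ++ List.replicate p.height .south :=
    slide_of_ge (Nat.zero_le _)
  rw [hslide', word, hw, ← slide, wrap, hslide, word_of_width_eq_zero h hr hw]
  simp [mirror, Step.mirror]

lemma isCounterclockwise_slide_of_isRow (h : p.Valid) (hr : p.isRow)
    (hc : Walk.IsAlmostClosed (p.slide y)) : IsCounterclockwise (p.slide y) := by
  obtain ⟨hlen, hend⟩ := isAlmostClosed_iff.1 hc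
  have hpos := height_pos hr
  simp only [endpoint_slide h, node, if_pos hr, IsAdjacentToOrigin] at hend
  obtain rfl : y = 0 := by omega
  obtain ⟨b, hb, rfl⟩ := exists_isBar_of_height_eq_one h hr (by omega)
  refine Or.inr (Or.inl ⟨b, hb, ?_, rfl⟩)
  by_contra! hw
  obtain rfl := eq_start_of_width_eq_zero hb.2.1 (by omega)
  simp [slide, lateral, word, offset, width] at hlen

lemma isCounterclockwise_or_mirror_slide_of_not_isRow (h : p.Valid) (hr : ¬ p.isRow)
    (hc : Walk.IsAlmostClosed (p.slide y)) :
    IsCounterclockwise (p.slide y) ∨ IsCounterclockwise (mirror (p.slide y)) := by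
  obtain ⟨hlen, hend⟩ := isAlmostClosed_iff.1 hc
  simp only [endpoint_slide h, node, if_neg hr, IsAdjacentToOrigin] at hend
  cases p with
  | start =>
    simp only [height, width] at hend
    obtain rfl : y = 1 := by omega
    simp [slide, lateral, word, offset] at hlen
  | ext p =>
    simp only [width, height, Nat.cast_add, Nat.cast_one] at hend
    have hw : p.width = 0 := by omega
    obtain rfl : y = p.height := by omega
    exact Or.inr (Or.inr (Or.inr ⟨p, h.1, h.2, by
      rw [← mirror_wrap_of_width_eq_zero h.1 h.2 hw, mirror_mirror]⟩))
  | col p c =>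
    simp only [width, height, Nat.cast_add, Nat.cast_one] at hend
    obtain rfl := eq_start_of_width_eq_zero h.2 (by omega : p.width = 0)
    simp only [height] at hend
    obtain rfl : y = 0 := by omega
    refine Or.inl (Or.inl ⟨c, ?_, rfl⟩)
    by_contra! hc
    obtain rfl : c = 0 := by omega
    simp [slide, lateral, word, offset] at hlen
  | _ => simp [isRow] at hr

lemma isCounterclockwise_or_mirror_of_nonneg {w : Walk} (hw : Admissible w)
    (hc : w.IsAlmostClosed) (hx : ∀ v ∈ visited w, 0 ≤ v.1) :
    IsCounterclockwise w ∨ IsCounterclockwise (mirror w) := by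
  obtain ⟨p, h, y, -, rfl⟩ := coded_of_admissible hw hx
  by_cases hr : p.isRow
  · exact Or.inl (isCounterclockwise_slide_of_isRow h hr hc)
  · exact isCounterclockwise_or_mirror_slide_of_not_isRow h hr hc

/-! ### Walks that visit both sides of the `y`-axis -/

lemma exists_split_west {w : Walk} (h : ∃ v ∈ visited w, v.1 < 0) :
    ∃ w₁ w₂, w = w₁ ++ [Step.west] ++ w₂ ∧ (∀ v ∈ visited w₁, 0 ≤ v.1) ∧
      (endpoint w₁).1 = 0 := by
  induction w using List.reverseRecOn with
  | nil =>
    obtain ⟨v, hv, h⟩ := h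
    simp_all [visited_nil]
  | append_singleton w s ih =>
    by_cases hw : ∃ v ∈ visited w, v.1 < 0
    · obtain ⟨w₁, w₂, rfl, h1, h2⟩ := ih hw
      exact ⟨w₁, w₂ ++ [s], by simp, h1, h2⟩
    · push Not at hw
      have hend := hw _ (endpoint_mem_visited w)
      obtain ⟨v, hv, h⟩ := h
      rcases mem_visited_snoc.1 hv with hv | rfl
      · exact absurd (hw v hv) h.not_ge
      · cases s with
        | west =>
          simp only [Step.vec, Prod.fst_add] at h
          exact ⟨w, [], by simp, hw, by omega⟩
        | _ =>
          simp only [Step.vec, Prod.fst_add] at h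
          omega

/-- Going south along `x = 1` to a point below height `Y` is blocked by the node `(1, b)`, and
nodes with `x = 0` can only be reached on the north side. -/
lemma le_endpoint_snd_of_fst_le_one {w r : Walk} {Y b : ℤ} (he : endpoint w = (-1, Y))
    (h0 : ((0, Y) : ℤ × ℤ) ∈ visited w) (hb : b < Y) (h1 : ((1, b) : ℤ × ℤ) ∈ visited w)
    (hw : Admissible (w ++ r)) (hx : ∀ v ∈ visited (w ++ r), v.1 ≤ 1)
    (hend : 0 ≤ (endpoint (w ++ r)).1) : Y ≤ (endpoint (w ++ r)).2 := by
  induction r using List.reverseRecOn with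
  | nil => simp [he] at hend
  | append_singleton r s ih =>
    rw [← List.append_assoc] at *
    obtain ⟨hw', hc, hs, -⟩ := admissible_snoc.1 hw
    have hsub : visited w ⊆ visited (w ++ r ++ [s]) :=
      (visited_subset_append _ _).trans (visited_subset_append _ _)
    have hx' : ∀ v ∈ visited (w ++ r), v.1 ≤ 1 := fun v hv ↦ hx v (visited_subset_append _ _ hv)
    have hprev := hx' _ (endpoint_mem_visited _)
    rcases hs with hs | hs | hs
    · exact hs _ (hsub h0)
    · have hend1 : 1 ≤ (endpoint (w ++ r ++ [s])).1 := hs _ (hsub h1)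
      have hc1 : s = .south → (endpoint (w ++ r)).1 = 1 → (endpoint (w ++ r)).2 ≤ b := by
        rintro rfl h
        exact clearAhead_south.1 hc _ (visited_subset_append _ _ h1) h.symm
      have ih := ih hw' hx'
      rw [endpoint_snoc] at hend1 ⊢
      cases s <;> simp only [Step.vec, Prod.fst_add, Prod.snd_add, forall_const] at * <;> omega
    · have := hs _ (hsub (he ▸ endpoint_mem_visited w))
      simp only at this
      omega

lemma eq_replicate_south_or_cons_north {w r : Walk} {Y : ℤ} (he : endpoint w = (-1, Y))
    (h0 : ((0, Y) : ℤ × ℤ) ∈ visited w) (hw : Admissible (w ++ r))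
    (hx : ∀ v ∈ visited (w ++ r), -1 ≤ v.1) :
    (∃ j, r = List.replicate j .south) ∨ ∃ r', r = .north :: r' := by
  induction r using List.reverseRecOn with
  | nil => exact Or.inl ⟨0, rfl⟩
  | append_singleton r s ih =>
    rw [← List.append_assoc] at *
    have hx' : ∀ v ∈ visited (w ++ r), -1 ≤ v.1 := fun v hv ↦ hx v (visited_subset_append _ _ hv)
    obtain ⟨hw', hc, -, ht⟩ := admissible_snoc.1 hw
    have hend := hx _ (endpoint_mem_visited _)
    rcases ih hw' hx' with ⟨j, rfl⟩ | ⟨r', rfl⟩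
    swap
    · exact Or.inr ⟨r' ++ [s], rfl⟩
    have hsub : visited w ⊆ visited (w ++ List.replicate j Step.south) := visited_subset_append _ _
    have hem : ((-1, Y) : ℤ × ℤ) ∈ visited w := he ▸ endpoint_mem_visited w
    have he' : endpoint (w ++ List.replicate j Step.south) = (-1, Y - j) := by
      rw [endpoint_append, he, endpoint_replicate]
      simp [Step.vec, sub_eq_add_neg]
    cases s with
    | south => exact Or.inl ⟨j + 1, by rw [List.replicate_succ']⟩
    | north =>
      have hle := clearAhead_north.1 hc _ (hsub hem) (by rw [he'])
      simp only [he'] at hle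
      obtain rfl : j = 0 := by omega
      exact Or.inr ⟨[], rfl⟩
    | west =>
      rw [endpoint_snoc, he'] at hend
      simp [Step.vec] at hend
    | east =>
      rcases j with _ | j
      · have hle := clearAhead_east.1 hc _ (hsub h0) (by rw [he']; simp)
        rw [he'] at hle
        simp at hle
      · have hlast : (w ++ List.replicate (j + 1) Step.south).getLast? = some .south := by
          rw [List.replicate_succ', ← List.append_assoc, List.getLast?_concat]
        have hwest : AtWest (w ++ List.replicate (j + 1) Step.south) := fun v hv ↦ by
          rw [he']
          exact hx' v hv
        exact absurd rfl ((ht hlast ⟨_, hsub hem, _, hsub h0, by simp⟩).2 hwest)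

/-- Going south along `x = -1` is blocked by the node `(-1, Y)`, and that line can only be entered
from the north side. -/
lemma lt_endpoint_snd_of_neg_one_le_fst {w r : Walk} {Y m b : ℤ} (hm : 0 < m)
    (h1 : ((m, b) : ℤ × ℤ) ∈ visited w) (h0 : ((-1, Y) : ℤ × ℤ) ∈ visited w)
    (hY : ∃ v ∈ visited w, Y < v.2) (he : (endpoint w).1 = -1 → Y < (endpoint w).2)
    (hw : Admissible (w ++ r)) (hx : ∀ v ∈ visited (w ++ r), -1 ≤ v.1)
    (hend : (endpoint (w ++ r)).1 = -1) : Y < (endpoint (w ++ r)).2 := by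
  induction r using List.reverseRecOn with
  | nil => simpa using he (by simpa using hend)
  | append_singleton r s ih =>
    rw [← List.append_assoc] at *
    have hx' : ∀ v ∈ visited (w ++ r), -1 ≤ v.1 := fun v hv ↦ hx v (visited_subset_append _ _ hv)
    obtain ⟨hw', hc, -, -⟩ := admissible_snoc.1 hw
    have hsub : visited w ⊆ visited (w ++ r) := visited_subset_append _ _
    have ih := ih hw' hx'
    have hprev := hx' _ (endpoint_mem_visited _)
    have hwest : (endpoint (w ++ r)).1 = 0 → Y < (endpoint (w ++ r)).2 := by
      intro h
      rcases hw'.onSide with hs | hs | hs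
      · obtain ⟨v, hv, hvY⟩ := hY
        exact hvY.trans_le (hs v (hsub hv))
      · exact absurd (h ▸ hs _ (hsub h1)) hm.not_ge
      · exact absurd (h ▸ hs _ (hsub h0)) (by simp)
    have hsouth : s = .south → (endpoint (w ++ r)).1 = -1 → (endpoint (w ++ r)).2 ≤ Y := by
      rintro rfl h
      exact clearAhead_south.1 hc _ (hsub h0) h.symm
    rw [endpoint_snoc] at hend ⊢
    cases s <;> simp only [Step.vec, Prod.fst_add, Prod.snd_add, forall_const] at * <;> omega

section Split

variable {r : Walk}

lemma mem_visited_split (h : p.Valid) (hr : p.isRow) :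
    ((0, p.height) : ℤ × ℤ) ∈ visited (p.slide 0 ++ [.west]) ∧
      ∃ b < (p.height : ℤ), ((p.width, b) : ℤ × ℤ) ∈ visited (p.slide 0 ++ [.west]) := by
  refine ⟨visited_subset_append _ _ (endpoint_slide_zero h hr ▸ endpoint_mem_visited _), ?_⟩
  obtain ⟨v, hv, hv1, hv2⟩ := h.inv.exists_fst_eq hr
  exact ⟨v.2, hv2, hv1 ▸ visited_subset_append _ _ (visited_word_subset_slide p 0 hv)⟩

lemma not_atNorth_of_split (h : p.Valid) (hr : p.isRow)
    (hw : Admissible (p.slide 0 ++ [.west] ++ r))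
    (hend : IsAdjacentToOrigin (endpoint (p.slide 0 ++ [.west] ++ r))) :
    ¬ AtNorth (p.slide 0 ++ [.west] ++ r) := by
  intro hs
  unfold IsAdjacentToOrigin at hend
  have h0 := (mem_visited_split h hr).1
  have hle := hs _ (visited_subset_append _ _ h0)
  have hpos := height_pos hr
  have he : endpoint (p.slide 0 ++ [.west] ++ r) = (0, (p.height : ℤ)) := by
    ext <;> simp only at hle ⊢ <;> omega
  rcases List.eq_nil_or_concat r with rfl | ⟨r, s, rfl⟩
  · rw [List.append_nil, endpoint_slide_zero_snoc_west h hr] at he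
    simp at he
  · rw [List.concat_eq_append, ← List.append_assoc] at hw he
    refine (admissible_snoc.1 hw).2.1.notMem ?_
    rw [← endpoint_snoc, he]
    exact visited_subset_append _ _ h0

lemma not_atEast_of_split (h : p.Valid) (hr : p.isRow) (hwidth : 0 < p.width)
    (hw : Admissible (p.slide 0 ++ [.west] ++ r))
    (hend : IsAdjacentToOrigin (endpoint (p.slide 0 ++ [.west] ++ r))) :
    ¬ AtEast (p.slide 0 ++ [.west] ++ r) := by
  intro hs
  unfold IsAdjacentToOrigin at hend
  obtain ⟨h0, b, hb, h1⟩ := mem_visited_split h hr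
  have hle := hs _ (visited_subset_append _ r h1)
  have hpos := height_pos hr
  simp only at hle
  have hwidth1 : (p.width : ℤ) = 1 := by omega
  have := le_endpoint_snd_of_fst_le_one (endpoint_slide_zero_snoc_west h hr) h0 hb
    (hwidth1 ▸ h1) hw (fun v hv ↦ (hs v hv).trans (by omega)) (by omega)
  omega

lemma isCounterclockwise_of_split_of_atWest (h : p.Valid) (hr : p.isRow) (hwidth : 0 < p.width)
    (hw : Admissible (p.slide 0 ++ [.west] ++ r))
    (hend : IsAdjacentToOrigin (endpoint (p.slide 0 ++ [.west] ++ r)))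
    (hs : AtWest (p.slide 0 ++ [.west] ++ r)) :
    IsCounterclockwise (p.slide 0 ++ [.west] ++ r) := by
  obtain ⟨h0, b, -, h1⟩ := mem_visited_split h hr
  have he := endpoint_slide_zero_snoc_west h hr
  have hem : ((-1, p.height) : ℤ × ℤ) ∈ visited _ := he ▸ endpoint_mem_visited _
  unfold IsAdjacentToOrigin at hend
  have hle := hs _ (visited_subset_append _ r hem)
  simp only at hle
  have he1 : (endpoint (p.slide 0 ++ [.west] ++ r)).1 = -1 := by omega
  have he2 : (endpoint (p.slide 0 ++ [.west] ++ r)).2 = 0 := by omega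
  have hx : ∀ v ∈ visited (p.slide 0 ++ [.west] ++ r), -1 ≤ v.1 := fun v hv ↦ he1 ▸ hs v hv
  rcases eq_replicate_south_or_cons_north he h0 hw hx with ⟨j, rfl⟩ | ⟨r, rfl⟩
  · obtain rfl : j = p.height := by
      rw [endpoint_append, he, endpoint_replicate] at he2
      simp only [Int.reduceNeg, Step.vec, Prod.smul_mk, Int.zsmul_eq_mul, mul_zero, mul_neg,
        mul_one, Prod.mk_add_mk, add_zero] at he2
      omega
    exact Or.inr (Or.inr ⟨p, h, hr, rfl⟩)
  · rw [List.append_cons] at hw hx he1 he2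
    have henorth : endpoint (p.slide 0 ++ [.west] ++ [.north]) = (-1, (p.height : ℤ) + 1) := by
      rw [endpoint_snoc, he]
      rfl
    have hlt := lt_endpoint_snd_of_neg_one_le_fst (by exact_mod_cast hwidth)
      (visited_subset_append _ _ h1) (visited_subset_append _ _ hem)
      ⟨_, endpoint_mem_visited _, by rw [henorth]; omega⟩ (by rw [henorth]; omega) hw hx he1
    omega

end Split

end Code

lemma isCounterclockwise_of_split {w₁ w₂ : Walk} (hw : Admissible (w₁ ++ [.west] ++ w₂))
    (hc : Walk.IsAlmostClosed (w₁ ++ [.west] ++ w₂)) (hx : ∀ v ∈ visited w₁, 0 ≤ v.1)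
    (he : (endpoint w₁).1 = 0) (hpos : ∃ v ∈ visited w₁, 0 < v.1) :
    IsCounterclockwise (w₁ ++ [.west] ++ w₂) := by
  obtain ⟨p, h, y, hy, rfl⟩ := coded_of_admissible hw.of_append.of_append hx
  obtain ⟨v, hv, hv0⟩ := hpos
  have hwidth := hv0.trans_le (h.inv.fst_le_slide h hy hv)
  rw [endpoint_slide h, node] at he
  by_cases hr : p.isRow
  · obtain rfl : y = 0 := by simpa [if_pos hr] using he
    have hend := (isAlmostClosed_iff.1 hc).2
    rcases hw.onSide with hs | hs | hs
    · exact absurd hs (not_atNorth_of_split h hr hw hend)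
    · exact absurd hs (not_atEast_of_split h hr (by exact_mod_cast hwidth) hw hend)
    · exact isCounterclockwise_of_split_of_atWest h hr (by exact_mod_cast hwidth) hw hend hs
  · simp only [if_neg hr] at he
    omega

lemma isCounterclockwise_or_mirror {w : Walk} (hw : Admissible w) (hc : w.IsAlmostClosed) :
    IsCounterclockwise w ∨ IsCounterclockwise (mirror w) := by
  by_cases hneg : ∃ v ∈ visited w, v.1 < 0
  swap
  · push Not at hneg
    exact isCounterclockwise_or_mirror_of_nonneg hw hc hneg
  by_cases hpos : ∃ v ∈ visited w, 0 < v.1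
  swap
  · push Not at hpos
    have := isCounterclockwise_or_mirror_of_nonneg (admissible_mirror.2 hw)
      (isAlmostClosed_mirror.2 hc)
      (forall_mem_visited_mirror.2 fun v hv ↦ neg_nonneg.2 (hpos v hv))
    rw [mirror_mirror] at this
    exact this.symm
  obtain ⟨w₁, w₂, hw₁, hx, he⟩ := exists_split_west hneg
  obtain ⟨u₁, u₂, hu₁, hx', he'⟩ := exists_split_west (w := mirror w)
    (exists_mem_visited_mirror.2 (by simpa using hpos))
  have hpre : w₁ ++ [.west] <+: w := ⟨w₂, hw₁.symm⟩
  have hpre' : mirror (u₁ ++ [.west]) <+: w :=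
    ⟨mirror u₂, by rw [← mirror_append, ← hu₁, mirror_mirror]⟩
  -- Whichever half-plane is entered first, the walk has been there before it enters the other.
  rcases List.prefix_or_prefix_of_prefix hpre hpre' with ⟨r, hr⟩ | ⟨r, hr⟩
  · have hm := hr ▸ visited_subset_append _ r (endpoint_mem_visited (w₁ ++ [Step.west]))
    rw [mem_visited_mirror, mem_visited_snoc, endpoint_snoc] at hm
    rw [hu₁]
    refine Or.inr (isCounterclockwise_of_split (hu₁ ▸ admissible_mirror.2 hw)
      (hu₁ ▸ isAlmostClosed_mirror.2 hc) hx' he' ?_)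
    rcases hm with hm | hm
    · exact ⟨_, hm, by simp [he, Step.vec]⟩
    · simpa [he, he', Step.vec] using congrArg Prod.fst hm
  · have hm := hr ▸ visited_subset_append _ r (endpoint_mem_visited (mirror (u₁ ++ [Step.west])))
    rw [mem_visited_snoc, endpoint_mirror, endpoint_snoc] at hm
    rw [hw₁]
    refine Or.inl (isCounterclockwise_of_split (hw₁ ▸ hw) (hw₁ ▸ hc) hx he ?_)
    rcases hm with hm | hm
    · exact ⟨_, hm, by simp [he', Step.vec]⟩
    · simpa [he, he', Step.vec] using congrArg Prod.fst hm

lemma polygons_eq (n : ℕ) : polygons n = {w | IsCounterclockwise w ∧ w.area = n} ∪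
    mirror '' {w | IsCounterclockwise w ∧ w.area = n} := by
  ext w
  constructor
  · rintro ⟨h1, h2, h3, h4⟩
    rcases isCounterclockwise_or_mirror ⟨h1, h2⟩ h3 with h | h
    · exact Or.inl ⟨h, h4⟩
    · exact Or.inr ⟨mirror w, ⟨h, (area_mirror w).trans h4⟩, mirror_mirror w⟩
  · rintro (⟨h, h4⟩ | ⟨w, ⟨h, h4⟩, rfl⟩)
    · exact ⟨h.admissible.1, h.admissible.2, h.isAlmostClosed, h4⟩
    · have hm := admissible_mirror.2 h.admissible
      exact ⟨hm.1, hm.2, isAlmostClosed_mirror.2 h.isAlmostClosed, (area_mirror w).trans h4⟩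

lemma disjoint_mirror (n : ℕ) : Disjoint {w | IsCounterclockwise w ∧ w.area = n}
    (mirror '' {w | IsCounterclockwise w ∧ w.area = n}) := by
  rw [Set.disjoint_left]
  rintro _ ⟨h, -⟩ ⟨w, ⟨h', -⟩, rfl⟩
  exact not_isCounterclockwise_mirror h' h

/-! ### Counting codes -/

/-- The codes of area `n` and width `M` that end with a north step. -/
def rowCodes (n M : ℕ) : Set Code := {p | p.Valid ∧ p.isRow ∧ p.areaLeft = n ∧ p.width = M}

/-- The codes of area `n` and width `M` that do not end with a north step. -/
def colCodes (n M : ℕ) : Set Code := {p | p.Valid ∧ ¬ p.isRow ∧ p.areaLeft = n ∧ p.width = M}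

/-- The codes of bar graphs of area `n`. -/
def barCodes (n : ℕ) : Set Code := {b | IsBar b ∧ b.areaLeft + b.width = n}

lemma rowCodes_eq (n M : ℕ) : rowCodes n M =
    (⋃ x ∈ (Finset.range (M + 1) : Set ℕ),
      (fun p ↦ row p x) '' (if x + 1 ≤ n then rowCodes (n - (x + 1)) M else ∅)) ∪
    up '' (if M + 1 ≤ n then colCodes (n - (M + 1)) M else ∅) := by
  ext p
  simp only [Set.mem_union, Set.mem_iUnion, Set.mem_image, Finset.coe_range, Set.mem_Iio]
  constructor
  · rintro ⟨h, hr, ha, hw⟩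
    cases p with
    | row p x =>
      obtain ⟨hv, hpr, hx⟩ := h
      simp only [areaLeft, width] at ha hw
      refine Or.inl ⟨x, by omega, p, ?_, rfl⟩
      rw [if_pos (by omega)]
      exact ⟨hv, hpr, by omega, hw⟩
    | up p =>
      obtain ⟨hv, hpr⟩ := h
      simp only [areaLeft, width] at ha hw
      refine Or.inr ⟨p, ?_, rfl⟩
      rw [if_pos (by omega)]
      exact ⟨hv, hpr, by omega, hw⟩
    | start | ext | col => exact (Bool.false_ne_true hr).elim
  · rintro (⟨x, hx, p, hp, rfl⟩ | ⟨p, hp, rfl⟩) <;> split_ifs at hp with hn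
    · obtain ⟨hv, hr, ha, hw⟩ := hp
      exact ⟨⟨hv, hr, by omega⟩, rfl, by simp only [areaLeft]; omega, hw⟩
    · exact hp.elim
    · obtain ⟨hv, hr, ha, hw⟩ := hp
      exact ⟨⟨hv, hr⟩, rfl, by simp only [areaLeft]; omega, hw⟩
    · exact hp.elim

lemma colCodes_zero (n : ℕ) : colCodes n 0 = if n = 0 then {start} else ∅ := by
  ext p
  constructor
  · rintro ⟨-, hr, rfl, hw⟩
    obtain rfl := eq_start_of_width_eq_zero hr hw
    exact Set.mem_singleton _
  · intro hp
    split_ifs at hp with hn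
    · rw [Set.mem_singleton_iff.1 hp]
      exact ⟨trivial, Bool.false_ne_true, hn.symm, rfl⟩
    · exact hp.elim

lemma colCodes_succ (n M : ℕ) : colCodes n (M + 1) =
    ext '' rowCodes n M ∪ ⋃ c ∈ (Finset.range (n + 1) : Set ℕ),
      (fun p ↦ col p c) '' colCodes (n - c) M := by
  ext p
  simp only [Set.mem_union, Set.mem_iUnion, Set.mem_image, Finset.coe_range, Set.mem_Iio]
  constructor
  · rintro ⟨h, hr, ha, hw⟩
    cases p with
    | start => cases hw
    | row | up => exact (hr rfl).elim
    | ext p => exact Or.inl ⟨p, ⟨h.1, h.2, ha, Nat.succ_injective hw⟩, rfl⟩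
    | col p c =>
      simp only [areaLeft] at ha
      exact Or.inr ⟨c, by omega, p, ⟨h.1, h.2, by omega, Nat.succ_injective hw⟩, rfl⟩
  · rintro (⟨p, ⟨hv, hr, ha, rfl⟩, rfl⟩ | ⟨c, hc, p, ⟨hv, hr, ha, rfl⟩, rfl⟩)
    · exact ⟨⟨hv, hr⟩, Bool.false_ne_true, ha, rfl⟩
    · exact ⟨⟨hv, hr⟩, Bool.false_ne_true, by simp only [areaLeft]; omega, rfl⟩

lemma barCodes_zero : barCodes 0 = {start} := by
  ext b
  constructor
  · rintro ⟨⟨-, hr, -⟩, h⟩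
    exact eq_start_of_width_eq_zero hr (by omega)
  · rintro rfl
    exact ⟨⟨trivial, Bool.false_ne_true, rfl⟩, rfl⟩

lemma barCodes_succ (n : ℕ) : barCodes (n + 1) =
    ⋃ c ∈ (Finset.range (n + 1) : Set ℕ), (fun p ↦ col p c) '' barCodes (n - c) := by
  ext b
  simp only [Set.mem_iUnion, Set.mem_image, Finset.coe_range, Set.mem_Iio]
  constructor
  · rintro ⟨⟨h, hr, hh⟩, ha⟩
    cases b with
    | start => cases ha
    | row | up => exact (hr rfl).elim
    | ext p => exact ((height_pos h.2).ne' hh).elim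
    | col p c =>
      simp only [areaLeft, width] at ha
      exact ⟨c, by omega, p, ⟨⟨h.1, h.2, hh⟩, by omega⟩, rfl⟩
  · rintro ⟨c, hc, b, ⟨⟨h, hr, hh⟩, ha⟩, rfl⟩
    exact ⟨⟨⟨h, hr⟩, Bool.false_ne_true, hh⟩, by simp only [areaLeft, width]; omega⟩

lemma finite_ite_empty {α : Type*} {P : Prop} [Decidable P] {s : Set α} (h : P → s.Finite) :
    (if P then s else ∅).Finite := by
  split_ifs with hP
  exacts [h hP, Set.finite_empty]

lemma finite_rowCodes_and_colCodes (n M : ℕ) : (rowCodes n M).Finite ∧ (colCodes n M).Finite := by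
  induction hN : n + M using Nat.strong_induction_on generalizing n M with
  | _ N ih =>
    subst hN
    constructor
    · rw [rowCodes_eq]
      exact (Set.Finite.biUnion (Finset.finite_toSet _) fun x _ ↦
        (finite_ite_empty fun h ↦ (ih _ (by omega) _ _ rfl).1).image _).union
        ((finite_ite_empty fun h ↦ (ih _ (by omega) _ _ rfl).2).image _)
    · cases M with
      | zero => exact colCodes_zero n ▸ finite_ite_empty fun _ ↦ Set.finite_singleton _
      | succ M =>
        rw [colCodes_succ]
        refine ((ih _ (by omega) _ _ rfl).1.image _).union
          (Set.Finite.biUnion (Finset.finite_toSet _) fun c hc ↦ ?_)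
        have := Finset.mem_range.1 (Finset.mem_coe.1 hc)
        exact (ih _ (by omega) _ _ rfl).2.image _

lemma finite_rowCodes (n M : ℕ) : (rowCodes n M).Finite := (finite_rowCodes_and_colCodes n M).1

lemma finite_colCodes (n M : ℕ) : (colCodes n M).Finite := (finite_rowCodes_and_colCodes n M).2

lemma finite_barCodes (n : ℕ) : (barCodes n).Finite := by
  induction n using Nat.strong_induction_on with
  | _ n ih =>
    cases n with
    | zero => exact barCodes_zero ▸ Set.finite_singleton _
    | succ n =>
      rw [barCodes_succ]
      exact Set.Finite.biUnion (Finset.finite_toSet _) fun c _ ↦ (ih _ (by omega)).image _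

/-- The number of codes of area `n` and width `M` that end with a north step. -/
noncomputable def rowCount (n M : ℕ) : ℕ := (rowCodes n M).ncard

/-- The number of codes of area `n` and width `M` that do not end with a north step. -/
noncomputable def colCount (n M : ℕ) : ℕ := (colCodes n M).ncard

/-- The number of codes of bar graphs of area `n`. -/
noncomputable def barCount (n : ℕ) : ℕ := (barCodes n).ncard

lemma ncard_biUnion_image {ι α β : Type*} {g : α → ι → β} {s : ι → Set α} (t : Finset ι)
    (hg : ∀ p p' x x', g p x = g p' x' → p = p' ∧ x = x') (hs : ∀ x, (s x).Finite) :
    (⋃ x ∈ (t : Set ι), (fun p ↦ g p x) '' s x).ncard = ∑ x ∈ t, (s x).ncard := by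
  rw [Set.Finite.ncard_biUnion (Finset.finite_toSet _) (fun x _ ↦ (hs x).image _),
    finsum_mem_coe_finset]
  · exact Finset.sum_congr rfl fun x _ ↦
      Set.ncard_image_of_injective _ fun p p' h ↦ (hg _ _ _ _ h).1
  · intro x _ x' _ hne
    rw [Function.onFun, Set.disjoint_left]
    rintro _ ⟨p, -, rfl⟩ ⟨p', -, h⟩
    exact hne (hg _ _ _ _ h).2.symm

lemma rowCount_eq (n M : ℕ) : rowCount n M =
    ∑ x ∈ Finset.range (M + 1), (if x + 1 ≤ n then rowCount (n - (x + 1)) M else 0) +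
      if M + 1 ≤ n then colCount (n - (M + 1)) M else 0 := by
  have hrow (x : ℕ) : (if x + 1 ≤ n then rowCodes (n - (x + 1)) M else ∅ : Set Code).Finite :=
    finite_ite_empty fun _ ↦ finite_rowCodes _ _
  have hcol : (if M + 1 ≤ n then colCodes (n - (M + 1)) M else ∅ : Set Code).Finite :=
    finite_ite_empty fun _ ↦ finite_colCodes _ _
  rw [rowCount, rowCodes_eq, Set.ncard_union_eq ?_
      (Set.Finite.biUnion (Finset.finite_toSet _) fun x _ ↦ (hrow x).image _) (hcol.image _),
    ncard_biUnion_image (g := row) _ (by simp) hrow,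
    Set.ncard_image_of_injective _ fun p p' h ↦ by simpa using h]
  · simp only [rowCount, colCount, apply_ite Set.ncard, Set.ncard_empty]
  · rw [Set.disjoint_left]
    rintro _ hp ⟨p', -, rfl⟩
    simp at hp

lemma colCount_zero (n : ℕ) : colCount n 0 = if n = 0 then 1 else 0 := by
  rw [colCount, colCodes_zero, apply_ite Set.ncard, Set.ncard_singleton, Set.ncard_empty]

lemma colCount_succ (n M : ℕ) : colCount n (M + 1) =
    rowCount n M + ∑ c ∈ Finset.range (n + 1), colCount (n - c) M := by
  rw [colCount, colCodes_succ, Set.ncard_union_eq ?_ ((finite_rowCodes _ _).image _)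
      (Set.Finite.biUnion (Finset.finite_toSet _) fun x _ ↦ (finite_colCodes _ _).image _),
    ncard_biUnion_image (g := col) _ (by simp) fun c ↦ finite_colCodes (n - c) M,
    Set.ncard_image_of_injective _ fun p p' h ↦ by simpa using h]
  · rfl
  · rw [Set.disjoint_left]
    rintro _ ⟨p, -, rfl⟩ hp
    simp at hp

lemma barCount_succ (n : ℕ) :
    barCount (n + 1) = ∑ c ∈ Finset.range (n + 1), barCount (n - c) := by
  rw [barCount, barCodes_succ,
    ncard_biUnion_image (g := col) _ (by simp) fun c ↦ finite_barCodes (n - c)]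
  rfl

lemma barCount_succ_eq_two_pow (n : ℕ) : barCount (n + 1) = 2 ^ n := by
  induction n with
  | zero =>
    rw [barCount_succ, Finset.sum_range_one, barCount, barCodes_zero, Set.ncard_singleton,
      pow_zero]
  | succ n ih =>
    rw [barCount_succ, Finset.sum_range_succ', pow_succ, ← ih]
    simp only [Nat.reduceSubDiff, tsub_zero, ← barCount_succ]
    ring

lemma width_lt_areaLeft {p : Code} (h : p.Valid) (hr : p.isRow) : p.width < p.areaLeft := by
  induction p with
  | row p x ih => have := ih h.1 h.2.1; simp only [width, areaLeft]; omega
  | up p _ => simp only [width, areaLeft]; omega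
  | start | ext | col => exact (Bool.false_ne_true hr).elim

lemma rowCount_eq_zero {n M : ℕ} (h : n ≤ M) : rowCount n M = 0 := by
  rw [rowCount, Set.ncard_eq_zero (finite_rowCodes _ _), Set.eq_empty_iff_forall_notMem]
  rintro p ⟨hv, hr, rfl, rfl⟩
  exact h.not_gt (width_lt_areaLeft hv hr)

/-! ### Counting polygons -/

lemma one_le_width_of_mem_barCodes {b : Code} {n : ℕ} (hb : b ∈ barCodes (n + 1)) :
    1 ≤ b.width := by
  by_contra hw
  obtain rfl := eq_start_of_width_eq_zero hb.1.2.1 (by omega)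
  cases hb.2

lemma setOf_isCounterclockwise_zero : {w | IsCounterclockwise w ∧ w.area = 0} = ∅ := by
  rw [Set.eq_empty_iff_forall_notMem]
  rintro w ⟨h, ha⟩
  have := h.signedArea_pos
  have := h.area_eq_signedArea
  omega

/-- The codes of area `n` that end with a north step. -/
def allRowCodes (n : ℕ) : Set Code := ⋃ M ∈ (Finset.range n : Set ℕ), rowCodes n M

lemma mem_allRowCodes {n : ℕ} {p : Code} :
    p ∈ allRowCodes n ↔ p.Valid ∧ p.isRow ∧ p.areaLeft = n := by
  simp only [allRowCodes, Set.mem_iUnion, Finset.coe_range, Set.mem_Iio]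
  constructor
  · rintro ⟨M, -, hv, hr, ha, -⟩
    exact ⟨hv, hr, ha⟩
  · rintro ⟨hv, hr, rfl⟩
    exact ⟨p.width, width_lt_areaLeft hv hr, hv, hr, rfl, rfl⟩

lemma finite_allRowCodes (n : ℕ) : (allRowCodes n).Finite :=
  Set.Finite.biUnion (Finset.finite_toSet _) fun _ _ ↦ finite_rowCodes _ _

lemma ncard_allRowCodes (n : ℕ) : (allRowCodes n).ncard = ∑ M ∈ Finset.range n, rowCount n M := by
  rw [allRowCodes, Set.Finite.ncard_biUnion (Finset.finite_toSet _) fun M _ ↦ finite_rowCodes _ _,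
    finsum_mem_coe_finset]
  · rfl
  · intro M _ M' _ hne
    rw [Function.onFun, Set.disjoint_left]
    rintro p ⟨-, -, -, h⟩ ⟨-, -, -, h'⟩
    exact hne (h.symm.trans h')

lemma setOf_isCounterclockwise_succ (n : ℕ) : {w | IsCounterclockwise w ∧ w.area = n + 1} =
    insert (hook (n + 1)) (bar '' barCodes (n + 1) ∪ wrap '' allRowCodes (n + 1)) := by
  ext w
  constructor
  · rintro ⟨h, ha⟩
    have hs := h.area_eq_signedArea
    rw [ha] at hs
    rcases h with ⟨m, -, rfl⟩ | ⟨b, hb, -, rfl⟩ | ⟨p, h, hr, rfl⟩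
    · rw [signedArea_hook, Nat.cast_inj] at hs
      exact Or.inl (hs ▸ rfl)
    · rw [signedArea_bar hb] at hs
      exact Or.inr (Or.inl ⟨b, ⟨hb, by omega⟩, rfl⟩)
    · rw [signedArea_wrap h hr] at hs
      exact Or.inr (Or.inr ⟨p, mem_allRowCodes.2 ⟨h, hr, by omega⟩, rfl⟩)
  · have of_signedArea {w : Walk} (h : IsCounterclockwise w) (hs : signedArea w = (n + 1 : ℕ)) :
        IsCounterclockwise w ∧ w.area = n + 1 :=
      ⟨h, Nat.cast_injective (h.area_eq_signedArea.trans hs)⟩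
    rintro (rfl | ⟨b, hb, rfl⟩ | ⟨p, hp, rfl⟩)
    · exact of_signedArea (Or.inl ⟨n + 1, by omega, rfl⟩) (signedArea_hook _)
    · refine of_signedArea (Or.inr (Or.inl ⟨b, hb.1, one_le_width_of_mem_barCodes hb, rfl⟩)) ?_
      rw [signedArea_bar hb.1, ← hb.2, Nat.cast_add]
    · obtain ⟨hv, hr, ha⟩ := mem_allRowCodes.1 hp
      exact of_signedArea (Or.inr (Or.inr ⟨p, hv, hr, rfl⟩)) (by rw [signedArea_wrap hv hr, ha])

lemma hook_notMem (n : ℕ) :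
    hook (n + 1) ∉ bar '' barCodes (n + 1) ∪ wrap '' allRowCodes (n + 1) := by
  rintro (⟨b, hb, he⟩ | ⟨p, hp, he⟩) <;> apply_fun endpoint at he
  · simp [endpoint_bar hb.1, endpoint_hook] at he
  · obtain ⟨hv, hr, -⟩ := mem_allRowCodes.1 hp
    simp [endpoint_wrap hv hr, endpoint_hook] at he

lemma disjoint_bar_wrap (n : ℕ) : Disjoint (bar '' barCodes n) (wrap '' allRowCodes n) := by
  rw [Set.disjoint_left]
  rintro _ ⟨b, hb, rfl⟩ ⟨p, hp, he⟩
  obtain ⟨hv, hr, -⟩ := mem_allRowCodes.1 hp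
  apply_fun endpoint at he
  simp [endpoint_bar hb.1, endpoint_wrap hv hr] at he

lemma finite_isCounterclockwise (n : ℕ) : {w | IsCounterclockwise w ∧ w.area = n}.Finite := by
  cases n with
  | zero => rw [setOf_isCounterclockwise_zero]; exact Set.finite_empty
  | succ n =>
    rw [setOf_isCounterclockwise_succ]
    exact (((finite_barCodes _).image _).union ((finite_allRowCodes _).image _)).insert _

lemma ncard_isCounterclockwise_succ (n : ℕ) :
    {w | IsCounterclockwise w ∧ w.area = n + 1}.ncard =
      1 + 2 ^ n + ∑ M ∈ Finset.range (n + 1), rowCount (n + 1) M := by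
  have hbar := (finite_barCodes (n + 1)).image bar
  have hwrap := (finite_allRowCodes (n + 1)).image wrap
  have hbar_inj : Set.InjOn bar (barCodes (n + 1)) := fun b hb c hc he ↦
    bar_injective hb.1 hc.1 he
  have hwrap_inj : Set.InjOn wrap (allRowCodes (n + 1)) := fun p hp q hq he ↦ by
    obtain ⟨hpv, hpr, -⟩ := mem_allRowCodes.1 hp
    obtain ⟨hqv, hqr, -⟩ := mem_allRowCodes.1 hq
    exact wrap_injective hpv hpr hqv hqr he
  rw [setOf_isCounterclockwise_succ, Set.ncard_insert_of_notMem (hook_notMem n) (hbar.union hwrap),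
    Set.ncard_union_eq (disjoint_bar_wrap _) hbar hwrap, hbar_inj.ncard_image,
    hwrap_inj.ncard_image, ncard_allRowCodes, ← barCount, barCount_succ_eq_two_pow]
  ring

lemma finite_polygons (n : ℕ) : (polygons n).Finite := by
  rw [polygons_eq]
  exact (finite_isCounterclockwise n).union ((finite_isCounterclockwise n).image _)

lemma ncard_polygons (n : ℕ) :
    (polygons n).ncard = 2 * {w | IsCounterclockwise w ∧ w.area = n}.ncard := by
  rw [polygons_eq, Set.ncard_union_eq (disjoint_mirror n) (finite_isCounterclockwise n)
      ((finite_isCounterclockwise n).image _),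
    Set.ncard_image_of_injective _ mirror_injective, two_mul]

lemma ncard_polygons_zero : (polygons 0).ncard = 0 := by
  rw [ncard_polygons, setOf_isCounterclockwise_zero, Set.ncard_empty, mul_zero]

lemma ncard_polygons_succ (n : ℕ) : (polygons (n + 1)).ncard =
    2 * (1 + 2 ^ n + ∑ M ∈ Finset.range (n + 1), rowCount (n + 1) M) := by
  rw [ncard_polygons, ncard_isCounterclockwise_succ]

/-! ### The infinite `q`-Pochhammer symbol -/

lemma iteratedDeriv_div_factorial_of_hasSum {c : ℕ → ℂ} {g : ℂ → ℂ}
    (h : ∀ᶠ z in 𝓝 0, HasSum (fun n ↦ c n * z ^ n) (g z)) (n : ℕ) :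
    iteratedDeriv n g 0 / (n.factorial : ℂ) = c n := by
  have hg : HasFPowerSeriesAt g (FormalMultilinearSeries.ofScalars ℂ c) 0 := by
    rw [hasFPowerSeriesAt_iff]
    filter_upwards [h] with z hz
    simpa [FormalMultilinearSeries.coeff_ofScalars, mul_comm] using hz
  obtain ⟨r, hr⟩ := hg
  have hc := hr.factorial_smul 1 n
  rw [iteratedDeriv_eq_iteratedFDeriv, div_eq_iff (by exact_mod_cast n.factorial_ne_zero)]
  refine hc.symm.trans ?_
  simp [FormalMultilinearSeries.ofScalars, mul_comm]

section QPoch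

variable {a b x z q : ℂ}

lemma summable_norm_mul_pow (x : ℂ) (hq : ‖q‖ < 1) : Summable fun j : ℕ ↦ ‖-(x * q ^ j)‖ := by
  simp only [norm_neg, norm_mul, norm_pow]
  exact (summable_geometric_of_lt_one (norm_nonneg _) hq).mul_left _

lemma multipliable_qPoch (x : ℂ) (hq : ‖q‖ < 1) : Multipliable fun j : ℕ ↦ 1 - x * q ^ j := by
  simp only [sub_eq_add_neg]
  exact multipliable_one_add_of_summable (summable_norm_mul_pow x hq)

lemma qPoch_ne_zero (hq : ‖q‖ < 1) (h : ∀ j : ℕ, x * q ^ j ≠ 1) : qPoch x q ≠ 0 := by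
  simp only [qPoch, sub_eq_add_neg]
  refine tprod_one_add_ne_zero_of_summable (fun j ↦ ?_) (summable_norm_mul_pow x hq)
  rw [← sub_eq_add_neg, sub_ne_zero]
  exact (h j).symm

lemma qPoch_ne_zero_of_norm_lt_one (hq : ‖q‖ < 1) (hx : ‖x‖ < 1) : qPoch x q ≠ 0 := by
  refine qPoch_ne_zero hq fun j h ↦ ?_
  have hlt : ‖x * q ^ j‖ < 1 := by
    rw [norm_mul, norm_pow]
    exact mul_lt_one_of_nonneg_of_lt_one_left (norm_nonneg _) hx
      (pow_le_one₀ (norm_nonneg _) hq.le)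
  rw [h, norm_one] at hlt
  exact lt_irrefl _ hlt

lemma qPoch_eq_mul (x : ℂ) (hq : ‖q‖ < 1) : qPoch x q = (1 - x) * qPoch (x * q) q := by
  have shift : (fun j : ℕ ↦ 1 - x * q ^ (j + 1)) = fun j : ℕ ↦ 1 - x * q * q ^ j := by
    ext j; ring
  have h := tprod_eq_zero_mul' (f := fun j : ℕ ↦ 1 - x * q ^ j)
    (by rw [shift]; exact multipliable_qPoch (x * q) hq)
  rw [shift] at h
  simpa [qPoch] using h

lemma analyticAt_qPoch {g k : ℂ → ℂ} (hg : AnalyticAt ℂ g z) (hk : AnalyticAt ℂ k z)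
    (hz : ‖k z‖ < 1) : AnalyticAt ℂ (fun w ↦ qPoch (g w) (k w)) z := by
  obtain ⟨r, hr, hr1⟩ := exists_between hz
  have hmem : ∀ᶠ w in 𝓝 z, AnalyticAt ℂ g w ∧ AnalyticAt ℂ k w ∧ ‖g w‖ < ‖g z‖ + 1 ∧ ‖k w‖ < r :=
    hg.eventually_analyticAt.and <| hk.eventually_analyticAt.and <|
      (hg.continuousAt.norm.eventually_lt_const (lt_add_one _)).and
        (hk.continuousAt.norm.eventually_lt_const hr)
  obtain ⟨U, hU, hUo, hzU⟩ := eventually_nhds_iff.1 hmem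
  have hbound : Summable fun j : ℕ ↦ (‖g z‖ + 1) * r ^ j :=
    (summable_geometric_of_lt_one ((norm_nonneg _).trans hr.le) hr1).mul_left _
  have hle (j : ℕ) : ∀ w ∈ U, ‖-(g w * k w ^ j)‖ ≤ (‖g z‖ + 1) * r ^ j := fun w hw ↦ by
    obtain ⟨-, -, hgw, hkw⟩ := hU w hw
    rw [norm_neg, norm_mul, norm_pow]
    gcongr
  have hd (j : ℕ) : DifferentiableOn ℂ (fun w ↦ -(g w * k w ^ j)) U := fun w hw ↦
    ((hU w hw).1.differentiableAt.mul
      ((hU w hw).2.1.differentiableAt.pow j)).neg.differentiableWithinAt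
  simp only [qPoch, sub_eq_add_neg]
  refine DifferentiableOn.analyticAt ?_ (hUo.mem_nhds hzU)
  exact (hbound.hasProdLocallyUniformlyOn_nat_one_add hUo (.of_forall hle)
    fun j ↦ (hd j).continuousOn).differentiableOn (.of_forall fun _ ↦ by
      simpa [Finset.prod_fn] using DifferentiableOn.finsetProd fun j _ ↦ (hd j).const_add 1) hUo

lemma one_sub_ne_zero (hq : ‖q‖ < 1) : 1 - q ≠ 0 := (isUnit_one_sub_of_norm_lt_one hq).ne_zero

lemma one_sub_pow_succ_ne_zero (hq : ‖q‖ < 1) (n : ℕ) : 1 - q ^ (n + 1) ≠ 0 :=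
  one_sub_ne_zero (by rw [norm_pow]; exact pow_lt_one₀ (norm_nonneg _) hq n.succ_ne_zero)

/-- The coefficient of `z ^ ν` in `(b z; q)_∞ / (a z; q)_∞`, according to Cauchy's `q`-binomial
theorem. -/
noncomputable def cauchyCoeff (a b q : ℂ) (ν : ℕ) : ℂ :=
  ∏ i ∈ Finset.range ν, (a - b * q ^ i) / (1 - q ^ (i + 1))

lemma cauchyCoeff_zero : cauchyCoeff a b q 0 = 1 := Finset.prod_range_zero _

lemma cauchyCoeff_succ (ν : ℕ) : cauchyCoeff a b q (ν + 1) =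
    cauchyCoeff a b q ν * ((a - b * q ^ ν) / (1 - q ^ (ν + 1))) :=
  Finset.prod_range_succ _ _

lemma summable_cauchyCoeff (hq : ‖q‖ < 1) (hz : ‖a * z‖ < 1) :
    Summable fun ν ↦ cauchyCoeff a b q ν * z ^ ν := by
  obtain ⟨r, hr, hr1⟩ := exists_between hz
  have hpow := tendsto_pow_atTop_nhds_zero_of_norm_lt_one hq
  have hratio : Filter.Tendsto (fun ν ↦ (a - b * q ^ ν) / (1 - q ^ (ν + 1)) * z) Filter.atTop
      (𝓝 (a * z)) := by
    simpa using ((hpow.const_mul b).const_sub a).div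
      (((Filter.tendsto_add_atTop_iff_nat 1).2 hpow).const_sub 1) (by simp) |>.mul_const z
  refine summable_of_ratio_norm_eventually_le hr1 ?_
  filter_upwards [hratio.norm.eventually_lt_const hr] with ν hν
  calc ‖cauchyCoeff a b q (ν + 1) * z ^ (ν + 1)‖
      = ‖(a - b * q ^ ν) / (1 - q ^ (ν + 1)) * z‖ * ‖cauchyCoeff a b q ν * z ^ ν‖ := by
        rw [cauchyCoeff_succ, pow_succ, ← norm_mul]
        ring_nf
    _ ≤ r * ‖cauchyCoeff a b q ν * z ^ ν‖ := by gcongr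

lemma tsum_cauchyCoeff_funEq (hq : ‖q‖ < 1) (hz : ‖a * z‖ < 1) :
    (1 - a * z) * ∑' ν, cauchyCoeff a b q ν * z ^ ν =
      (1 - b * z) * ∑' ν, cauchyCoeff a b q ν * (z * q) ^ ν := by
  have hz' : ‖a * (z * q)‖ < 1 := by
    rw [← mul_assoc, norm_mul]
    exact mul_lt_one_of_nonneg_of_lt_one_left (norm_nonneg _) hz hq.le
  have h := summable_cauchyCoeff (b := b) hq hz
  have h' := summable_cauchyCoeff (b := b) hq hz'
  have key : (∑' ν, cauchyCoeff a b q (ν + 1) * z ^ (ν + 1)) -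
        a * z * ∑' ν, cauchyCoeff a b q ν * z ^ ν =
      (∑' ν, cauchyCoeff a b q (ν + 1) * (z * q) ^ (ν + 1)) -
        b * z * ∑' ν, cauchyCoeff a b q ν * (z * q) ^ ν := by
    rw [← tsum_mul_left, ← tsum_mul_left, ← ((summable_nat_add_iff 1).2 h).tsum_sub (h.mul_left _),
      ← ((summable_nat_add_iff 1).2 h').tsum_sub (h'.mul_left _)]
    refine tsum_congr fun ν ↦ ?_
    have := one_sub_pow_succ_ne_zero hq ν
    rw [cauchyCoeff_succ]
    field_simp
    ring
  have split := h.tsum_eq_zero_add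
  have split' := h'.tsum_eq_zero_add
  rw [pow_zero] at split split'
  linear_combination key + split - split'

lemma tendsto_tsum_cauchyCoeff (hq : ‖q‖ < 1) :
    Filter.Tendsto (fun z ↦ ∑' ν, cauchyCoeff a b q ν * z ^ ν) (𝓝 0) (𝓝 1) := by
  have hnear : ∀ᶠ z in 𝓝 (0 : ℂ), ‖a * z‖ < 1 :=
    (by fun_prop : Continuous fun z : ℂ ↦ ‖a * z‖).continuousAt.eventually_lt_const (by simp)
  have hpow : HasFPowerSeriesAt (fun z ↦ ∑' ν, cauchyCoeff a b q ν * z ^ ν)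
      (FormalMultilinearSeries.ofScalars ℂ (cauchyCoeff a b q)) 0 := by
    rw [hasFPowerSeriesAt_iff]
    filter_upwards [hnear] with z hz
    simpa [FormalMultilinearSeries.coeff_ofScalars, mul_comm] using
      (summable_cauchyCoeff hq hz).hasSum
  have hzero : ∑' ν, cauchyCoeff a b q ν * (0 : ℂ) ^ ν = 1 := by
    rw [tsum_eq_single 0 (by intro n hn; simp [hn]), cauchyCoeff_zero, pow_zero, mul_one]
  exact hzero ▸ hpow.analyticAt.continuousAt.tendsto

theorem q_binomial (hq : ‖q‖ < 1) (hz : ‖a * z‖ < 1) :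
    qPoch (a * z) q * ∑' ν, cauchyCoeff a b q ν * z ^ ν = qPoch (b * z) q := by
  have iterated (n : ℕ) :
      (∏ j ∈ Finset.range n, (1 - a * z * q ^ j)) * ∑' ν, cauchyCoeff a b q ν * z ^ ν =
        (∏ j ∈ Finset.range n, (1 - b * z * q ^ j)) *
          ∑' ν, cauchyCoeff a b q ν * (z * q ^ n) ^ ν := by
    induction n with
    | zero => simp
    | succ n ih =>
      have hn : ‖a * (z * q ^ n)‖ < 1 := by
        rw [← mul_assoc, norm_mul, norm_pow]
        exact mul_lt_one_of_nonneg_of_lt_one_left (norm_nonneg _) hz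
          (pow_le_one₀ (norm_nonneg _) hq.le)
      have := tsum_cauchyCoeff_funEq (b := b) hq hn
      rw [Finset.prod_range_succ, Finset.prod_range_succ, pow_succ, ← mul_assoc z]
      linear_combination (1 - a * z * q ^ n) * ih +
        (∏ j ∈ Finset.range n, (1 - b * z * q ^ j)) * this
  have hshift : Filter.Tendsto (fun n ↦ z * q ^ n) Filter.atTop (𝓝 0) := by
    simpa using (tendsto_pow_atTop_nhds_zero_of_norm_lt_one hq).const_mul z
  have hleft := (multipliable_qPoch (a * z) hq).hasProd.tendsto_prod_nat.mul_const
    (∑' ν, cauchyCoeff a b q ν * z ^ ν)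
  have hright := (multipliable_qPoch (b * z) hq).hasProd.tendsto_prod_nat.mul
    ((tendsto_tsum_cauchyCoeff (a := a) (b := b) hq).comp hshift)
  rw [mul_one] at hright
  exact tendsto_nhds_unique hleft (hright.congr fun n ↦ (iterated n).symm)

end QPoch

/-! ### The coefficients of `1 / Q` -/

variable {q z : ℂ}

lemma hasSum_one_div_Q (hq : ‖q‖ < 1) (hz : ‖v q * z‖ < 1) :
    HasSum (fun ν ↦ cauchyCoeff (v q) (q * u q) q ν * z ^ ν) (1 / Q z q) := by
  rw [Q, one_div_div, ← q_binomial hq hz, mul_div_cancel_left₀ _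
    (qPoch_ne_zero_of_norm_lt_one hq hz)]
  exact (summable_cauchyCoeff hq hz).hasSum

lemma d_eq_cauchyCoeff (hq : ‖q‖ < 1) (ν : ℕ) : d ν q = cauchyCoeff (v q) (q * u q) q ν := by
  refine iteratedDeriv_div_factorial_of_hasSum ?_ ν
  have hnear : ∀ᶠ z in 𝓝 (0 : ℂ), ‖v q * z‖ < 1 :=
    (by fun_prop : Continuous fun z : ℂ ↦ ‖v q * z‖).continuousAt.eventually_lt_const (by simp)
  filter_upwards [hnear] with z hz using hasSum_one_div_Q hq hz

lemma one_sub_norm_le_norm_one_sub (q : ℂ) : 1 - ‖q‖ ≤ ‖1 - q‖ := by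
  simpa using norm_sub_norm_le 1 q

lemma norm_u_le (hq : ‖q‖ ≤ 55 / 100) : ‖u q‖ ≤ 11 / 9 := by
  have := one_sub_norm_le_norm_one_sub q
  rw [u, norm_div, div_le_iff₀ (by linarith)]
  linarith

lemma v_eq (hq : ‖q‖ < 1) : v q = 1 + q ^ 2 / (1 - q) := by
  have := one_sub_ne_zero hq
  rw [v]
  field_simp

lemma norm_v_le (hq : ‖q‖ ≤ 55 / 100) : ‖v q‖ ≤ 16723 / 10000 := by
  have h1 := one_sub_norm_le_norm_one_sub q
  have h2 : ‖q ^ 2 / (1 - q)‖ ≤ 6723 / 10000 := by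
    rw [norm_div, norm_pow, div_le_iff₀ (by linarith)]
    nlinarith [norm_nonneg q]
  rw [v_eq (by linarith)]
  refine (norm_add_le _ _).trans ?_
  rw [norm_one]
  linarith

lemma norm_mul_u_lt_one (hq : ‖q‖ ≤ 55 / 100) : ‖q * u q‖ < 1 := by
  rw [norm_mul]
  nlinarith [norm_u_le hq, norm_nonneg q, norm_nonneg (u q)]

lemma qPoch_mul_u_ne_zero (hq : ‖q‖ ≤ 55 / 100) : qPoch (q * u q) q ≠ 0 :=
  qPoch_ne_zero_of_norm_lt_one (by linarith) (norm_mul_u_lt_one hq)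

lemma norm_cauchyCoeff_factor_le (hq : ‖q‖ ≤ 55 / 100) {y B : ℝ} {i : ℕ} (hy : ‖q ^ (i + 1)‖ ≤ y)
    (hy1 : y < 1) (hB : 16723 / 10000 + 11 / 9 * y ≤ B * (1 - y)) (hB0 : 0 ≤ B) :
    ‖(v q - q * u q * q ^ i) / (1 - q ^ (i + 1))‖ ≤ B := by
  have hden := one_sub_norm_le_norm_one_sub (q ^ (i + 1))
  rw [norm_div, div_le_iff₀ (by linarith)]
  calc ‖v q - q * u q * q ^ i‖ = ‖v q - u q * q ^ (i + 1)‖ := by ring_nf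
    _ ≤ ‖v q‖ + ‖u q‖ * ‖q ^ (i + 1)‖ := (norm_sub_le _ _).trans_eq (by rw [norm_mul])
    _ ≤ 16723 / 10000 + 11 / 9 * y := by gcongr; exacts [norm_v_le hq, norm_u_le hq]
    _ ≤ B * (1 - y) := hB
    _ ≤ B * ‖1 - q ^ (i + 1)‖ := by gcongr; linarith

lemma norm_prod_range_le_mul_pow {R : Type*} [SeminormedCommRing R] [NormOneClass R] {f : ℕ → R}
    {K B : ℝ} {N : ℕ} (hK : 1 ≤ K) (hB : 1 ≤ B) (hf : ∀ i, ‖f i‖ ≤ K)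
    (hfN : ∀ i, N ≤ i → ‖f i‖ ≤ B) (n : ℕ) : ‖∏ i ∈ Finset.range n, f i‖ ≤ K ^ N * B ^ n := by
  suffices h : ‖∏ i ∈ Finset.range n, f i‖ ≤ K ^ min n N * B ^ n from
    h.trans (by gcongr; exact min_le_right n N)
  induction n with
  | zero => simp
  | succ n ih =>
    rw [Finset.prod_range_succ]
    refine (norm_mul_le_of_le ih le_rfl).trans ?_
    rcases lt_or_ge n N with hn | hn
    · rw [min_eq_left hn.le, min_eq_left hn, pow_succ, pow_succ]
      calc K ^ n * B ^ n * ‖f n‖ ≤ K ^ n * B ^ n * K := by gcongr; exact hf n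
        _ ≤ K ^ n * K * (B ^ n * B) := by
          rw [mul_right_comm]
          gcongr
          exact le_mul_of_one_le_right (by positivity) hB
    · rw [min_eq_right hn, min_eq_right (hn.trans n.le_succ), pow_succ, ← mul_assoc]
      gcongr
      exact hfN n hn

/-- From the eighth factor on, each factor of `d ν q` is at most `7 / 4` in absolute value, which
the powers of `55 / 100` in the series for `PA` outweigh. -/
lemma norm_d_le (hq : ‖q‖ ≤ 55 / 100) (ν : ℕ) : ‖d ν q‖ ≤ 6 ^ 7 * (7 / 4) ^ ν := by
  rw [d_eq_cauchyCoeff (by linarith), cauchyCoeff]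
  refine norm_prod_range_le_mul_pow (by norm_num) (by norm_num) (fun i ↦ ?_) (fun i hi ↦ ?_) ν
  · refine norm_cauchyCoeff_factor_le hq ?_ (by norm_num : (55 / 100 : ℝ) < 1) (by norm_num)
      (by norm_num)
    rw [norm_pow]
    exact (pow_le_of_le_one (norm_nonneg _) (by linarith) i.succ_ne_zero).trans hq
  · refine norm_cauchyCoeff_factor_le hq (y := (55 / 100) ^ 8) ?_ (by norm_num) (by norm_num)
      (by norm_num)
    rw [norm_pow]
    calc ‖q‖ ^ (i + 1) ≤ (55 / 100) ^ (i + 1) := by gcongr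
      _ ≤ (55 / 100) ^ 8 := pow_le_pow_of_le_one (by norm_num) (by norm_num) (by omega)

/-! ### The zeros of `1 - 2 x + x ^ m` -/

lemma natCast_mul_pow_pred_le_one {m : ℕ} (hm : 4 ≤ m) :
    (m : ℝ) * (55 / 100) ^ (m - 1) ≤ 1 := by
  induction m, hm using Nat.le_induction with
  | base => norm_num
  | succ m hm ih =>
    have hm' : (4 : ℝ) ≤ m := by exact_mod_cast hm
    obtain ⟨j, rfl⟩ := Nat.exists_eq_add_of_le' (show 1 ≤ m by omega)
    have hpos : (0 : ℝ) < (55 / 100) ^ j := by positivity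
    rw [Nat.add_sub_cancel] at ih ⊢
    rw [pow_succ]
    push_cast at *
    nlinarith

lemma norm_pow_sub_pow_le {R : Type*} [SeminormedCommRing R] [NormOneClass R] {x y : R} {r : ℝ}
    (hx : ‖x‖ ≤ r) (hy : ‖y‖ ≤ r) (n : ℕ) :
    ‖x ^ n - y ^ n‖ ≤ n * r ^ (n - 1) * ‖x - y‖ := by
  have : 0 ≤ r := (norm_nonneg x).trans hx
  rw [← geom_sum₂_mul]
  refine norm_mul_le_of_le ((norm_sum_le _ _).trans ?_) le_rfl
  refine (Finset.sum_le_card_nsmul _ _ (r ^ (n - 1)) fun i hi ↦ ?_).trans (by simp)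
  have hi' : i + (n - 1 - i) = n - 1 := by have := Finset.mem_range.1 hi; omega
  rw [← hi', pow_add, hi']
  exact norm_mul_le_of_le ((norm_pow_le x i).trans (by gcongr))
    ((norm_pow_le y _).trans (by gcongr))

/-- The solutions of `2 q = 1 + q ^ m` are the fixed points of a contraction of the disc. -/
lemma root_unique {m : ℕ} (hm : 4 ≤ m) {z q : ℂ} (hz : ‖z‖ ≤ 55 / 100) (hq : ‖q‖ ≤ 55 / 100)
    (hz0 : 1 - 2 * z + z ^ m = 0) (hq0 : 1 - 2 * q + q ^ m = 0) : q = z := by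
  have hdiff : 2 * (q - z) = q ^ m - z ^ m := by linear_combination hz0 - hq0
  have hle := (norm_pow_sub_pow_le hq hz m).trans
    (mul_le_of_le_one_left (norm_nonneg _) (natCast_mul_pow_pred_le_one hm))
  rw [← hdiff, norm_mul, Complex.norm_ofNat] at hle
  exact sub_eq_zero.1 (norm_le_zero_iff.1 (by linarith))

lemma le_of_real_roots {m : ℕ} (hm : 2 ≤ m) {x y : ℝ} (hx : 0 < x) (hy : y < 1)
    (hx0 : 1 - 2 * x + x ^ m = 0) (hy0 : 1 - 2 * y + y ^ m = 0) : y ≤ x := by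
  by_contra! hxy
  have hslope := (strictConvexOn_pow hm).slope_strict_mono_adjacent (Set.mem_Ici.2 hx.le)
    (Set.mem_Ici.2 zero_le_one) hxy hy
  rw [div_lt_div_iff₀ (by linarith) (by linarith), one_pow,
    show x ^ m = 2 * x - 1 by linarith, show y ^ m = 2 * y - 1 by linarith] at hslope
  nlinarith

section Zbar

variable {k : ℕ}

lemma exists_root (hk : 2 ≤ k) :
    ∃ x : ℝ, 1 / 2 < x ∧ x < 55 / 100 ∧ 1 - 2 * x + x ^ (k + 2) = 0 := by
  have hcont : ContinuousOn (fun x : ℝ ↦ 1 - 2 * x + x ^ (k + 2))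
      (Set.Icc (1 / 2) (55 / 100)) := by fun_prop
  have hleft : (0 : ℝ) < 1 - 2 * (1 / 2) + (1 / 2) ^ (k + 2) := by
    have : (0 : ℝ) < (1 / 2) ^ (k + 2) := by positivity
    linarith
  have hright : (1 - 2 * (55 / 100) + (55 / 100) ^ (k + 2) : ℝ) < 0 := by
    have : (55 / 100 : ℝ) ^ (k + 2) ≤ (55 / 100) ^ 4 :=
      pow_le_pow_of_le_one (by norm_num) (by norm_num) (by omega)
    norm_num at this ⊢
    linarith
  obtain ⟨x, ⟨hx1, hx2⟩, hx⟩ := intermediate_value_Ioo' (by norm_num) hcont ⟨hright, hleft⟩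
  exact ⟨x, hx1, hx2, hx⟩

lemma zbar_spec (hk : 2 ≤ k) :
    1 / 2 < zbar k ∧ zbar k < 55 / 100 ∧ 1 - 2 * zbar k + zbar k ^ (k + 2) = 0 := by
  obtain ⟨x, hx1, hx2, hx⟩ := exists_root hk
  have hleast : zbar k = x := by
    refine IsLeast.csInf_eq ⟨⟨⟨by linarith, by linarith⟩, hx⟩, ?_⟩
    rintro y ⟨⟨hy0, -⟩, hy⟩
    rcases hy0.eq_or_lt with rfl | hy0
    · simp at hy
    · exact le_of_real_roots (by omega) hy0 (by linarith) hy hx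
  rw [hleast]
  exact ⟨hx1, hx2, hx⟩

lemma half_lt_zbar (hk : 2 ≤ k) : 1 / 2 < zbar k := (zbar_spec hk).1

lemma zbar_lt (hk : 2 ≤ k) : zbar k < 55 / 100 := (zbar_spec hk).2.1

lemma zbar_pos (hk : 2 ≤ k) : 0 < zbar k := by linarith [half_lt_zbar hk]

lemma zbar_pow (hk : 2 ≤ k) : zbar k ^ (k + 2) = 2 * zbar k - 1 := by
  linarith [(zbar_spec hk).2.2]

lemma eq_zbar (hk : 2 ≤ k) {x : ℝ} (hx0 : 0 < x) (hx1 : x < 1)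
    (hx : 1 - 2 * x + x ^ (k + 2) = 0) : x = zbar k :=
  have hlt : zbar k < 1 := (zbar_lt hk).trans (by norm_num)
  le_antisymm (le_of_real_roots (by omega) (zbar_pos hk) hx1 (zbar_spec hk).2.2 hx)
    (le_of_real_roots (by omega) hx0 hlt hx (zbar_spec hk).2.2)

lemma zbar_root (hk : 2 ≤ k) : 1 - 2 * (zbar k : ℂ) + (zbar k : ℂ) ^ (k + 2) = 0 := by
  exact_mod_cast (zbar_spec hk).2.2

lemma norm_zbar_lt (hk : 2 ≤ k) : ‖(zbar k : ℂ)‖ < 55 / 100 := by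
  rw [Complex.norm_of_nonneg (zbar_pos hk).le]
  exact zbar_lt hk

lemma zbar_mem_puncturedDisc (hk : 2 ≤ k) : (zbar k : ℂ) ∈ puncturedDisc := by
  refine ⟨norm_zbar_lt hk, fun h ↦ (half_lt_zbar hk).ne' ?_⟩
  exact Complex.ofReal_injective (h.trans (by norm_num))

lemma zbar_injective {j : ℕ} (hj : 2 ≤ j) (hk : 2 ≤ k) (h : zbar j = zbar k) : j = k := by
  have hpow : zbar j ^ (j + 2) = zbar j ^ (k + 2) := by
    rw [zbar_pow hj, h, zbar_pow hk]
  have hlt : zbar j < 1 := (zbar_lt hj).trans (by norm_num)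
  exact Nat.add_right_cancel (pow_right_injective₀ (zbar_pos hj) hlt.ne hpow)

lemma tendsto_zbar : Filter.Tendsto zbar Filter.atTop (𝓝 (1 / 2)) := by
  have hupper : Filter.Tendsto (fun k : ℕ ↦ (1 / 2 : ℝ) + (55 / 100) ^ (k + 2)) Filter.atTop
      (𝓝 (1 / 2)) := by
    simpa using ((Filter.tendsto_add_atTop_iff_nat 2).2 (tendsto_pow_atTop_nhds_zero_of_lt_one
      (r := (55 / 100 : ℝ)) (by norm_num) (by norm_num))).const_add (1 / 2 : ℝ)
  refine tendsto_of_tendsto_of_tendsto_of_le_of_le' tendsto_const_nhds hupper ?_ ?_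
  · filter_upwards [Filter.eventually_ge_atTop 2] with k hk using (half_lt_zbar hk).le
  · filter_upwards [Filter.eventually_ge_atTop 2] with k hk
    have hle : zbar k ^ (k + 2) ≤ (55 / 100) ^ (k + 2) :=
      pow_le_pow_left₀ (zbar_pos hk).le (zbar_lt hk).le _
    linarith [zbar_pow hk, half_lt_zbar hk]

end Zbar

lemma denom_ne_zero {ν : ℕ} (hν : 1 ≤ ν) (hq : ‖q‖ < 55 / 100)
    (h : 2 ≤ ν → q ≠ (zbar ν : ℂ)) : 1 - 2 * q + q ^ (ν + 2) ≠ 0 := by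
  rcases hν.eq_or_lt with rfl | hν
  · have hsum : ‖q + q ^ 2‖ < 1 := by
      refine (norm_add_le _ _).trans_lt ?_
      rw [norm_pow]
      nlinarith [norm_nonneg q]
    rw [show 1 - 2 * q + q ^ (1 + 2) = (1 - q) * (1 - (q + q ^ 2)) by ring]
    exact mul_ne_zero (one_sub_ne_zero (by linarith)) (one_sub_ne_zero hsum)
  · exact fun h0 ↦ h hν (root_unique (by omega) (norm_zbar_lt hν).le hq.le (zbar_root hν) h0)

/-! ### The continuation of `PA` to the punctured disc -/

/-- The term of index `ν` of the series in the formula for `PA`. -/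
noncomputable def seriesTerm (ν : ℕ) (q : ℂ) : ℂ :=
  d ν q * (q ^ (ν + 2) / (1 - 2 * q + q ^ (ν + 2)))

/-- The factor in front of the bracket in the formula for `PA`. -/
noncomputable def prefactor (q : ℂ) : ℂ := A q * (qPoch (v q) q / qPoch (q * u q) q)

/-- The meromorphic continuation of the sum of `PA`, given by the right-hand side of the formula
for `PA`. -/
noncomputable def continuation (q : ℂ) : ℂ :=
  C q - prefactor q * (q ^ 2 / (1 - q) ^ 2 + ∑' n, seriesTerm (n + 1) q)

lemma isOpen_puncturedDisc : IsOpen puncturedDisc :=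
  (isOpen_lt continuous_norm continuous_const).inter isOpen_ne

lemma norm_lt_one_of_mem_puncturedDisc (hq : q ∈ puncturedDisc) : ‖q‖ < 1 :=
  hq.1.trans (by norm_num)

lemma one_sub_two_mul_ne_zero (hq : q ≠ 1 / 2) : 1 - 2 * q ≠ 0 :=
  fun h ↦ hq (by linear_combination -(1 / 2 : ℂ) * h)

lemma analyticAt_u (hq : ‖q‖ < 1) : AnalyticAt ℂ u q :=
  analyticAt_id.div (by fun_prop) (one_sub_ne_zero hq)

lemma analyticAt_v (hq : ‖q‖ < 1) : AnalyticAt ℂ v q :=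
  AnalyticAt.div (by fun_prop) (by fun_prop) (one_sub_ne_zero hq)

lemma analyticAt_prefactor (hq : q ∈ puncturedDisc) : AnalyticAt ℂ prefactor q := by
  have hq1 := norm_lt_one_of_mem_puncturedDisc hq
  have hA : AnalyticAt ℂ A q := AnalyticAt.div (by fun_prop) (by fun_prop)
    (pow_ne_zero 2 (one_sub_two_mul_ne_zero hq.2))
  exact hA.mul ((analyticAt_qPoch (analyticAt_v hq1) analyticAt_id hq1).div
    (analyticAt_qPoch (analyticAt_id.mul (analyticAt_u hq1)) analyticAt_id hq1)
    (qPoch_mul_u_ne_zero hq.1.le))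

lemma analyticAt_C (hq : q ∈ puncturedDisc) : AnalyticAt ℂ C q :=
  AnalyticAt.div (by fun_prop) (by fun_prop)
    (mul_ne_zero (one_sub_ne_zero (norm_lt_one_of_mem_puncturedDisc hq))
      (pow_ne_zero 2 (one_sub_two_mul_ne_zero hq.2)))

lemma analyticAt_d (ν : ℕ) (hq : ‖q‖ < 1) : AnalyticAt ℂ (d ν) q := by
  have hprod : AnalyticAt ℂ (fun q ↦ cauchyCoeff (v q) (q * u q) q ν) q := by
    have hu := analyticAt_u hq
    have hv := analyticAt_v hq
    simp only [cauchyCoeff]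
    exact Finset.analyticAt_fun_prod _ fun i _ ↦
      AnalyticAt.div (by fun_prop) (by fun_prop) (one_sub_pow_succ_ne_zero hq i)
  refine hprod.congr ?_
  filter_upwards [continuous_norm.continuousAt.eventually_lt_const hq] with w hw
    using (d_eq_cauchyCoeff hw ν).symm

lemma analyticAt_seriesTerm {ν : ℕ} (hq : ‖q‖ < 1) (h : 1 - 2 * q + q ^ (ν + 2) ≠ 0) :
    AnalyticAt ℂ (seriesTerm ν) q :=
  (analyticAt_d ν hq).mul (AnalyticAt.div (by fun_prop) (by fun_prop) h)

lemma norm_pow_add_two_le (hq : ‖q‖ ≤ 55 / 100) (ν : ℕ) : ‖q ^ (ν + 2)‖ ≤ (55 / 100) ^ ν := by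
  rw [norm_pow]
  exact (pow_le_pow_of_le_one (norm_nonneg q) (by linarith) (Nat.le_add_right ν 2)).trans
    (by gcongr)

lemma norm_seriesTerm_le (hq : ‖q‖ ≤ 55 / 100) {δ : ℝ} (hδ : 0 < δ) {ν : ℕ}
    (h : δ ≤ ‖1 - 2 * q + q ^ (ν + 2)‖) :
    ‖seriesTerm ν q‖ ≤ 6 ^ 7 / δ * (77 / 80) ^ ν := by
  calc ‖seriesTerm ν q‖
      = ‖d ν q‖ * (‖q ^ (ν + 2)‖ / ‖1 - 2 * q + q ^ (ν + 2)‖) := by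
        rw [seriesTerm, norm_mul, norm_div]
    _ ≤ 6 ^ 7 * (7 / 4) ^ ν * ((55 / 100) ^ ν / δ) := by
        gcongr
        exacts [norm_d_le hq ν, norm_pow_add_two_le hq ν]
    _ = 6 ^ 7 / δ * (77 / 80) ^ ν := by
        rw [show (77 / 80 : ℝ) = 7 / 4 * (55 / 100) by norm_num, mul_pow]
        ring

lemma exists_eventually_le_norm_denom (hq : q ∈ puncturedDisc) :
    ∃ δ > 0, ∃ N : ℕ, ∀ᶠ w in 𝓝 q, ∀ ν ≥ N, δ ≤ ‖1 - 2 * w + w ^ (ν + 2)‖ := by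
  set δ := ‖1 - 2 * q‖ / 4 with hδ_def
  have hδ : 0 < δ := div_pos (norm_pos_iff.2 (one_sub_two_mul_ne_zero hq.2)) (by norm_num)
  obtain ⟨N, hN⟩ := exists_pow_lt_of_lt_one hδ (show (55 / 100 : ℝ) < 1 by norm_num)
  have hnear : ∀ᶠ w in 𝓝 q, 2 * δ < ‖1 - 2 * w‖ :=
    (by fun_prop : Continuous fun w : ℂ ↦ ‖1 - 2 * w‖).continuousAt.eventually_const_lt
      (by linarith)
  refine ⟨δ, hδ, N, ?_⟩
  filter_upwards [hnear, isOpen_puncturedDisc.mem_nhds hq] with w hw hwD ν hν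
  have hpow : ‖w ^ (ν + 2)‖ ≤ δ := (norm_pow_add_two_le hwD.1.le ν).trans <|
    (pow_le_pow_of_le_one (by norm_num) (by norm_num) hν).trans hN.le
  linarith [norm_sub_le_norm_add (1 - 2 * w) (w ^ (ν + 2))]

lemma summable_geometric_tail (c : ℝ) (N : ℕ) :
    Summable fun n : ℕ ↦ c * (77 / 80 : ℝ) ^ (n + N + 1) :=
  ((summable_nat_add_iff (N + 1)).2
    (summable_geometric_of_lt_one (by norm_num) (by norm_num))).mul_left c

lemma summable_seriesTerm (hq : q ∈ puncturedDisc) :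
    Summable fun n ↦ seriesTerm (n + 1) q := by
  obtain ⟨δ, hδ, N, h⟩ := exists_eventually_le_norm_denom hq
  refine (summable_nat_add_iff N).1 (Summable.of_norm_bounded
    (summable_geometric_tail (6 ^ 7 / δ) N) fun n ↦ ?_)
  exact norm_seriesTerm_le hq.1.le hδ (h.self_of_nhds _ (by omega))

lemma analyticAt_tsum_seriesTerm_tail (hq : q ∈ puncturedDisc) :
    ∃ N₀, ∀ N ≥ N₀, AnalyticAt ℂ (fun w ↦ ∑' n, seriesTerm (n + N + 1) w) q := by
  obtain ⟨δ, hδ, N₀, h⟩ := exists_eventually_le_norm_denom hq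
  obtain ⟨U, hU, hUo, hqU⟩ := eventually_nhds_iff.1
    (h.and (isOpen_puncturedDisc.eventually_mem hq))
  refine ⟨N₀, fun N hN ↦ ?_⟩
  have hden : ∀ w ∈ U, ∀ n, δ ≤ ‖1 - 2 * w + w ^ (n + N + 1 + 2)‖ :=
    fun w hw n ↦ (hU w hw).1 _ (by omega)
  refine (Complex.differentiableOn_tsum_of_summable_norm (summable_geometric_tail (6 ^ 7 / δ) N)
    (fun n w hw ↦ ?_) hUo fun n w hw ↦ norm_seriesTerm_le (hU w hw).2.1.le hδ (hden w hw n))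
    |>.analyticAt (hUo.mem_nhds hqU)
  exact (analyticAt_seriesTerm (norm_lt_one_of_mem_puncturedDisc (hU w hw).2)
    (norm_pos_iff.1 (hδ.trans_le (hden w hw n)))).differentiableAt.differentiableWithinAt

lemma analyticAt_tsum_seriesTerm_sub_sum (hq : q ∈ puncturedDisc) (s : Finset ℕ)
    (h : ∀ n ∉ s, 1 - 2 * q + q ^ (n + 1 + 2) ≠ 0) :
    AnalyticAt ℂ (fun w ↦ ∑' n, seriesTerm (n + 1) w - ∑ n ∈ s, seriesTerm (n + 1) w) q := by
  obtain ⟨N₀, htail⟩ := analyticAt_tsum_seriesTerm_tail hq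
  obtain ⟨N, hN₀, hs⟩ : ∃ N ≥ N₀, s ⊆ Finset.range N := by
    obtain ⟨N, hN⟩ := s.exists_nat_subset_range
    exact ⟨max N₀ N, le_max_left _ _, hN.trans (Finset.range_mono (le_max_right _ _))⟩
  have hfin : AnalyticAt ℂ (fun w ↦ ∑ n ∈ Finset.range N \ s, seriesTerm (n + 1) w) q :=
    Finset.analyticAt_fun_sum _ fun n hn ↦ analyticAt_seriesTerm
      (norm_lt_one_of_mem_puncturedDisc hq) (h n (Finset.mem_sdiff.1 hn).2)
  refine (hfin.add (htail N hN₀)).congr ?_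
  filter_upwards [isOpen_puncturedDisc.mem_nhds hq] with w hw
  rw [Pi.add_apply, ← (summable_seriesTerm hw).sum_add_tsum_nat_add N, ← Finset.sum_sdiff hs]
  ring

lemma analyticAt_sub_prefactor_mul {g : ℂ → ℂ} (hq : q ∈ puncturedDisc) (hg : AnalyticAt ℂ g q) :
    AnalyticAt ℂ (fun w ↦ C w - prefactor w * (w ^ 2 / (1 - w) ^ 2 + g w)) q := by
  have hrat : AnalyticAt ℂ (fun w : ℂ ↦ w ^ 2 / (1 - w) ^ 2) q :=
    AnalyticAt.div (by fun_prop) (by fun_prop)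
      (pow_ne_zero 2 (one_sub_ne_zero (norm_lt_one_of_mem_puncturedDisc hq)))
  exact (analyticAt_C hq).sub ((analyticAt_prefactor hq).mul (hrat.add hg))

lemma analyticAt_continuation (hq : q ∈ puncturedDisc)
    (h : ∀ k : ℕ, 2 ≤ k → q ≠ (zbar k : ℂ)) : AnalyticAt ℂ continuation q := by
  refine analyticAt_sub_prefactor_mul hq ?_
  simpa using analyticAt_tsum_seriesTerm_sub_sum hq ∅
    fun n _ ↦ denom_ne_zero n.succ_pos hq.1 (h _)

/-! ### The poles of the continuation -/

lemma d_ofReal_ne_zero {x : ℝ} (hx0 : 0 < x) (hx1 : x < 1) (ν : ℕ) :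
    d ν (x : ℂ) ≠ 0 := by
  rw [d_eq_cauchyCoeff (by rwa [Complex.norm_of_nonneg hx0.le]), cauchyCoeff,
    Finset.prod_ne_zero_iff]
  intro i _
  have hpow : x ^ (i + 1) < 1 := pow_lt_one₀ hx0.le hx1 i.succ_ne_zero
  have hle : x * (x * x ^ i) ≤ x ^ 2 := by
    rw [← pow_succ', ← pow_succ']
    exact pow_le_pow_of_le_one hx0.le hx1.le (by omega)
  have hfactor : (v x - x * u x * (x : ℂ) ^ i) / (1 - (x : ℂ) ^ (i + 1)) =
      (((1 - x + x ^ 2 - x * (x * x ^ i)) / (1 - x) / (1 - x ^ (i + 1)) : ℝ) : ℂ) := by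
    rw [v, u]
    push_cast
    ring
  rw [hfactor, Complex.ofReal_ne_zero]
  refine div_ne_zero (div_ne_zero ?_ ?_) ?_ <;> nlinarith

lemma qPoch_v_ne_zero (hq : ‖q‖ ≤ 55 / 100) (hq0 : q ≠ 0) : qPoch (v q) q ≠ 0 := by
  have hq1 : ‖q‖ < 1 := by linarith
  refine qPoch_ne_zero hq1 fun j hj ↦ ?_
  cases j with
  | zero =>
    rw [pow_zero, mul_one, v_eq hq1, add_eq_left] at hj
    exact div_ne_zero (pow_ne_zero 2 hq0) (one_sub_ne_zero hq1) hj
  | succ j =>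
    have hpow : ‖q‖ ^ (j + 1) ≤ 55 / 100 :=
      (pow_le_of_le_one (norm_nonneg q) hq1.le j.succ_ne_zero).trans hq
    have hle : ‖v q * q ^ (j + 1)‖ ≤ 16723 / 10000 * (55 / 100) :=
      norm_mul_le_of_le (norm_v_le hq) (by rwa [norm_pow])
    rw [hj, norm_one] at hle
    norm_num at hle

lemma prefactor_ne_zero (hq : q ∈ puncturedDisc) (hq0 : q ≠ 0) : prefactor q ≠ 0 := by
  refine mul_ne_zero (div_ne_zero (mul_ne_zero (mul_ne_zero two_ne_zero hq0) ?_) ?_)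
    (div_ne_zero (qPoch_v_ne_zero hq.1.le hq0) (qPoch_mul_u_ne_zero hq.1.le))
  · exact pow_ne_zero 2 (one_sub_ne_zero (norm_lt_one_of_mem_puncturedDisc hq))
  · exact pow_ne_zero 2 (one_sub_two_mul_ne_zero hq.2)

lemma meromorphicOrderAt_denom {m : ℕ} (hm : 4 ≤ m) (hz : ‖z‖ ≤ 55 / 100)
    (hz0 : 1 - 2 * z + z ^ m = 0) :
    meromorphicOrderAt (fun w : ℂ ↦ 1 - 2 * w + w ^ m) z = 1 := by
  have hderiv : HasDerivAt (fun w : ℂ ↦ 1 - 2 * w + w ^ m) (-2 + m * z ^ (m - 1)) z := by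
    simpa using (((hasDerivAt_id' z).const_mul 2).const_sub 1).fun_add (hasDerivAt_pow m z)
  have hsmall : ‖(m : ℂ) * z ^ (m - 1)‖ ≤ 1 := by
    rw [norm_mul, Complex.norm_natCast, norm_pow]
    exact le_trans (by gcongr) (natCast_mul_pow_pred_le_one hm)
  have hne : deriv (fun w : ℂ ↦ 1 - 2 * w + w ^ m) z ≠ 0 := by
    intro h
    rw [hderiv.deriv, neg_add_eq_zero] at h
    rw [← h] at hsmall
    norm_num at hsmall
  have han : AnalyticAt ℂ (fun w : ℂ ↦ 1 - 2 * w + w ^ m) z := by fun_prop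
  rw [han.meromorphicOrderAt_eq, han.analyticOrderAt_eq_one_of_zero_deriv_ne_zero hz0 hne]
  rfl

lemma meromorphicOrderAt_prefactor_mul_seriesTerm {k : ℕ} (hk : 2 ≤ k) :
    meromorphicOrderAt (prefactor * seriesTerm k) (zbar k) = ((-1 : ℤ) : WithTop ℤ) := by
  have hz := zbar_mem_puncturedDisc hk
  have hz0 : (zbar k : ℂ) ≠ 0 := Complex.ofReal_ne_zero.2 (zbar_pos hk).ne'
  have hz1 := norm_lt_one_of_mem_puncturedDisc hz
  have hnum : AnalyticAt ℂ (fun w ↦ prefactor w * d k w * w ^ (k + 2)) (zbar k : ℂ) :=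
    ((analyticAt_prefactor hz).mul (analyticAt_d k hz1)).mul (by fun_prop)
  have hnum0 : prefactor (zbar k) * d k (zbar k) * (zbar k : ℂ) ^ (k + 2) ≠ 0 :=
    mul_ne_zero (mul_ne_zero (prefactor_ne_zero hz hz0)
      (d_ofReal_ne_zero (zbar_pos hk) ((zbar_lt hk).trans (by norm_num)) k))
      (pow_ne_zero _ hz0)
  have hfac : prefactor * seriesTerm k =
      (fun w ↦ prefactor w * d k w * w ^ (k + 2)) * (fun w ↦ 1 - 2 * w + w ^ (k + 2))⁻¹ := by
    ext w
    simp only [Pi.mul_apply, Pi.inv_apply, seriesTerm]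
    ring
  rw [hfac, meromorphicOrderAt_mul_of_ne_zero hnum hnum0, meromorphicOrderAt_inv,
    meromorphicOrderAt_denom (by omega) hz.1.le (zbar_root hk)]
  rfl

lemma meromorphicOrderAt_continuation {k : ℕ} (hk : 2 ≤ k) :
    meromorphicOrderAt continuation (zbar k) = ((-1 : ℤ) : WithTop ℤ) := by
  obtain ⟨j, rfl⟩ := Nat.exists_eq_add_of_le' (show 1 ≤ k by omega)
  have hz := zbar_mem_puncturedDisc hk
  have hregular := analyticAt_sub_prefactor_mul hz <|
    analyticAt_tsum_seriesTerm_sub_sum hz {j} fun n hn ↦ denom_ne_zero n.succ_pos hz.1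
      fun hn2 he ↦ hn <| Finset.mem_singleton.2 <| Nat.succ_injective
        (zbar_injective hn2 hk (Complex.ofReal_injective he.symm))
  set regular : ℂ → ℂ := fun w ↦ C w - prefactor w * (w ^ 2 / (1 - w) ^ 2 +
    (∑' n, seriesTerm (n + 1) w - ∑ n ∈ {j}, seriesTerm (n + 1) w)) with hregular_def
  have hsplit : continuation = regular + -(prefactor * seriesTerm (j + 1)) := by
    ext w
    simp only [hregular_def, continuation, Pi.add_apply, Pi.neg_apply, Pi.mul_apply,
      Finset.sum_singleton]
    ring
  have hpole : meromorphicOrderAt (-(prefactor * seriesTerm (j + 1))) (zbar (j + 1)) =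
      ((-1 : ℤ) : WithTop ℤ) := by
    rw [← meromorphicOrderAt_neg, meromorphicOrderAt_prefactor_mul_seriesTerm hk]
  rw [hsplit, meromorphicOrderAt_add_eq_right_of_lt hregular.meromorphicAt, hpole]
  rw [hpole]
  exact lt_of_lt_of_le (by decide) hregular.meromorphicOrderAt_nonneg

lemma slitDisc_subset : slitDisc ⊆ puncturedDisc := fun q hq ↦
  ⟨hq.1, fun h ↦ hq.2 (1 / 2) ⟨le_rfl, by norm_num⟩ (h.trans (by norm_num))⟩

lemma ne_zbar_of_mem_slitDisc (hq : q ∈ slitDisc) {k : ℕ} (hk : 2 ≤ k) : q ≠ (zbar k : ℂ) :=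
  hq.2 _ ⟨(half_lt_zbar hk).le, (zbar_lt hk).le⟩

lemma meromorphicOn_continuation : MeromorphicOn continuation puncturedDisc := by
  intro q hq
  by_cases! h : ∃ k : ℕ, 2 ≤ k ∧ q = (zbar k : ℂ)
  · obtain ⟨k, hk, rfl⟩ := h
    exact meromorphicAt_of_meromorphicOrderAt_ne_zero
      (by rw [meromorphicOrderAt_continuation hk]; decide)
  · exact (analyticAt_continuation hq h).meromorphicAt

/-- The power series `F` converges at `q`, with sum `s`. -/
def HasValueAt (F : ℂ⟦X⟧) (q s : ℂ) : Prop :=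
  HasSum (fun n ↦ PowerSeries.coeff n F * q ^ n) s

section HasValueAt

variable {F G : ℂ⟦X⟧} {s t : ℂ}

lemma HasValueAt.add (hF : HasValueAt F q s) (hG : HasValueAt G q t) :
    HasValueAt (F + G) q (s + t) := by
  simpa [HasValueAt, add_mul] using HasSum.add hF hG

lemma HasValueAt.mul (hF : HasValueAt F q s) (hG : HasValueAt G q t) :
    HasValueAt (F * G) q (s * t) := by
  have hF' := summable_norm_iff.2 hF.summable
  have hG' := summable_norm_iff.2 hG.summable
  have hsum := (summable_norm_sum_mul_antidiagonal_of_summable_norm hF' hG').of_norm.hasSum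
  rw [← tsum_mul_tsum_eq_tsum_sum_antidiagonal_of_summable_norm hF' hG', hF.tsum_eq,
    hG.tsum_eq] at hsum
  refine hsum.congr_fun fun n ↦ ?_
  rw [PowerSeries.coeff_mul, Finset.sum_mul]
  refine Finset.sum_congr rfl fun p hp ↦ ?_
  rw [← Finset.HasAntidiagonal.mem_antidiagonal.1 hp, pow_add]
  ring

lemma HasValueAt.sum {ι : Type*} {F : ι → ℂ⟦X⟧} {s : ι → ℂ} {I : Finset ι}
    (h : ∀ i ∈ I, HasValueAt (F i) q (s i)) : HasValueAt (∑ i ∈ I, F i) q (∑ i ∈ I, s i) := by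
  simpa [HasValueAt, Finset.sum_mul] using hasSum_sum h

lemma hasValueAt_coe_polynomial (p : ℂ[X]) (q : ℂ) : HasValueAt (p : ℂ⟦X⟧) q (p.eval q) := by
  rw [Polynomial.eval_eq_sum_range, HasValueAt]
  simp only [Polynomial.coeff_coe]
  refine hasSum_sum_of_ne_finset_zero fun n hn ↦ ?_
  rw [Polynomial.coeff_eq_zero_of_natDegree_lt (by simpa using hn), zero_mul]

lemma hasValueAt_X_pow (q : ℂ) (k : ℕ) : HasValueAt (PowerSeries.X ^ k) q (q ^ k) := by
  simpa using hasValueAt_coe_polynomial (Polynomial.X ^ k) q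

lemma HasValueAt.pow (h : HasValueAt F q s) (k : ℕ) : HasValueAt (F ^ k) q (s ^ k) := by
  induction k with
  | zero => simpa using hasValueAt_X_pow q 0
  | succ k ih => rw [pow_succ, pow_succ]; exact ih.mul h

lemma hasValueAt_geometric (hq : ‖q‖ < 1) : HasValueAt (PowerSeries.mk 1) q (1 - q)⁻¹ := by
  simpa [HasValueAt] using hasSum_geometric_of_norm_lt_one hq

end HasValueAt

/-! ### Generating functions of row and column codes -/

lemma sum_one_fifth_pow_succ_le (k : ℕ) :
    ∑ x ∈ Finset.range k, (1 / 5 : ℝ) ^ (x + 1) ≤ 1 / 4 := by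
  have hsum := (hasSum_geometric_of_lt_one (r := (1 / 5 : ℝ)) (by norm_num) (by norm_num)).mul_right
    (1 / 5)
  simp only [← pow_succ] at hsum
  exact (sum_le_hasSum _ (fun _ _ ↦ by positivity) hsum).trans_eq (by norm_num)

lemma sum_le_div_four {f : ℕ → ℝ} {K : ℝ} {k : ℕ} (hK : 0 ≤ K)
    (hf : ∀ x ∈ Finset.range k, f x ≤ K * (1 / 5) ^ (x + 1)) :
    ∑ x ∈ Finset.range k, f x ≤ K / 4 :=
  calc ∑ x ∈ Finset.range k, f x ≤ ∑ x ∈ Finset.range k, K * (1 / 5) ^ (x + 1) :=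
        Finset.sum_le_sum hf
    _ ≤ K * (1 / 4) := by
        rw [← Finset.mul_sum]
        exact mul_le_mul_of_nonneg_left (sum_one_fifth_pow_succ_le k) hK
    _ = K / 4 := by ring

lemma five_pow_sub {m n : ℕ} (h : m ≤ n) : (5 : ℝ) ^ (n - m) = 5 ^ n * (1 / 5) ^ m := by
  rw [pow_sub₀ _ (by norm_num) h, one_div, inv_pow]

lemma rowCount_le_of_forall_lt {n M : ℕ}
    (hrow : ∀ m < n, (rowCount m M : ℝ) ≤ 5 ^ m * 2 ^ M / 2)
    (hcol : ∀ m < n, (colCount m M : ℝ) ≤ 5 ^ m * 2 ^ M) :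
    (rowCount n M : ℝ) ≤ 5 ^ n * 2 ^ M / 2 := by
  have hrows : ∑ x ∈ Finset.range (M + 1),
      (((if x + 1 ≤ n then rowCount (n - (x + 1)) M else 0 : ℕ)) : ℝ) ≤
        5 ^ n * 2 ^ M / 2 / 4 := by
    refine sum_le_div_four (by positivity) fun x _ ↦ ?_
    split_ifs with h
    · refine (hrow _ (by omega)).trans_eq ?_
      rw [five_pow_sub h]
      ring
    · rw [Nat.cast_zero]
      positivity
  have hcols : (((if M + 1 ≤ n then colCount (n - (M + 1)) M else 0 : ℕ)) : ℝ) ≤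
      5 ^ n * 2 ^ M * (1 / 5) := by
    split_ifs with h
    · calc (colCount (n - (M + 1)) M : ℝ) ≤ 5 ^ (n - (M + 1)) * 2 ^ M := hcol _ (by omega)
        _ = 5 ^ n * 2 ^ M * (1 / 5) ^ (M + 1) := by rw [five_pow_sub h]; ring
        _ ≤ 5 ^ n * 2 ^ M * (1 / 5) := by
          gcongr
          exact pow_le_of_le_one (by norm_num) (by norm_num) M.succ_ne_zero
    · rw [Nat.cast_zero]
      positivity
  rw [rowCount_eq, Nat.cast_add, Nat.cast_sum]
  linarith [show (0 : ℝ) ≤ 5 ^ n * 2 ^ M by positivity]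

lemma colCount_succ_le_of_forall_le {n M : ℕ}
    (hrow : (rowCount n M : ℝ) ≤ 5 ^ n * 2 ^ M / 2)
    (hcol : ∀ m ≤ n, (colCount m M : ℝ) ≤ 5 ^ m * 2 ^ M) :
    (colCount n (M + 1) : ℝ) ≤ 5 ^ n * 2 ^ (M + 1) := by
  have hcols : ∑ c ∈ Finset.range (n + 1), (colCount (n - c) M : ℝ) ≤ 5 ^ n * 2 ^ M * 5 / 4 := by
    refine sum_le_div_four (by positivity) fun c hc ↦ ?_
    refine (hcol _ (Nat.sub_le n c)).trans_eq ?_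
    rw [five_pow_sub (Finset.mem_range_succ_iff.1 hc)]
    ring
  rw [colCount_succ, Nat.cast_add, Nat.cast_sum, pow_succ]
  linarith [show (0 : ℝ) ≤ 5 ^ n * 2 ^ M by positivity]

lemma rowCount_le_and_colCount_le (n M : ℕ) :
    (rowCount n M : ℝ) ≤ 5 ^ n * 2 ^ M / 2 ∧ (colCount n M : ℝ) ≤ 5 ^ n * 2 ^ M := by
  induction hN : n + M using Nat.strong_induction_on generalizing n M with
  | _ N ih =>
    subst hN
    constructor
    · exact rowCount_le_of_forall_lt (fun m hm ↦ (ih _ (by omega) m M rfl).1)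
        fun m hm ↦ (ih _ (by omega) m M rfl).2
    · cases M with
      | zero =>
        rw [colCount_zero]
        split_ifs with h <;> simp [h]
      | succ M =>
        exact colCount_succ_le_of_forall_le (ih _ (by omega) n M rfl).1
          fun m hm ↦ (ih _ (by omega) m M rfl).2

lemma norm_rowCount_mul_pow_le (hq : ‖q‖ ≤ 1 / 40) (n M : ℕ) :
    ‖(rowCount n M : ℂ) * q ^ n‖ ≤ (1 / 2) ^ M * (1 / 2) ^ n := by
  rcases le_or_gt n M with h | h
  · rw [rowCount_eq_zero h, Nat.cast_zero, zero_mul, norm_zero]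
    positivity
  have hcount : (rowCount n M : ℝ) ≤ 5 ^ n * 2 ^ M :=
    (rowCount_le_and_colCount_le n M).1.trans (half_le_self (by positivity))
  calc ‖(rowCount n M : ℂ) * q ^ n‖ = rowCount n M * ‖q‖ ^ n := by
        rw [norm_mul, norm_pow, Complex.norm_natCast]
    _ ≤ 5 ^ n * 2 ^ M * (1 / 40) ^ n := by gcongr
    _ = 2 ^ M * (1 / 8) ^ n := by rw [mul_right_comm, ← mul_pow, mul_comm]; norm_num
    _ = (1 / 2) ^ M * (4 ^ M * (1 / 8) ^ n) := by rw [← mul_assoc, ← mul_pow]; norm_num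
    _ ≤ (1 / 2) ^ M * (4 ^ n * (1 / 8) ^ n) := by
        gcongr
        norm_num
    _ = (1 / 2) ^ M * (1 / 2) ^ n := by rw [← mul_pow]; norm_num

lemma summable_colCount_mul_pow (hq : ‖q‖ ≤ 1 / 40) (M : ℕ) :
    Summable fun n ↦ (colCount n M : ℂ) * q ^ n := by
  refine Summable.of_norm_bounded (g := fun n : ℕ ↦ 2 ^ M * (1 / 8 : ℝ) ^ n)
    ((summable_geometric_of_lt_one (by norm_num) (by norm_num)).mul_left _) fun n ↦ ?_
  calc ‖(colCount n M : ℂ) * q ^ n‖ = colCount n M * ‖q‖ ^ n := by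
        rw [norm_mul, norm_pow, Complex.norm_natCast]
    _ ≤ 5 ^ n * 2 ^ M * (1 / 40) ^ n := by
        gcongr
        exact (rowCount_le_and_colCount_le n M).2
    _ = 2 ^ M * (1 / 8) ^ n := by rw [mul_right_comm, ← mul_pow, mul_comm]; norm_num

lemma summable_rowCount_mul_pow (hq : ‖q‖ ≤ 1 / 40) :
    Summable fun p : ℕ × ℕ ↦ (rowCount p.2 p.1 : ℂ) * q ^ p.2 :=
  Summable.of_norm_bounded (summable_geometric_two.mul_of_nonneg summable_geometric_two
    (fun _ ↦ by positivity) fun _ ↦ by positivity) fun p ↦ norm_rowCount_mul_pow_le hq p.2 p.1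

/-- The area generating function of the codes of width `M` that end with a north step. -/
noncomputable def rowSeries (M : ℕ) (q : ℂ) : ℂ := ∑' n, (rowCount n M : ℂ) * q ^ n

/-- The area generating function of the codes of width `M` that do not end with a north step. -/
noncomputable def colSeries (M : ℕ) (q : ℂ) : ℂ := ∑' n, (colCount n M : ℂ) * q ^ n

lemma hasValueAt_rowSeries (hq : ‖q‖ ≤ 1 / 40) (M : ℕ) :
    HasValueAt (PowerSeries.mk fun n ↦ (rowCount n M : ℂ)) q (rowSeries M q) := by
  simpa [HasValueAt, rowSeries] using ((summable_rowCount_mul_pow hq).prod_factor M).hasSum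

lemma hasValueAt_colSeries (hq : ‖q‖ ≤ 1 / 40) (M : ℕ) :
    HasValueAt (PowerSeries.mk fun n ↦ (colCount n M : ℂ)) q (colSeries M q) := by
  simpa [HasValueAt, colSeries] using (summable_colCount_mul_pow hq M).hasSum

lemma norm_rowSeries_le (hq : ‖q‖ ≤ 1 / 40) (M : ℕ) : ‖rowSeries M q‖ ≤ 2 * (1 / 2) ^ M := by
  rw [mul_comm]
  exact tsum_of_norm_bounded (hasSum_geometric_two.mul_left _) fun n ↦
    norm_rowCount_mul_pow_le hq n M

lemma rowSeries_eq_mul_colSeries (hq : ‖q‖ ≤ 1 / 40) (M : ℕ) :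
    (1 - 2 * q + q ^ (M + 2)) * rowSeries M q = (1 - q) * q ^ (M + 1) * colSeries M q := by
  have hseries : (PowerSeries.mk fun n ↦ (rowCount n M : ℂ)) =
      (∑ x ∈ Finset.range (M + 1), PowerSeries.X ^ (x + 1)) *
        (PowerSeries.mk fun n ↦ (rowCount n M : ℂ)) +
      PowerSeries.X ^ (M + 1) * (PowerSeries.mk fun n ↦ (colCount n M : ℂ)) := by
    ext n
    simp only [Finset.sum_mul, map_add, map_sum, PowerSeries.coeff_X_pow_mul',
      PowerSeries.coeff_mk, rowCount_eq n M]
    push_cast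
    rfl
  have hrow := hasValueAt_rowSeries hq M
  rw [hseries] at hrow
  have hvalue := (((HasValueAt.sum fun x _ ↦ hasValueAt_X_pow q (x + 1)).mul
    (hasValueAt_rowSeries hq M)).add
      ((hasValueAt_X_pow q (M + 1)).mul (hasValueAt_colSeries hq M))).unique hrow
  have hgeom : (1 - q) * ∑ x ∈ Finset.range (M + 1), q ^ (x + 1) = q - q ^ (M + 2) := by
    have := mul_neg_geom_sum q (M + 1)
    simp only [pow_succ, ← Finset.sum_mul] at this ⊢
    linear_combination q * this
  linear_combination -(1 - q) * hvalue + rowSeries M q * hgeom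

lemma colSeries_zero (q : ℂ) : colSeries 0 q = 1 := by
  rw [colSeries, tsum_eq_single 0 fun n hn ↦ by simp [colCount_zero, hn]]
  simp [colCount_zero]

lemma colSeries_succ (hq : ‖q‖ ≤ 1 / 40) (M : ℕ) :
    (1 - q) * colSeries (M + 1) q = (1 - q) * rowSeries M q + colSeries M q := by
  have hseries : (PowerSeries.mk fun n ↦ (colCount n (M + 1) : ℂ)) =
      (PowerSeries.mk fun n ↦ (rowCount n M : ℂ)) +
      PowerSeries.mk 1 * (PowerSeries.mk fun n ↦ (colCount n M : ℂ)) := by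
    ext n
    rw [map_add, PowerSeries.coeff_mul, Finset.Nat.sum_antidiagonal_eq_sum_range_succ_mk]
    simp [colCount_succ]
  have hcol := hasValueAt_colSeries hq (M + 1)
  rw [hseries] at hcol
  have hvalue := ((hasValueAt_rowSeries hq M).add
    ((hasValueAt_geometric (by linarith)).mul (hasValueAt_colSeries hq M))).unique hcol
  have := one_sub_ne_zero (q := q) (by linarith)
  rw [← hvalue]
  field_simp

lemma one_sub_mul_rowSeries_zero (hq : ‖q‖ ≤ 1 / 40) : (1 - q) * rowSeries 0 q = q := by
  have h := rowSeries_eq_mul_colSeries hq 0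
  rw [colSeries_zero] at h
  refine mul_left_cancel₀ (one_sub_ne_zero (q := q) (by linarith)) ?_
  linear_combination h

lemma rowSeries_succ (hq : ‖q‖ ≤ 1 / 40) (M : ℕ) :
    (1 - q) * (1 - 2 * q + q ^ (M + 3)) * rowSeries (M + 1) q =
      (q * (1 - 2 * q) + q ^ (M + 2) * (1 - q + q ^ 2)) * rowSeries M q := by
  linear_combination (1 - q) * rowSeries_eq_mul_colSeries hq (M + 1) +
    (1 - q) * q ^ (M + 2) * colSeries_succ hq M - q * rowSeries_eq_mul_colSeries hq M

/-- The generating function of the codes that end with a north step, with `t` marking the width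
and `q` marking the area. -/
noncomputable def rowWidthSeries (t q : ℂ) : ℂ := ∑' M, rowSeries M q * t ^ M

section WidthSeries

variable {t : ℂ}

lemma norm_rowSeries_mul_pow_le (hq : ‖q‖ ≤ 1 / 40) (ht : ‖t‖ ≤ 1) (M : ℕ) :
    ‖rowSeries M q * t ^ M‖ ≤ 2 * (1 / 2) ^ M := by
  rw [norm_mul, norm_pow]
  exact (mul_le_of_le_one_right (norm_nonneg _) (pow_le_one₀ (norm_nonneg _) ht)).trans
    (norm_rowSeries_le hq M)

lemma summable_rowSeries_mul_pow (hq : ‖q‖ ≤ 1 / 40) (ht : ‖t‖ ≤ 1) :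
    Summable fun M ↦ rowSeries M q * t ^ M :=
  Summable.of_norm_bounded (summable_geometric_two.mul_left 2) (norm_rowSeries_mul_pow_le hq ht)

lemma norm_rowWidthSeries_le (hq : ‖q‖ ≤ 1 / 40) (ht : ‖t‖ ≤ 1) : ‖rowWidthSeries t q‖ ≤ 4 :=
  (tsum_of_norm_bounded (hasSum_geometric_two.mul_left 2)
    (norm_rowSeries_mul_pow_le hq ht)).trans_eq (by norm_num)

lemma norm_mul_le_of_norm_le_one {c : ℝ} (hq : ‖q‖ ≤ c) (ht : ‖t‖ ≤ 1) : ‖q * t‖ ≤ c := by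
  rw [norm_mul]
  exact (mul_le_of_le_one_right (norm_nonneg q) ht).trans hq

lemma rowWidthSeries_funEq (hq : ‖q‖ ≤ 1 / 40) (ht : ‖t‖ ≤ 1) :
    (1 - 2 * q) * (1 - q - q * t) * rowWidthSeries t q =
      q * (1 - q) ^ 2 -
        q ^ 2 * (1 - q - (1 - q + q ^ 2) * t) * rowWidthSeries (q * t) q := by
  have hs := summable_rowSeries_mul_pow hq ht
  have hs' := summable_rowSeries_mul_pow hq
    ((norm_mul_le_of_norm_le_one hq ht).trans (by norm_num) : ‖q * t‖ ≤ 1)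
  have hsucc := (summable_nat_add_iff 1).2 hs
  have hsucc' := (summable_nat_add_iff 1).2 hs'
  have hsplit : rowWidthSeries t q =
      rowSeries 0 q + ∑' M : ℕ, rowSeries (M + 1) q * t ^ (M + 1) := by
    rw [rowWidthSeries, hs.tsum_eq_zero_add, pow_zero, mul_one]
  have hsplit' : rowWidthSeries (q * t) q =
      rowSeries 0 q + ∑' M : ℕ, rowSeries (M + 1) q * (q * t) ^ (M + 1) := by
    rw [rowWidthSeries, hs'.tsum_eq_zero_add, pow_zero, mul_one]
  have hrec : (1 - q) * (1 - 2 * q) * (∑' M : ℕ, rowSeries (M + 1) q * t ^ (M + 1)) +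
      (1 - q) * q ^ 2 * (∑' M : ℕ, rowSeries (M + 1) q * (q * t) ^ (M + 1)) =
      q * (1 - 2 * q) * t * rowWidthSeries t q +
        q ^ 2 * t * (1 - q + q ^ 2) * rowWidthSeries (q * t) q := by
    simp only [rowWidthSeries, ← tsum_mul_left]
    rw [← (hsucc.mul_left _).tsum_add (hsucc'.mul_left _),
      ← (hs.mul_left _).tsum_add (hs'.mul_left _)]
    refine tsum_congr fun M ↦ ?_
    rw [mul_pow, mul_pow]
    linear_combination t ^ (M + 1) * rowSeries_succ hq M
  linear_combination hrec + (1 - q) * (1 - 2 * q) * hsplit + (1 - q) * q ^ 2 * hsplit' +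
    (1 - q) ^ 2 * one_sub_mul_rowSeries_zero hq

end WidthSeries

/-! ### Solution of the functional equation -/

variable {t : ℂ}

lemma half_le_norm_denom (hq : ‖q‖ ≤ 1 / 40) (ν : ℕ) : 1 / 2 ≤ ‖1 - 2 * q + q ^ (ν + 2)‖ := by
  have hpow : ‖q ^ (ν + 2)‖ ≤ 1 / 40 := by
    rw [norm_pow]
    exact (pow_le_of_le_one (norm_nonneg _) (by linarith) (by omega)).trans hq
  have htwo : ‖2 * q‖ ≤ 1 / 20 := by
    rw [norm_mul, Complex.norm_ofNat]
    linarith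
  linarith [one_sub_norm_le_norm_one_sub (2 * q), norm_sub_le_norm_add (1 - 2 * q) (q ^ (ν + 2))]

/-- The series `S(t)` for which `1 - Q(t) S(t)` solves the functional equation of
`rowWidthSeries`, up to an elementary factor. -/
noncomputable def solutionSeries (t q : ℂ) : ℂ := ∑' ν, seriesTerm ν q * t ^ ν

lemma norm_seriesTerm_mul_pow_le (hq : ‖q‖ ≤ 1 / 40) (ht : ‖t‖ ≤ 1) (ν : ℕ) :
    ‖seriesTerm ν q * t ^ ν‖ ≤ 6 ^ 7 / (1 / 2) * (77 / 80) ^ ν := by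
  rw [norm_mul, norm_pow]
  exact (mul_le_of_le_one_right (norm_nonneg _) (pow_le_one₀ (norm_nonneg _) ht)).trans
    (norm_seriesTerm_le (by linarith) (by norm_num) (half_le_norm_denom hq ν))

lemma hasSum_geometric_bound : HasSum (fun ν : ℕ ↦ (6 ^ 7 / (1 / 2) * (77 / 80) ^ ν : ℝ))
    (6 ^ 7 / (1 / 2) * (1 - 77 / 80)⁻¹) :=
  (hasSum_geometric_of_lt_one (by norm_num) (by norm_num)).mul_left _

lemma summable_seriesTerm_mul_pow (hq : ‖q‖ ≤ 1 / 40) (ht : ‖t‖ ≤ 1) :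
    Summable fun ν ↦ seriesTerm ν q * t ^ ν :=
  Summable.of_norm_bounded hasSum_geometric_bound.summable (norm_seriesTerm_mul_pow_le hq ht)

lemma norm_solutionSeries_le (hq : ‖q‖ ≤ 1 / 40) (ht : ‖t‖ ≤ 1) :
    ‖solutionSeries t q‖ ≤ 6 ^ 7 / (1 / 2) * (1 - 77 / 80)⁻¹ :=
  tsum_of_norm_bounded hasSum_geometric_bound (norm_seriesTerm_mul_pow_le hq ht)

lemma hasSum_d_mul_pow (hq : ‖q‖ ≤ 1 / 40) (hz : ‖z‖ ≤ 1 / 40) :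
    HasSum (fun ν ↦ d ν q * z ^ ν) (1 / Q z q) := by
  have hvz : ‖v q * z‖ < 1 := by
    rw [norm_mul]
    nlinarith [norm_v_le (q := q) (by linarith), norm_nonneg z]
  simpa only [d_eq_cauchyCoeff (q := q) (by linarith)] using
    hasSum_one_div_Q (by linarith) hvz

lemma solutionSeries_funEq (hq : ‖q‖ ≤ 1 / 40) (ht : ‖t‖ ≤ 1) :
    (1 - 2 * q) * solutionSeries t q + q ^ 2 * solutionSeries (q * t) q =
      q ^ 2 * (1 / Q (q * t) q) := by
  have hqt := norm_mul_le_of_norm_le_one hq ht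
  rw [← (hasSum_d_mul_pow hq hqt).tsum_eq, solutionSeries, solutionSeries, ← tsum_mul_left,
    ← tsum_mul_left, ← tsum_mul_left, ← ((summable_seriesTerm_mul_pow hq ht).mul_left _).tsum_add
      ((summable_seriesTerm_mul_pow hq (hqt.trans (by norm_num))).mul_left _)]
  refine tsum_congr fun ν ↦ ?_
  have hden : 1 - 2 * q + q ^ (ν + 2) ≠ 0 :=
    norm_pos_iff.1 (one_half_pos.trans_le (half_le_norm_denom hq ν))
  simp only [seriesTerm]
  field_simp
  ring

lemma qPoch_mul_u_mul_ne_zero (hq : ‖q‖ ≤ 55 / 100) (ht : ‖t‖ ≤ 1) :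
    qPoch (q * u q * t) q ≠ 0 := by
  refine qPoch_ne_zero_of_norm_lt_one (by linarith) ?_
  rw [norm_mul]
  exact (mul_le_of_le_one_right (norm_nonneg _) ht).trans_lt (norm_mul_u_lt_one hq)

lemma Q_funEq (hq : ‖q‖ ≤ 55 / 100) (ht : ‖t‖ ≤ 1) :
    (1 - q * u q * t) * Q t q = (1 - v q * t) * Q (q * t) q := by
  have hq1 : ‖q‖ < 1 := by linarith
  have hne := qPoch_mul_u_mul_ne_zero hq ht
  rw [qPoch_eq_mul (q * u q * t) hq1] at hne
  have := left_ne_zero_of_mul hne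
  have := right_ne_zero_of_mul hne
  rw [Q, Q, qPoch_eq_mul (v q * t) hq1, qPoch_eq_mul (q * u q * t) hq1,
    show v q * (q * t) = v q * t * q by ring,
    show q * u q * (q * t) = q * u q * t * q by ring]
  field_simp

lemma Q_ne_zero (hq : ‖q‖ ≤ 1 / 40) (hz : ‖z‖ ≤ 1 / 40) : Q z q ≠ 0 := by
  refine div_ne_zero (qPoch_ne_zero_of_norm_lt_one (by linarith) ?_)
    (qPoch_mul_u_mul_ne_zero (by linarith) (by linarith))
  rw [norm_mul]
  nlinarith [norm_v_le (q := q) (by linarith), norm_nonneg z]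

lemma continuousOn_Q (hq : ‖q‖ ≤ 55 / 100) :
    ContinuousOn (fun t ↦ Q t q) (Metric.closedBall 0 1) := by
  have hq1 : ‖q‖ < 1 := by linarith
  intro t ht
  have hcont (c : ℂ) : ContinuousAt (fun t ↦ qPoch (c * t) q) t :=
    (analyticAt_qPoch (by fun_prop) analyticAt_const hq1).continuousAt
  exact ((hcont _).div (hcont _)
    (qPoch_mul_u_mul_ne_zero hq (mem_closedBall_zero_iff.1 ht))).continuousWithinAt

/-- The difference between `rowWidthSeries` and the explicit solution of its functional equation,
with denominators cleared. -/
noncomputable def defect (t q : ℂ) : ℂ :=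
  (1 - 2 * q) * (1 - q - q * t) * rowWidthSeries t q -
    q * (1 - q) ^ 2 * (1 - Q t q * solutionSeries t q)

lemma defect_funEq (hq : ‖q‖ ≤ 1 / 40) (ht : ‖t‖ ≤ 1) :
    (1 - 2 * q) * (1 - q * u q * t) * defect t q =
      -(q ^ 2 * (1 - v q * t)) * defect (q * t) q := by
  have h0 := one_sub_ne_zero (q := q) (by linarith)
  have hu : (1 - q) * u q = q := by rw [u]; field_simp
  have hv : (1 - q) * v q = 1 - q + q ^ 2 := by rw [v]; field_simp
  have hQ : Q (q * t) q * (1 / Q (q * t) q) = 1 :=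
    mul_one_div_cancel (Q_ne_zero hq (norm_mul_le_of_norm_le_one hq ht))
  rw [defect, defect]
  linear_combination (1 - 2 * q) * (1 - q * u q * t) * rowWidthSeries_funEq hq ht +
    q * (1 - q) ^ 2 * (1 - 2 * q) * solutionSeries t q * Q_funEq (q := q) (by linarith) ht +
    q * (1 - q) ^ 2 * (1 - v q * t) * Q (q * t) q * solutionSeries_funEq hq ht +
    q * (1 - q) ^ 2 * (1 - v q * t) * q ^ 2 * hQ +
    q ^ 2 * (1 - v q * t) * (1 - 2 * q) * q * t * rowWidthSeries (q * t) q * hu -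
    (1 - 2 * q) * (1 - q * u q * t) * q ^ 2 * t * rowWidthSeries (q * t) q * hv

lemma norm_defect_le (hq : ‖q‖ ≤ 1 / 40) (ht : ‖t‖ ≤ 1) :
    ‖defect t q‖ ≤ 1 / 2 * ‖defect (q * t) q‖ := by
  have htwo : 19 / 20 ≤ ‖1 - 2 * q‖ := by
    have := one_sub_norm_le_norm_one_sub (2 * q)
    rw [norm_mul, Complex.norm_ofNat] at this
    linarith
  have hu : 1 / 2 ≤ ‖1 - q * u q * t‖ := by
    have hle : ‖q * u q * t‖ ≤ 1 / 40 * (11 / 9) * 1 := by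
      rw [norm_mul, norm_mul]
      gcongr
      exact norm_u_le (by linarith)
    linarith [one_sub_norm_le_norm_one_sub (q * u q * t)]
  have hv : ‖1 - v q * t‖ ≤ 3 := by
    have hle : ‖v q * t‖ ≤ 16723 / 10000 * 1 := by
      rw [norm_mul]
      gcongr
      exact norm_v_le (by linarith)
    linarith [norm_sub_le 1 (v q * t), norm_one (α := ℂ)]
  have hfunEq := congrArg norm (defect_funEq hq ht)
  simp only [norm_mul, norm_neg, norm_pow] at hfunEq
  have hcontract : 19 / 40 * ‖defect t q‖ ≤ 3 / 1600 * ‖defect (q * t) q‖ :=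
    calc 19 / 40 * ‖defect t q‖ = 19 / 20 * (1 / 2) * ‖defect t q‖ := by ring
      _ ≤ ‖1 - 2 * q‖ * ‖1 - q * u q * t‖ * ‖defect t q‖ := by gcongr
      _ = ‖q‖ ^ 2 * ‖1 - v q * t‖ * ‖defect (q * t) q‖ := hfunEq
      _ ≤ (1 / 40) ^ 2 * 3 * ‖defect (q * t) q‖ := by gcongr
      _ = 3 / 1600 * ‖defect (q * t) q‖ := by ring
  linarith [norm_nonneg (defect (q * t) q)]

lemma exists_norm_defect_le (hq : ‖q‖ ≤ 1 / 40) : ∃ B, ∀ t : ℂ, ‖t‖ ≤ 1 → ‖defect t q‖ ≤ B := by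
  obtain ⟨K, hK⟩ := (isCompact_closedBall (0 : ℂ) 1).exists_bound_of_continuousOn
    (continuousOn_Q (q := q) (by linarith))
  refine ⟨‖1 - 2 * q‖ * (‖1 - q‖ + ‖q‖ * 1) * 4 +
    ‖q * (1 - q) ^ 2‖ * (1 + K * (6 ^ 7 / (1 / 2) * (1 - 77 / 80)⁻¹)), fun t ht ↦ ?_⟩
  have hQ := hK t (mem_closedBall_zero_iff.2 ht)
  have hK0 := (norm_nonneg _).trans hQ
  have hlinear : ‖1 - q - q * t‖ ≤ ‖1 - q‖ + ‖q‖ * 1 :=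
    (norm_sub_le _ _).trans (by rw [norm_mul]; gcongr)
  have hsolution : ‖1 - Q t q * solutionSeries t q‖ ≤
      1 + K * (6 ^ 7 / (1 / 2) * (1 - 77 / 80)⁻¹) := by
    refine (norm_sub_le _ _).trans ?_
    rw [norm_mul, norm_one]
    gcongr
    exact norm_solutionSeries_le hq ht
  refine (norm_sub_le _ _).trans (add_le_add ?_ ?_)
  · rw [norm_mul, norm_mul]
    gcongr
    exact norm_rowWidthSeries_le hq ht
  · rw [norm_mul]
    gcongr

lemma eq_zero_of_norm_le_mul_norm_comp_mul {E : Type*} [NormedAddCommGroup E] {f : ℂ → E}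
    {c B : ℝ} (hc0 : 0 ≤ c) (hc : c < 1) (hq : ‖q‖ ≤ 1)
    (hf : ∀ t, ‖t‖ ≤ 1 → ‖f t‖ ≤ c * ‖f (q * t)‖) (hB : ∀ t, ‖t‖ ≤ 1 → ‖f t‖ ≤ B)
    (ht : ‖t‖ ≤ 1) : f t = 0 := by
  have hiterate (n : ℕ) : ∀ t, ‖t‖ ≤ 1 → ‖f t‖ ≤ c ^ n * B := by
    induction n with
    | zero => simpa using hB
    | succ n ih =>
      intro t ht
      rw [pow_succ', mul_assoc]
      exact (hf t ht).trans (mul_le_mul_of_nonneg_left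
        (ih _ (norm_mul_le_of_norm_le_one hq ht)) hc0)
  have hlim : Filter.Tendsto (fun n : ℕ ↦ c ^ n * B) Filter.atTop (𝓝 0) := by
    simpa using (tendsto_pow_atTop_nhds_zero_of_lt_one hc0 hc).mul_const B
  exact norm_le_zero_iff.1 (ge_of_tendsto' hlim fun n ↦ hiterate n t ht)

lemma defect_eq_zero (hq : ‖q‖ ≤ 1 / 40) (ht : ‖t‖ ≤ 1) : defect t q = 0 := by
  obtain ⟨B, hB⟩ := exists_norm_defect_le hq
  exact eq_zero_of_norm_le_mul_norm_comp_mul (f := fun t ↦ defect t q) (by norm_num) (by norm_num)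
    (hq.trans (by norm_num)) (fun t ht ↦ norm_defect_le hq ht) hB ht

/-! ### The area generating function near the origin -/

lemma solutionSeries_one (hq : ‖q‖ ≤ 1 / 40) :
    solutionSeries 1 q = q ^ 2 / (1 - q) ^ 2 + ∑' n, seriesTerm (n + 1) q := by
  rw [solutionSeries, (summable_seriesTerm_mul_pow hq (by simp)).tsum_eq_zero_add]
  simp only [one_pow, mul_one, seriesTerm, d_eq_cauchyCoeff (q := q) (by linarith : ‖q‖ < 1) 0,
    cauchyCoeff_zero, one_mul, zero_add]
  rw [show 1 - 2 * q + q ^ 2 = (1 - q) ^ 2 by ring]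

lemma hasSum_sum_rowCount (hq : ‖q‖ ≤ 1 / 40) :
    HasSum (fun n : ℕ ↦ ((∑ M ∈ Finset.range n, rowCount n M : ℕ) : ℂ) * q ^ n)
      (rowWidthSeries 1 q) := by
  have hsummable := summable_rowCount_mul_pow hq
  have hsum : HasSum (fun p : ℕ × ℕ ↦ (rowCount p.2 p.1 : ℂ) * q ^ p.2) (rowWidthSeries 1 q) := by
    rw [hsummable.hasSum_iff, hsummable.tsum_prod]
    simp only [rowWidthSeries, rowSeries, one_pow, mul_one]
  refine ((Equiv.prodComm ℕ ℕ).hasSum_iff.2 hsum).prod_fiberwise fun n ↦ ?_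
  rw [Nat.cast_sum, Finset.sum_mul]
  refine hasSum_sum_of_ne_finset_zero fun M hM ↦ ?_
  simp [rowCount_eq_zero (show n ≤ M by simpa using hM)]

lemma continuation_eq (hq : ‖q‖ ≤ 1 / 40) : continuation q =
    2 * (q * (1 - q)⁻¹ + q * (1 - 2 * q)⁻¹ + rowWidthSeries 1 q) := by
  have h1 := one_sub_ne_zero (q := q) (by linarith)
  have h2 : 1 - 2 * q ≠ 0 := one_sub_two_mul_ne_zero fun h ↦ by norm_num [h] at hq
  have hsolution : (1 - 2 * q) ^ 2 * rowWidthSeries 1 q =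
      q * (1 - q) ^ 2 * (1 - Q 1 q * solutionSeries 1 q) := by
    have h := defect_eq_zero hq (t := 1) (by simp)
    rw [defect] at h
    linear_combination h
  have hQ : qPoch (v q) q / qPoch (q * u q) q = Q 1 q := by rw [Q, mul_one, mul_one]
  rw [continuation, prefactor, hQ, ← solutionSeries_one hq, C, A,
    eq_div_of_mul_eq (pow_ne_zero 2 h2) ((mul_comm _ _).trans hsolution)]
  field_simp
  ring

lemma hasValueAt_PA_of_norm_le (hq : ‖q‖ ≤ 1 / 40) : HasValueAt PA q (continuation q) := by
  have hq2 : ‖2 * q‖ < 1 := by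
    rw [norm_mul, Complex.norm_ofNat]
    linarith
  have hones := (hasSum_geometric_of_norm_lt_one (show ‖q‖ < 1 by linarith)).mul_left q
  have hbars := (hasSum_geometric_of_norm_lt_one hq2).mul_left q
  have hrows := (hasSum_nat_add_iff' 1).2 (hasSum_sum_rowCount hq)
  simp only [Finset.sum_range_one, Finset.range_zero, Finset.sum_empty, Nat.cast_zero, zero_mul,
    sub_zero] at hrows
  rw [HasValueAt, continuation_eq hq, ← hasSum_nat_add_iff' 1]
  simp only [PA, PowerSeries.coeff_mk, Finset.sum_range_one, ncard_polygons_zero,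
    Nat.cast_zero, zero_mul, sub_zero]
  refine (((hones.add hbars).add hrows).mul_left 2).congr_fun fun n ↦ ?_
  rw [ncard_polygons_succ]
  push_cast
  rw [mul_pow, pow_succ]
  ring

/-! ### Convergence in the disc of radius `1/2` -/

lemma mem_slitDisc_of_norm_lt (hq : ‖q‖ < 1 / 2) : q ∈ slitDisc := by
  refine ⟨by linarith, fun x hx h ↦ ?_⟩
  rw [h, Complex.norm_real, Real.norm_eq_abs] at hq
  linarith [le_abs_self x, hx.1]

lemma analyticOnNhd_continuation : AnalyticOnNhd ℂ continuation slitDisc := fun _ hq ↦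
  analyticAt_continuation (slitDisc_subset hq) fun _ hk ↦ ne_zbar_of_mem_slitDisc hq hk

lemma hasValueAt_iterate_derivative {F : ℂ⟦X⟧} {f : ℂ → ℂ} {r : ℝ}
    (hf : DifferentiableOn ℂ f (Metric.ball 0 r)) (hF : ∀ᶠ q in 𝓝 (0 : ℂ), HasValueAt F q (f q))
    (i : ℕ) (hq : q ∈ Metric.ball (0 : ℂ) r) :
    HasValueAt ((PowerSeries.derivative ℂ)^[i] F) q (deriv^[i] f q) := by
  have hdiff : DifferentiableOn ℂ (deriv^[i] f) (Metric.ball 0 r) := by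
    induction i with
    | zero => exact hf
    | succ i ih =>
      rw [Function.iterate_succ_apply']
      exact ih.deriv Metric.isOpen_ball
  refine (Complex.hasSum_taylorSeries_on_ball hdiff hq).congr_fun fun n ↦ ?_
  have hcoeff : iteratedDeriv n (deriv^[i] f) 0 =
      PowerSeries.coeff (n + i) F * ((n + i).factorial : ℂ) := by
    rw [← iteratedDeriv_div_factorial_of_hasSum hF, div_mul_cancel₀ _
      (Nat.cast_ne_zero.2 (n + i).factorial_ne_zero), iteratedDeriv_eq_iterate,
      iteratedDeriv_eq_iterate, Function.iterate_add_apply]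
  have hn : (n.factorial : ℂ) ≠ 0 := Nat.cast_ne_zero.2 n.factorial_ne_zero
  rw [hcoeff, PowerSeries.coeff_iterate_derivative, ← Nat.factorial_mul_ascFactorial]
  simp only [sub_zero, smul_eq_mul]
  push_cast
  field_simp

lemma hasValueAt_iterate_derivative_PA (i : ℕ) (hq : ‖q‖ < 1 / 2) :
    HasValueAt ((PowerSeries.derivative ℂ)^[i] PA) q (deriv^[i] continuation q) := by
  refine hasValueAt_iterate_derivative (r := 1 / 2) (fun z hz ↦ ?_) ?_ i (mem_ball_zero_iff.2 hq)
  · exact (analyticOnNhd_continuation z (mem_slitDisc_of_norm_lt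
      (mem_ball_zero_iff.1 hz))).differentiableAt.differentiableWithinAt
  · filter_upwards [Metric.closedBall_mem_nhds (0 : ℂ) (by norm_num : (0 : ℝ) < 1 / 40)] with w hw
    exact hasValueAt_PA_of_norm_le (mem_closedBall_zero_iff.1 hw)

lemma eventually_hasValueAt_iterate_derivative_PA (i : ℕ) :
    ∀ᶠ q in 𝓝 0, HasValueAt ((PowerSeries.derivative ℂ)^[i] PA) q (deriv^[i] continuation q) := by
  filter_upwards [Metric.ball_mem_nhds (0 : ℂ) one_half_pos] with q hq
  exact hasValueAt_iterate_derivative_PA i (mem_ball_zero_iff.1 hq)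

/-! ### Linear independence over the polynomials -/

lemma isPreconnected_slitDisc : IsPreconnected slitDisc := by
  have h0 : (0 : ℂ) ∈ slitDisc := mem_slitDisc_of_norm_lt (by simp)
  refine (StarConvex.isPathConnected (a := (0 : ℂ)) ?_ h0).isConnected.isPreconnected
  rw [starConvex_zero_iff]
  rintro q ⟨hnorm, hslit⟩ a ha0 ha1
  refine ⟨?_, fun x hx h ↦ ?_⟩
  · rw [norm_smul, Real.norm_eq_abs, abs_of_nonneg ha0]
    exact (mul_le_of_le_one_left (norm_nonneg _) ha1).trans_lt hnorm
  have ha : 0 < a := by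
    refine ha0.lt_of_ne' fun ha ↦ ?_
    rw [ha, zero_smul] at h
    linarith [hx.1, Complex.ofReal_eq_zero.1 h.symm]
  have hq : q = ((x / a : ℝ) : ℂ) := by
    rw [Complex.ofReal_div, ← h, Complex.real_smul,
      mul_div_cancel_left₀ _ (Complex.ofReal_ne_zero.2 ha.ne')]
  refine hslit (x / a) ⟨hx.1.trans (le_div_self (by linarith [hx.1]) ha ha1), ?_⟩ hq
  rw [hq, Complex.norm_real] at hnorm
  exact (le_abs_self _).trans hnorm.le

lemma frequently_mem_slitDisc {x : ℝ} (hx : ‖(x : ℂ)‖ < 55 / 100) :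
    ∃ᶠ q in 𝓝[≠] (x : ℂ), q ∈ slitDisc := by
  have hlim : Filter.Tendsto (fun n : ℕ ↦ (x : ℂ) + (1 / ((n : ℝ) + 1) : ℝ) * Complex.I)
      Filter.atTop (𝓝 (x : ℂ)) := by
    simpa using ((Complex.continuous_ofReal.tendsto 0).comp
      (tendsto_one_div_add_atTop_nhds_zero_nat (𝕜 := ℝ))).mul_const Complex.I |>.const_add (x : ℂ)
  have hnonreal (n : ℕ) (y : ℝ) : (x : ℂ) + (1 / ((n : ℝ) + 1) : ℝ) * Complex.I ≠ y := by
    intro h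
    have him := congrArg Complex.im h
    rw [Complex.add_im, Complex.im_ofReal_mul, Complex.ofReal_im, Complex.ofReal_im, Complex.I_im,
      mul_one, zero_add] at him
    exact (by positivity : (1 / ((n : ℝ) + 1)) ≠ 0) him
  refine Filter.Tendsto.frequently (tendsto_nhdsWithin_iff.2
    ⟨hlim, .of_forall fun n ↦ hnonreal n x⟩) (Filter.Eventually.frequently ?_)
  filter_upwards [hlim.norm.eventually_lt_const hx] with n hn
  exact ⟨hn, fun y _ ↦ hnonreal n y⟩

lemma lt_meromorphicOrderAt_sum {ι : Type*} {f : ι → ℂ → ℂ} {b : WithTop ℤ} {s : Finset ι}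
    (hb : b ≠ ⊤) (hf : ∀ i, MeromorphicAt (f i) z)
    (hlt : ∀ i ∈ s, b < meromorphicOrderAt (f i) z) :
    b < meromorphicOrderAt (∑ i ∈ s, f i) z := by
  induction s using Finset.cons_induction with
  | empty =>
    rw [Finset.sum_empty, (meromorphicOrderAt_eq_top_iff (f := (0 : ℂ → ℂ))).2 (by simp)]
    exact hb.lt_top
  | cons i s hi ih =>
    rw [Finset.sum_cons]
    exact (lt_min (hlt i (Finset.mem_cons_self i s)) (ih fun j hj ↦ hlt j
      (Finset.mem_cons_of_mem hj))).trans_le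
      (meromorphicOrderAt_add (hf i) (MeromorphicAt.sum fun j _ ↦ hf j))

lemma meromorphicOrderAt_sum_range_succ {f : ℕ → ℂ → ℂ} {r : ℕ}
    (hf : ∀ i, MeromorphicAt (f i) z) (htop : meromorphicOrderAt (f r) z ≠ ⊤)
    (hlt : ∀ i < r, meromorphicOrderAt (f r) z < meromorphicOrderAt (f i) z) :
    meromorphicOrderAt (∑ i ∈ Finset.range (r + 1), f i) z = meromorphicOrderAt (f r) z := by
  rw [Finset.sum_range_succ]
  exact meromorphicOrderAt_add_eq_right_of_lt (MeromorphicAt.sum fun i _ ↦ hf i)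
    (lt_meromorphicOrderAt_sum htop hf fun i hi ↦ hlt i (Finset.mem_range.1 hi))

section LinearRelation

variable {D : Set ℂ} {G : ℕ → ℂ⟦X⟧} {g : ℕ → ℂ → ℂ} {r : ℕ} {p : ℕ → ℂ[X]}

lemma analyticAt_polynomial_eval (p : ℂ[X]) (z : ℂ) : AnalyticAt ℂ (fun q ↦ p.eval q) z :=
  p.differentiable.analyticAt z

lemma eqOn_zero_of_sum_coe_mul_eq_zero (hD : IsPreconnected D) (h0 : 0 ∈ D)
    (hG : ∀ i, ∀ᶠ q in 𝓝 (0 : ℂ), HasValueAt (G i) q (g i q))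
    (hg : ∀ i, AnalyticOnNhd ℂ (g i) D)
    (h : ∑ i ∈ Finset.range r, (p i : ℂ⟦X⟧) * G i = 0) :
    Set.EqOn (∑ i ∈ Finset.range r, (fun q ↦ (p i).eval q) * g i) 0 D := by
  have hanalytic : AnalyticOnNhd ℂ (∑ i ∈ Finset.range r, (fun q ↦ (p i).eval q) * g i) D :=
    Finset.analyticOnNhd_sum _ fun i _ q hq ↦ (analyticAt_polynomial_eval (p i) q).mul (hg i q hq)
  refine hanalytic.eqOn_zero_of_preconnected_of_eventuallyEq_zero hD h0 ?_
  filter_upwards [(Finset.range r).eventually_all.2 fun i _ ↦ hG i] with q hq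
  have hsum := HasValueAt.sum fun i hi ↦ (hasValueAt_coe_polynomial (p i) q).mul (hq i hi)
  rw [h] at hsum
  have hzero : HasValueAt 0 q 0 := by simpa using hasValueAt_coe_polynomial 0 q
  simpa using hsum.unique hzero

/-- At a point of `Z` where `p r` does not vanish, the last summand has a pole of larger order than
all the others, so that the sum cannot vanish near that point. -/
lemma sum_coe_mul_ne_zero {Z : Set ℂ} {m : ℕ → ℤ} (hD : IsPreconnected D) (h0 : 0 ∈ D)
    (hZ : Z.Infinite) (hDZ : ∀ z ∈ Z, ∃ᶠ q in 𝓝[≠] z, q ∈ D) (hm : StrictAnti m)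
    (hG : ∀ i, ∀ᶠ q in 𝓝 (0 : ℂ), HasValueAt (G i) q (g i q))
    (hg : ∀ i, AnalyticOnNhd ℂ (g i) D) (hmer : ∀ i, ∀ z ∈ Z, MeromorphicAt (g i) z)
    (hord : ∀ i, ∀ z ∈ Z, meromorphicOrderAt (g i) z = m i) (hp : p r ≠ 0) :
    ∑ i ∈ Finset.range (r + 1), (p i : ℂ⟦X⟧) * G i ≠ 0 := by
  intro h
  obtain ⟨z, hz, hpz⟩ : ∃ z ∈ Z, (p r).eval z ≠ 0 := by
    by_contra! hroot
    exact hp (Polynomial.eq_zero_of_infinite_isRoot _ (hZ.mono hroot))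
  set term : ℕ → ℂ → ℂ := fun i ↦ (fun q ↦ (p i).eval q) * g i
  have hp_mer (i : ℕ) := (analyticAt_polynomial_eval (p i) z).meromorphicAt
  have hterm_mer (i : ℕ) : MeromorphicAt (term i) z := (hp_mer i).mul (hmer i z hz)
  have hterm_le (i : ℕ) : (m i : WithTop ℤ) ≤ meromorphicOrderAt (term i) z := by
    rw [meromorphicOrderAt_mul (hp_mer i) (hmer i z hz), hord i z hz]
    exact le_add_of_nonneg_left (analyticAt_polynomial_eval (p i) z).meromorphicOrderAt_nonneg
  have hterm_r : meromorphicOrderAt (term r) z = m r := by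
    rw [meromorphicOrderAt_mul_of_ne_zero (analyticAt_polynomial_eval (p r) z) hpz, hord r z hz]
  have hsum_order := meromorphicOrderAt_sum_range_succ hterm_mer
    (hterm_r ▸ WithTop.coe_ne_top) fun i hi ↦
      hterm_r.trans_lt ((WithTop.coe_lt_coe.2 (hm hi)).trans_le (hterm_le i))
  have hsum_zero := (((MeromorphicAt.sum fun i _ ↦ hterm_mer i).frequently_eq_iff_eventuallyEq
    (MeromorphicAt.const 0 z)).1 ((hDZ z hz).mono fun q hq ↦
      eqOn_zero_of_sum_coe_mul_eq_zero hD h0 hG hg h hq))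
  rw [meromorphicOrderAt_eq_top_iff.2 hsum_zero, hterm_r] at hsum_order
  exact WithTop.top_ne_coe hsum_order

end LinearRelation

lemma infinite_zbar : ((fun k ↦ (zbar k : ℂ)) '' Set.Ici 2).Infinite :=
  (Set.Ici_infinite 2).image fun _ hj _ hk h ↦ zbar_injective hj hk (Complex.ofReal_injective h)

lemma meromorphicAt_zbar {k : ℕ} (hk : 2 ≤ k) : MeromorphicAt continuation (zbar k) :=
  meromorphicOn_continuation _ (zbar_mem_puncturedDisc hk)

lemma sum_coe_mul_ne_zero_of_order_zbar {G : ℕ → ℂ⟦X⟧} {g : ℕ → ℂ → ℂ} {m : ℕ → ℤ} {r : ℕ}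
    {p : ℕ → ℂ[X]} (hm : StrictAnti m)
    (hG : ∀ i, ∀ᶠ q in 𝓝 (0 : ℂ), HasValueAt (G i) q (g i q))
    (hg : ∀ i, AnalyticOnNhd ℂ (g i) slitDisc)
    (hmer : ∀ i k, 2 ≤ k → MeromorphicAt (g i) (zbar k))
    (hord : ∀ i k, 2 ≤ k → meromorphicOrderAt (g i) (zbar k) = m i) (hp : p r ≠ 0) :
    ∑ i ∈ Finset.range (r + 1), (p i : ℂ⟦X⟧) * G i ≠ 0 :=
  sum_coe_mul_ne_zero isPreconnected_slitDisc (mem_slitDisc_of_norm_lt (by simp)) infinite_zbar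
    (Set.forall_mem_image.2 fun _ hk ↦ frequently_mem_slitDisc (norm_zbar_lt hk)) hm hG hg
    (fun i ↦ Set.forall_mem_image.2 (hmer i)) (fun i ↦ Set.forall_mem_image.2 (hord i)) hp

lemma meromorphicOrderAt_iterate_deriv_continuation (i : ℕ) {k : ℕ} (hk : 2 ≤ k) :
    meromorphicOrderAt (deriv^[i] continuation) (zbar k) = ((-1 - i : ℤ) : WithTop ℤ) := by
  induction i with
  | zero => simpa using meromorphicOrderAt_continuation hk
  | succ i ih =>
    rw [Function.iterate_succ_apply', meromorphicOrderAt_deriv_eq_sub_one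
      (Int.cast_ne_zero.2 (by omega)) ih]
    congr 1
    push_cast
    ring

lemma not_isHolonomic_PA : ¬ IsHolonomic PA := by
  rintro ⟨r, p, hp, h⟩
  exact sum_coe_mul_ne_zero_of_order_zbar (m := fun i ↦ -1 - i)
    (fun i j hij ↦ by dsimp only; omega) eventually_hasValueAt_iterate_derivative_PA
    (fun i ↦ analyticOnNhd_continuation.iterated_deriv i)
    (fun i k hk ↦ (meromorphicAt_zbar hk).iterated_deriv)
    (fun i k hk ↦ meromorphicOrderAt_iterate_deriv_continuation i hk) hp h

lemma transcendental_PA : Transcendental ℂ[X] PA := by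
  rw [transcendental_iff]
  intro P hP
  by_contra hne
  refine sum_coe_mul_ne_zero_of_order_zbar (m := fun i ↦ -i) (G := fun i ↦ PA ^ i)
    (g := fun i ↦ continuation ^ i) (p := P.coeff) (fun i j hij ↦ by dsimp only; omega)
    (fun i ↦ (eventually_hasValueAt_iterate_derivative_PA 0).mono fun q hq ↦ hq.pow i)
    (fun i ↦ analyticOnNhd_continuation.pow i) (fun i k hk ↦ (meromorphicAt_zbar hk).pow i)
    (fun i k hk ↦ ?_) (Polynomial.leadingCoeff_ne_zero.2 hne) ?_
  · rw [meromorphicOrderAt_pow (meromorphicAt_zbar hk), meromorphicOrderAt_continuation hk,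
      ← mul_neg_one (i : ℤ), WithTop.coe_mul]
    rfl
  · rw [Polynomial.aeval_eq_sum_range] at hP
    simpa only [Algebra.smul_def] using! hP

end Prudent

open Prudent in
theorem lemma3p2 :
    -- there are finitely many 3-sided prudent polygons of each area
    (∀ n : ℕ, (polygons n).Finite) ∧
    -- the points `zbar k`, `k ≥ 2`
    (∀ k : ℕ, 2 ≤ k →
      1 / 2 < zbar k ∧ zbar k < 55 / 100 ∧ 1 - 2 * zbar k + zbar k ^ (k + 2) = 0 ∧
      ∀ x : ℝ, 0 < x → x < 1 → 1 - 2 * x + x ^ (k + 2) = 0 → x = zbar k) ∧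
    Filter.Tendsto zbar Filter.atTop (𝓝 (1 / 2)) ∧
    (∃ f : ℂ → ℂ,
      -- `f` continues the sum of the power series `PA`
      (∀ q : ℂ, ‖q‖ < 1 / 2 → HasSum (fun n : ℕ => PowerSeries.coeff n PA * q ^ n) (f q)) ∧
      AnalyticOnNhd ℂ f slitDisc ∧
      -- the series representation, with non-vanishing denominators
      (∀ q ∈ slitDisc,
        qPoch (q * u q) q ≠ 0 ∧
        (∀ ν : ℕ, 1 ≤ ν → 1 - 2 * q + q ^ (ν + 2) ≠ 0) ∧
        ∃ s : ℂ,
          HasSum (fun n : ℕ => d (n + 1) q * (q ^ (n + 1 + 2) / (1 - 2 * q + q ^ (n + 1 + 2)))) s ∧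
          f q = C q - A q * (qPoch (v q) q / qPoch (q * u q) q) * (q ^ 2 / (1 - q) ^ 2 + s)) ∧
      -- meromorphy in the punctured disc, with simple poles exactly at the `zbar k`, `k ≥ 2`
      MeromorphicOn f puncturedDisc ∧
      (∀ k : ℕ, 2 ≤ k → meromorphicOrderAt f (zbar k : ℂ) = ((-1 : ℤ) : WithTop ℤ)) ∧
      (∀ q ∈ puncturedDisc, (∀ k : ℕ, 2 ≤ k → q ≠ (zbar k : ℂ)) → AnalyticAt ℂ f q)) ∧
    ¬ IsHolonomic PA ∧
    Transcendental ℂ[X] PA := by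
  refine ⟨finite_polygons,
    fun k hk ↦ ⟨half_lt_zbar hk, zbar_lt hk, (zbar_spec hk).2.2, fun x ↦ eq_zbar hk⟩,
    tendsto_zbar, ⟨continuation, fun q hq ↦ hasValueAt_iterate_derivative_PA 0 hq,
      analyticOnNhd_continuation, fun q hq ↦ ?_, meromorphicOn_continuation,
      fun k hk ↦ meromorphicOrderAt_continuation hk, fun q hq h ↦ analyticAt_continuation hq h⟩,
    not_isHolonomic_PA, transcendental_PA⟩
  exact ⟨qPoch_mul_u_ne_zero hq.1.le,
    fun ν hν ↦ denom_ne_zero hν hq.1 fun h ↦ ne_zbar_of_mem_slitDisc hq h,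
    ∑' n, seriesTerm (n + 1) q, (summable_seriesTerm (slitDisc_subset hq)).hasSum, rfl⟩
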